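/- **Setting.** Let $k$ be a field and $(X,\Delta=\sum D_i)$ an snc pair over $k$: $X$ is a smooth variety over $k$, and near every point there are local coordinates $x_1,\dots,x_n$ (defining an étale morphism to $\mathbb A^n_k$) such that the finitely many irreducible components $D_i$ passing through that point are among the hypersurfaces $(x_j=0)$. A *stratum* is an irreducible component of some intersection $D_{i_1}\cap\dots\cap D_{i_r}$ with $r\ge 1$. Let $J\subset\mathcal O_X$ be a (quasi-coherent) ideal sheaf. For a point $x$, $\operatorname{mult}_xJ$ is the largest $m$ with $J_x\subset\mathfrak m_x^m$ ($\infty$ if there is none); for an irreducible closed $W$, $\operatorname{mult}_WJ$ is the multiplicity at the generic point of $W$. An ideal sheaf is *toroidal* if, locally on $X$, it is a sum of ideal sheaves $\mathcal O_X(-\sum_i m_iD_i)$ with $m_i\in\mathbb N$. The *toroidal hull* $J^t$ is the smallest toroidal ideal sheaf containing $J$. A *blow-up sequence* starting from $(X,\Delta)$ is a sequence $(X_n,\Delta_n)\to\dots\to(X_0,\Delta_0)=(X,\Delta)$ in which each $\pi_i:X_{i+1}\to X_i$ is the blow-up of a closed (reduced) subscheme $Z_i\subset X_i$ and $\Delta_{i+1}=(\pi_i)^{-1}_*\Delta_i+E_{i+1}$,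 with $E_{i+1}$ the exceptional divisor. It is *toroidal* if every $Z_i$ is a disjoint union of strata of $(X_i,\Delta_i)$. Given an ideal sheaf $I_0=I$ on $X$, and whenever $I_i$ has multiplicity $m_i$ along $Z_i$ in one of the two senses below, put $I_{i+1}:=\mathcal O_{X_{i+1}}(m_iE_{i+1})\cdot\pi_i^*I_i$, required to be an ideal sheaf on $X_{i+1}$. * The sequence is *toroidally equimultiple for $I$* if it is toroidal and, for every $i$, there is an $m_i\in\mathbb N$ with $\operatorname{mult}_WI_i=m_i$ for every stratum $W\subset Z_i$. * The sequence is *equimultiple for $I$* if, for every $i$, $Z_i$ is smooth, nowhere dense and has normal crossings with $\Delta_i$, and there is an $m_i\in\mathbb N$ with $\operatorname{mult}_zI_i=m_i$ for every $z\in Z_i$. **Proposition.** The toroidal hull $J^t$ exists, and the following three sets of blow-up sequences starting from $(X,\Delta)$ are equal: 1. toroidally equimultiple blow-up sequences for $J$; 2. toroidally equimultiple blow-up sequences for $J^t$; 3. toroidal blow-up sequences that are equimultiple for $J^t$. -/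

import Mathlib

open AlgebraicGeometry CategoryTheory TopologicalSpace

universe u

noncomputable section

namespace Toroidal

/-! ### Multiplicity of an ideal sheaf -/

/-- The stalk `J_x ⊆ 𝒪_{X,x}` of an ideal sheaf. -/
def stalkIdeal {X : Scheme.{u}} (J : X.IdealSheafData) (x : X) : Ideal (X.presheaf.stalk x) :=
  ⨆ (U : X.affineOpens) (h : x ∈ U.1), (J.ideal U).map (X.presheaf.germ U.1 x h).hom

/-- `mult_x J`: the supremum of all `m` with `J_x ⊆ 𝔪_x ^ m`; it is `⊤` if there is no largest such
`m`. -/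
def mult {X : Scheme.{u}} (J : X.IdealSheafData) (x : X) : ℕ∞ :=
  ⨆ (m : ℕ) (_ : stalkIdeal J x ≤ IsLocalRing.maximalIdeal (X.presheaf.stalk x) ^ m), (m : ℕ∞)

/-- `mult_W J`: the multiplicity at the generic point of the irreducible closed subset `W`. -/
def multAlong {X : Scheme.{u}} (J : X.IdealSheafData) (W : IrreducibleCloseds X) : ℕ∞ :=
  mult J W.isIrreducible.genericPoint

/-! ### Blow-ups -/

/-- The ideal sheaf of an effective Cartier divisor: locally generated by one non-zero-divisor. -/
def IsCartier {X : Scheme.{u}} (I : X.IdealSheafData) : Prop :=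
  ∀ x : X, ∃ U : X.affineOpens, x ∈ U.1 ∧
    ∃ a : Γ(X, U.1), a ∈ nonZeroDivisors Γ(X, U.1) ∧ I.ideal U = Ideal.span {a}

/-- `π : B ⟶ X` is the blow-up of the ideal sheaf `I`, that is, the universal morphism to `X` for
which the inverse image ideal sheaf of `I` is the ideal sheaf of an effective Cartier divisor. -/
def IsBlowUp {X B : Scheme.{u}} (π : B ⟶ X) (I : X.IdealSheafData) : Prop :=
  IsCartier (I.comap π) ∧
    ∀ (T : Scheme.{u}) (f : T ⟶ X), IsCartier (I.comap f) → ∃! g : T ⟶ B, g ≫ π = f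

/-! ### Pairs, strata, simple normal crossings -/

/-- A pair `(X, Δ = ∑ D_i)` over `k`: a `k`-scheme and a finite set of distinct irreducible closed
subsets `D_i`. -/
structure LogPair (k : Type u) [Field k] where
  /-- the scheme -/
  X : Scheme.{u}
  /-- the structure morphism -/
  hom : X ⟶ Spec (CommRingCat.of k)
  /-- the irreducible components `D_i` of `Δ` -/
  Δ : Finset (IrreducibleCloseds X)

variable {k : Type u} [Field k]

namespace LogPair

variable (P : LogPair k)

/-- The structure map `k → Γ(X, U)`. -/
def scalars (U : P.X.Opens) : k →+* Γ(P.X, U) :=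
  ((Scheme.ΓSpecIso (CommRingCat.of k)).inv ≫ P.hom.appTop ≫
    P.X.presheaf.map (homOfLE le_top).op).hom

/-- `x_1, …, x_n` are local coordinates on the affine open `U`: the morphism `U → 𝔸ⁿ_k` that they
define is étale. -/
def IsCoordinates (U : P.X.affineOpens) {n : ℕ} (x : Fin n → Γ(P.X, U.1)) : Prop :=
  (MvPolynomial.eval₂Hom (P.scalars U.1) x).Etale

/-- Every `D_i` that passes through `p` is given on `U` as `(x_j = 0)` for one of the functions
`x_j`. (If the `x_j` are local coordinates then `(x_j = 0)` is reduced, and distinct `D_i` belong to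
distinct `x_j`.) -/
def IsAdapted (p : P.X) (U : P.X.affineOpens) {n : ℕ} (x : Fin n → Γ(P.X, U.1)) : Prop :=
  ∀ D ∈ P.Δ, p ∈ D → ∃ j : Fin n, ∀ q ∈ U.1, q ∈ D ↔ q ∉ P.X.basicOpen (x j)

/-- `(X, Δ)` is an snc pair over `k`: `X` is a smooth variety over `k`, and near every point there
are local coordinates `x_1, …, x_n` such that the `D_i` through that point are among the coordinate
hyperplanes `(x_j = 0)`. -/
structure IsSnc : Prop where
  isIntegral : IsIntegral P.X
  isSeparated : IsSeparated P.hom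
  quasiCompact : QuasiCompact P.hom
  smooth : Smooth P.hom
  exists_coordinates : ∀ p : P.X, ∃ (U : P.X.affineOpens) (n : ℕ) (x : Fin n → Γ(P.X, U.1)),
    p ∈ U.1 ∧ P.IsCoordinates U x ∧ P.IsAdapted p U x

/-- A closed stratum: an irreducible component of an intersection `D_{i_1} ∩ ⋯ ∩ D_{i_r}` with
`r ≥ 1`. -/
def IsStratum (W : IrreducibleCloseds P.X) : Prop :=
  ∃ s : Finset (IrreducibleCloseds P.X), s.Nonempty ∧ s ⊆ P.Δ ∧
    Maximal (fun V : IrreducibleCloseds P.X => (V : Set P.X) ⊆ ⋂ D ∈ s, (D : Set P.X)) W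

/-- `Z` is a disjoint union of strata. -/
def IsToroidalCenter (Z : Closeds P.X) : Prop :=
  ∃ 𝒲 : Set (IrreducibleCloseds P.X), (∀ W ∈ 𝒲, P.IsStratum W) ∧
    (∀ V ∈ 𝒲, ∀ W ∈ 𝒲, V ≠ W → Disjoint (V : Set P.X) (W : Set P.X)) ∧
    (Z : Set P.X) = ⋃ W ∈ 𝒲, (W : Set P.X)

/-- `Z` is smooth, nowhere dense and has normal crossings with `Δ`: near every point of `Z` there
are local coordinates `x_1, …, x_n` such that `Z` is given by the vanishing of some of them, and the
`D_i` through that point are among the coordinate hyperplanes. -/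
def HasNormalCrossings (Z : Closeds P.X) : Prop :=
  ∀ p ∈ Z, ∃ (U : P.X.affineOpens) (n : ℕ) (x : Fin n → Γ(P.X, U.1)),
    p ∈ U.1 ∧ P.IsCoordinates U x ∧ P.IsAdapted p U x ∧
    ∃ s : Finset (Fin n), s.Nonempty ∧ ∀ q ∈ U.1, q ∈ Z ↔ ∀ j ∈ s, q ∉ P.X.basicOpen (x j)

/-! ### Toroidal ideal sheaves and the toroidal hull -/

/-- The ideal sheaf `𝒪_X(-∑ m_i D_i)`. -/
def divisorIdeal (m : IrreducibleCloseds P.X → ℕ) : P.X.IdealSheafData :=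
  ∏ D ∈ P.Δ, Scheme.IdealSheafData.vanishingIdeal (⟨D, D.isClosed⟩ : Closeds P.X) ^ m D

/-- `I` is toroidal: `X` is covered by (affine) opens on each of which `I` is a sum of ideal sheaves
of the form `𝒪(-∑ m_i D_i)`. -/
def IsToroidal (I : P.X.IdealSheafData) : Prop :=
  ∀ p : P.X, ∃ U : P.X.affineOpens, p ∈ U.1 ∧
    ∃ M : Set (IrreducibleCloseds P.X → ℕ), I.ideal U = ⨆ m ∈ M, (P.divisorIdeal m).ideal U

/-- The toroidal hull `Jᵗ`: the smallest toroidal ideal sheaf containing `J`. -/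
def toroidalHull (J : P.X.IdealSheafData) : P.X.IdealSheafData :=
  sInf {I | P.IsToroidal I ∧ J ≤ I}

/-! ### Equimultiplicity -/

/-- `J` is equimultiple along `Z`, with multiplicity `m`. -/
def IsEquimultiple (J : P.X.IdealSheafData) (Z : Closeds P.X) (m : ℕ) : Prop :=
  ∀ z ∈ Z, mult J z = m

/-- `J` is toroidally equimultiple along `Z`, with multiplicity `m`: `mult_W J = m` for all strata
`W ⊆ Z`. -/
def IsToroidallyEquimultiple (J : P.X.IdealSheafData) (Z : Closeds P.X) (m : ℕ) : Prop :=
  ∀ W : IrreducibleCloseds P.X, P.IsStratum W → (W : Set P.X) ⊆ Z → multAlong J W = m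

end LogPair

/-! ### Blow-up sequences -/

/-- A blow-up `(X', Δ') → (X, Δ)` of a closed (reduced) subscheme `Z ⊆ X`, where
`Δ' = ∑ π⁻¹_* D_i + ∑ E_j`. -/
structure PairBlowUp (P P' : LogPair k) where
  /-- the center of the blow-up -/
  Z : Closeds P.X
  /-- the blow-up morphism -/
  π : P'.X ⟶ P.X
  isBlowUp : IsBlowUp π (Scheme.IdealSheafData.vanishingIdeal Z)
  hom_eq : P'.hom = π ≫ P.hom
  /-- The components of `Δ'` are the birational transforms of those `D_i` that are not contained
  in `Z`, and the irreducible components `E_j` of `π⁻¹(Z)`. -/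
  mem_Δ_iff : ∀ D' : IrreducibleCloseds P'.X, D' ∈ P'.Δ ↔
    (∃ D ∈ P.Δ, ¬ (D : Set P.X) ⊆ Z ∧ (D' : Set P'.X) = closure (π ⁻¹' ((D : Set P.X) \ Z))) ∨
    Maximal (fun E : IrreducibleCloseds P'.X => (E : Set P'.X) ⊆ π ⁻¹' (Z : Set P.X)) D'

/-- The ideal sheaf `𝒪_{X'}(-E)` of the exceptional divisor `E` of a blow-up. -/
def PairBlowUp.exceptionalIdeal {P P' : LogPair k} (b : PairBlowUp P P') : P'.X.IdealSheafData :=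
  (Scheme.IdealSheafData.vanishingIdeal b.Z).comap b.π

/-- `J'` is the birational transform `𝒪_{X'}(mE) · π^* J`. Since `𝒪_{X'}(-E)` is invertible, this
means `𝒪_{X'}(-mE) · J' = π^* J`, which determines `J'`. -/
def PairBlowUp.IsBirationalTransform {P P' : LogPair k} (b : PairBlowUp P P') (m : ℕ)
    (J : P.X.IdealSheafData) (J' : P'.X.IdealSheafData) : Prop :=
  b.exceptionalIdeal ^ m * J' = J.comap b.π

/-- Sequences of blow-ups `(X_n, Δ_n) → ⋯ → (X_0, Δ_0)` that start from `(X_0, Δ_0) = P`. -/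
inductive BlowUpSequence : LogPair k → Type (u + 1)
  | nil (P : LogPair k) : BlowUpSequence P
  | cons {P P' : LogPair k} (b : PairBlowUp P P') (S : BlowUpSequence P') : BlowUpSequence P

namespace BlowUpSequence

/-- All centers of the sequence are toroidal, that is, disjoint unions of strata. -/
def IsToroidal : {P : LogPair k} → BlowUpSequence P → Prop
  | _, nil _ => True
  | _, cons (P := P) b S => P.IsToroidalCenter b.Z ∧ S.IsToroidal

/-- The sequence is toroidally equimultiple for `J_0 = J`: every center `Z_i` is toroidal,
`J_i` is toroidally equimultiple along `Z_i`, and `J_{i+1}` is the birational transform of `J_i`. -/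
def IsToroidallyEquimultiple :
    {P : LogPair k} → BlowUpSequence P → P.X.IdealSheafData → Prop
  | _, nil _, _ => True
  | _, cons (P := P) b S, J => P.IsToroidalCenter b.Z ∧
      ∃ m, P.IsToroidallyEquimultiple J b.Z m ∧
        ∃ J', b.IsBirationalTransform m J J' ∧ S.IsToroidallyEquimultiple J'

/-- The sequence is equimultiple for `J_0 = J`: every center `Z_i` is smooth and has normal crossings
with `Δ_i`, `J_i` is equimultiple along `Z_i`, and `J_{i+1}` is the birational transform of `J_i`. -/
def IsEquimultiple :
    {P : LogPair k} → BlowUpSequence P → P.X.IdealSheafData → Prop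
  | _, nil _, _ => True
  | _, cons (P := P) b S, J => P.HasNormalCrossings b.Z ∧
      ∃ m, P.IsEquimultiple J b.Z m ∧
        ∃ J', b.IsBirationalTransform m J J' ∧ S.IsEquimultiple J'

end BlowUpSequence

/-- The toroidally equimultiple blow-up sequences for `J`, starting from `P = (X, Δ)`. -/
def toroidallyEquimultipleSequences (P : LogPair k) (J : P.X.IdealSheafData) :
    Set (BlowUpSequence P) :=
  {S | S.IsToroidallyEquimultiple J}

/-- The equimultiple blow-up sequences for `J` with toroidal centers, starting from
`P = (X, Δ)`. -/
def equimultipleToroidalSequences (P : LogPair k) (J : P.X.IdealSheafData) :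
    Set (BlowUpSequence P) :=
  {S | S.IsToroidal ∧ S.IsEquimultiple J}

end Toroidal

end

/-! ### Ideals under flat ring homomorphisms -/

namespace Toroidal

section Flat

open TensorProduct

variable {R O : Type*} [CommRing R] [CommRing O]

/-! Near a point an snc pair is étale over affine space, with the components of `Δ` as coordinate
hyperplanes, so there toroidal ideals are extensions of monomial ideals. The local rings are flat
over the polynomial ring, and the coordinates vanishing at the point generate prime ideals
(`IsToricFrame`). Hence colons, finite intersections and contractions of toroidal ideals can be
computed on sets of exponents.

A toroidal ideal is determined by its stalks at the finitely many generic points of `X` and of the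
strata (`le_of_forall_isStratumPoint`, `finite_setOf_isStratumPoint`). At one point, Krull's theorem
gives a least monomial ideal that contains `J` (`le_map_monomialIdeal_iInter`). Primary
decomposition, followed by contraction from generic points of strata, realizes it by a global
toroidal ideal (`exists_isToroidal_stalkIdeal_le`). Intersecting over the stratum points gives the
hull.

At a stratum point, the contraction of a power of the maximal ideal is toroidal, so it contains `J`
if and only if it contains the hull: both have the same multiplicity along each stratum
(`mult_toroidalHull`). The multiplicity of a toroidal ideal at a point of a toroidal center equals
that at the generic point of the smallest stratum through it, so for the hull the two notions of
equimultiplicity agree (`isEquimultiple_iff`). Toroidal centers also have normal crossings.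

It remains to see that hulls commute with birational transforms; then one inducts on the sequence.
In charts the blow-up is the monomial substitution `X_j ↦ X_j X_i`. The crux is that a monomial
ideal upstairs contracts into the monomial ideal of the preimage exponents
(`comap_map_monomialIdeal_blowUp`), so a toroidal ideal containing the pull-back of `J` contains
that of the hull (`comap_toroidalHull_le`). Division by the exceptional divisor, which is Cartier
and toroidal, does the rest (`isBirationalTransform_toroidalHull`).

The blow-ups are given by a universal property only. Their charts are therefore first identified
with open subschemes (`exists_affineOpens`) and the new boundary with coordinate hyperplanes. The
hypothesis carried through the induction is `IsLocallySnc`. -/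

theorem mem_map_ker_iff_tmul [Algebra R O] [Module.Flat R O] {M : Type*} [AddCommGroup M]
    [Module R M] (g : R →ₗ[R] M) (x : O) :
    x ∈ Ideal.map (algebraMap R O) (LinearMap.ker g) ↔ x ⊗ₜ[R] g 1 = 0 := by
  let I : Ideal R := LinearMap.ker g
  let g' : (R ⧸ I) →ₗ[R] M := Submodule.liftQ I g le_rfl
  have hg' : Function.Injective g' := by
    rw [← LinearMap.ker_eq_bot]
    exact Submodule.ker_liftQ_eq_bot _ _ _ le_rfl
  have h1 : x ∈ Ideal.map (algebraMap R O) I ↔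
      x ⊗ₜ[R] (Ideal.Quotient.mk I 1 : R ⧸ I) = 0 := by
    rw [← (TensorProduct.tensorQuotEquivQuotSMul O I).map_eq_zero_iff,
      TensorProduct.tensorQuotEquivQuotSMul_tmul_mk, one_smul, Submodule.Quotient.mk_eq_zero,
      Ideal.smul_top_eq_map, Submodule.restrictScalars_mem]
  -- `R ⧸ I` embeds into `M`, and flatness keeps this injective after tensoring with `O`.
  have h2 := Module.Flat.lTensor_preserves_injective_linearMap (M := O) g' hg'
  rw [show LinearMap.ker g = I from rfl, h1, ← (injective_iff_map_eq_zero' _).mp h2]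
  simp only [LinearMap.lTensor_tmul]
  rfl

/-- `I ⊓ J` is the kernel of `R → (R ⧸ I) × (R ⧸ J)`, and flat base change preserves kernels. -/
theorem flat_map_inf {ψ : R →+* O} (hψ : ψ.Flat) (I J : Ideal R) :
    (I ⊓ J).map ψ = I.map ψ ⊓ J.map ψ := by
  refine le_antisymm (Ideal.map_inf_le _) fun x hx => ?_
  algebraize [ψ]
  let g : R →ₗ[R] (R ⧸ I) × (R ⧸ J) := (Submodule.mkQ I).prod (Submodule.mkQ J)
  have hg : LinearMap.ker g = I ⊓ J := by
    simp [g, LinearMap.ker_prod]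
  have key := (mem_map_ker_iff_tmul (O := O) g x).mpr
  rw [hg] at key
  refine key ?_
  have hI := (mem_map_ker_iff_tmul (O := O) (Submodule.mkQ I) x).mp (by
    rw [Submodule.ker_mkQ]; exact hx.1)
  have hJ := (mem_map_ker_iff_tmul (O := O) (Submodule.mkQ J) x).mp (by
    rw [Submodule.ker_mkQ]; exact hx.2)
  apply (TensorProduct.prodRight R R O (R ⧸ I) (R ⧸ J)).injective
  rw [map_zero]
  refine Prod.ext ?_ ?_
  · exact hI
  · exact hJ

theorem flat_map_biInf {ψ : R →+* O} (hψ : ψ.Flat) {ι : Type*} (s : Finset ι) (I : ι → Ideal R) :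
    (⨅ i ∈ s, I i).map ψ = ⨅ i ∈ s, (I i).map ψ := by
  classical
  induction s using Finset.induction_on with
  | empty => simp [Ideal.map_top]
  | insert a s ha ih => rw [Finset.iInf_insert, Finset.iInf_insert, flat_map_inf hψ, ih]

/-- The colon `(I : r)` is the kernel of `p ↦ r p` into `R ⧸ I`, which flat base change preserves.
-/
theorem flat_colon {ψ : R →+* O} (hψ : ψ.Flat) {I J : Ideal R} {r : R}
    (hJ : ∀ p, r * p ∈ I → p ∈ J) {y : O} (hy : ψ r * y ∈ I.map ψ) : y ∈ J.map ψ := by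
  algebraize [ψ]
  let g : R →ₗ[R] (R ⧸ I) := (Submodule.mkQ I).comp (LinearMap.mulLeft R r)
  have hg : LinearMap.ker g ≤ J := by
    intro p hp
    apply hJ
    have hp' : (Ideal.Quotient.mk I (r * p)) = 0 := hp
    exact Ideal.Quotient.eq_zero_iff_mem.mp hp'
  refine Ideal.map_mono hg ((mem_map_ker_iff_tmul (O := O) g y).mpr ?_)
  have h1 := (mem_map_ker_iff_tmul (O := O) (Submodule.mkQ I) (ψ r * y)).mp (by
    rw [Submodule.ker_mkQ]; exact hy)
  have h2 : g 1 = r • (Submodule.mkQ I) 1 := by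
    rw [← map_smul]
    simp [g]
  rw [h2, TensorProduct.tmul_smul, TensorProduct.smul_tmul', Algebra.smul_def]
  exact h1

/-- The contraction of `K` is the kernel of `R → S ⧸ K`, so it commutes with the flat base change to
`O`. This compares a blow-up chart with the local ring below it. -/
theorem flat_contraction [Algebra R O] [Module.Flat R O] {S : Type*} [CommRing S] [Algebra R S]
    (K : Ideal S) {x : O}
    (hx : x ⊗ₜ[R] (1 : S) ∈ K.map (Algebra.TensorProduct.includeRight : S →ₐ[R] O ⊗[R] S)) :
    x ∈ (K.comap (algebraMap R S)).map (algebraMap R O) := by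
  let g : R →ₗ[R] (S ⧸ K) := (Ideal.Quotient.mkₐ R K).toLinearMap.comp (Algebra.linearMap R S)
  have hg : LinearMap.ker g = K.comap (algebraMap R S) := by
    ext r
    exact Ideal.Quotient.eq_zero_iff_mem
  rw [← hg, mem_map_ker_iff_tmul]
  let q : O ⊗[R] S →ₐ[R] O ⊗[R] (S ⧸ K) :=
    Algebra.TensorProduct.map (AlgHom.id R O) (Ideal.Quotient.mkₐ R K)
  have hq : K.map (Algebra.TensorProduct.includeRight : S →ₐ[R] O ⊗[R] S) ≤
      RingHom.ker q := by
    rw [Ideal.map_le_iff_le_comap]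
    intro s hs
    simp [q, RingHom.mem_ker, Ideal.Quotient.eq_zero_iff_mem.mpr hs]
  have := hq hx
  rw [RingHom.mem_ker] at this
  simpa [q, g] using this

end Flat

/-! ### Monomial ideals -/

open MvPolynomial

section Monomial

variable {σ : Type*} {k : Type*} [Field k]

/-- `U` is an upper set of exponents that is determined by the coordinates in `T`. -/
def IsUpperOn (T : Finset σ) (U : Set (σ →₀ ℕ)) : Prop :=
  ∀ a ∈ U, ∀ b : σ →₀ ℕ, (∀ i ∈ T, a i ≤ b i) → b ∈ U

theorem IsUpperOn.isUpperSet {T : Finset σ} {U : Set (σ →₀ ℕ)} (h : IsUpperOn T U) :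
    IsUpperSet U := fun a b hab ha => h a ha b fun i _ => hab i

theorem IsUpperOn.mono {T T' : Finset σ} {U : Set (σ →₀ ℕ)} (h : IsUpperOn T U) (hT : T ⊆ T') :
    IsUpperOn T' U := fun a ha b hab => h a ha b fun i hi => hab i (hT hi)

variable (k) in
/-- The ideal generated by the monomials with exponents in `U`. -/
noncomputable def monomialIdeal (U : Set (σ →₀ ℕ)) : Ideal (MvPolynomial σ k) :=
  Ideal.span ((fun a => monomial a 1) '' U)

theorem monomial_mem_monomialIdeal {U : Set (σ →₀ ℕ)} {a : σ →₀ ℕ} (ha : a ∈ U) :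
    monomial a (1 : k) ∈ monomialIdeal k U :=
  Ideal.subset_span ⟨a, ha, rfl⟩

theorem mem_monomialIdeal {U : Set (σ →₀ ℕ)} (hU : IsUpperSet U) {p : MvPolynomial σ k} :
    p ∈ monomialIdeal k U ↔ ∀ a ∈ p.support, a ∈ U := by
  rw [monomialIdeal, mem_ideal_span_monomial_image]
  exact forall₂_congr fun a _ => ⟨fun ⟨b, hb, hba⟩ => hU hba hb, fun h => ⟨a, h, le_rfl⟩⟩

theorem monomial_mem_monomialIdeal_iff {U : Set (σ →₀ ℕ)} (hU : IsUpperSet U) {a : σ →₀ ℕ} :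
    monomial a (1 : k) ∈ monomialIdeal k U ↔ a ∈ U := by
  classical
  rw [mem_monomialIdeal hU, support_monomial, if_neg one_ne_zero]
  simp

theorem monomialIdeal_mono {U V : Set (σ →₀ ℕ)} (h : U ⊆ V) :
    monomialIdeal k U ≤ monomialIdeal k V :=
  Ideal.span_mono (Set.image_mono h)

theorem monomialIdeal_le_iff {U V : Set (σ →₀ ℕ)} (hV : IsUpperSet V) :
    monomialIdeal k U ≤ monomialIdeal k V ↔ U ⊆ V :=
  ⟨fun h _ ha => (monomial_mem_monomialIdeal_iff hV).mp (h (monomial_mem_monomialIdeal ha)),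
    monomialIdeal_mono⟩

theorem monomialIdeal_union (U V : Set (σ →₀ ℕ)) :
    monomialIdeal k (U ∪ V) = monomialIdeal k U ⊔ monomialIdeal k V := by
  rw [monomialIdeal, Set.image_union, Ideal.span_union]; rfl

theorem monomialIdeal_univ : monomialIdeal k (Set.univ : Set (σ →₀ ℕ)) = ⊤ := by
  rw [Ideal.eq_top_iff_one]
  exact monomial_mem_monomialIdeal (Set.mem_univ 0)

theorem monomialIdeal_biInter {ι : Type*} (s : Finset ι) (U : ι → Set (σ →₀ ℕ))
    (hU : ∀ i ∈ s, IsUpperSet (U i)) :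
    monomialIdeal k (⋂ i ∈ s, U i) = ⨅ i ∈ s, monomialIdeal k (U i) := by
  ext p
  rw [mem_monomialIdeal (isUpperSet_iInter₂ hU)]
  simp only [Submodule.mem_iInf, Set.mem_iInter]
  exact ⟨fun h i hi => (mem_monomialIdeal (hU i hi)).mpr fun a ha => h a ha i hi,
    fun h a ha i hi => (mem_monomialIdeal (hU i hi)).mp (h i hi) a ha⟩

/-- Multiplication by a monomial shifts the support without cancellation, so such colons are visible
on exponents. -/
theorem mem_monomialIdeal_of_monomial_mul_mem {U : Set (σ →₀ ℕ)} (hU : IsUpperSet U) (c : σ →₀ ℕ)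
    {p : MvPolynomial σ k} (h : monomial c 1 * p ∈ monomialIdeal k U) :
    p ∈ monomialIdeal k {a | c + a ∈ U} := by
  have hV : IsUpperSet {a | c + a ∈ U} := fun a b hab ha => hU (add_le_add_right hab c) ha
  rw [mem_monomialIdeal hU] at h
  rw [mem_monomialIdeal hV]
  intro a ha
  refine h _ ?_
  rw [mem_support_iff] at ha ⊢
  rwa [coeff_monomial_mul, one_mul]

/-- The exponents that are positive somewhere on `T`. -/
def posOn (T : Finset σ) : Set (σ →₀ ℕ) := {a | ∃ i ∈ T, a i ≠ 0}

/-- The exponents of degree at least `N` on `T`. -/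
def degOn (T : Finset σ) (N : ℕ) : Set (σ →₀ ℕ) := {a | N ≤ ∑ i ∈ T, a i}

theorem isUpperOn_posOn (T : Finset σ) : IsUpperOn T (posOn T) := by
  rintro a ⟨i, hi, h⟩ b hab
  exact ⟨i, hi, by have := hab i hi; omega⟩

theorem isUpperOn_degOn (T : Finset σ) (N : ℕ) : IsUpperOn T (degOn T N) :=
  fun _ ha _ hab => le_trans ha (Finset.sum_le_sum hab)

theorem IsUpperOn.union {T : Finset σ} {U V : Set (σ →₀ ℕ)} (hU : IsUpperOn T U)
    (hV : IsUpperOn T V) : IsUpperOn T (U ∪ V) :=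
  fun a ha b hab => ha.imp (fun h => hU a h b hab) (fun h => hV a h b hab)

theorem IsUpperOn.colon {T : Finset σ} {U : Set (σ →₀ ℕ)} (hU : IsUpperOn T U) (c : σ →₀ ℕ) :
    IsUpperOn T {a | c + a ∈ U} :=
  fun a ha b hab => hU _ ha _ fun i hi => by simpa using hab i hi

theorem isUpperOn_iInter₂ {ι : Sort*} {κ : ι → Sort*} {T : Finset σ}
    {U : ∀ i, κ i → Set (σ →₀ ℕ)} (hU : ∀ i j, IsUpperOn T (U i j)) :
    IsUpperOn T (⋂ (i) (j), U i j) := by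
  intro a ha b hab
  rw [Set.mem_iInter₂] at ha ⊢
  exact fun i j => hU i j a (ha i j) b hab

variable (k) in
theorem monomialIdeal_posOn (T : Finset σ) :
    monomialIdeal k (posOn T) = Ideal.span (X '' (T : Set σ)) := by
  classical
  refine le_antisymm ?_ ?_
  · rw [monomialIdeal, Ideal.span_le]
    rintro _ ⟨a, ⟨i, hi, h⟩, rfl⟩
    exact mem_ideal_span_X_image.mpr fun m hm =>
      ⟨i, hi, by rw [support_monomial, if_neg one_ne_zero, Finset.mem_singleton] at hm; rwa [hm]⟩
  · rw [Ideal.span_le]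
    rintro _ ⟨i, hi, rfl⟩
    exact monomial_mem_monomialIdeal (⟨i, hi, by simp⟩ : Finsupp.single i 1 ∈ posOn T)

variable (k) in
theorem monomialIdeal_degOn (T : Finset σ) (N : ℕ) :
    monomialIdeal k (degOn T N) = monomialIdeal k (posOn T) ^ N := by
  classical
  refine le_antisymm ?_ ?_
  · rw [monomialIdeal, Ideal.span_le]
    rintro _ ⟨a, ha, rfl⟩
    induction N generalizing a with
    | zero => simp
    | succ N ih =>
      obtain ⟨i, hi, h⟩ : ∃ i ∈ T, a i ≠ 0 := by
        by_contra! h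
        have : ∑ i ∈ T, a i = 0 := Finset.sum_eq_zero h
        have : N + 1 ≤ ∑ i ∈ T, a i := ha
        omega
      have hle : Finsupp.single i 1 ≤ a := by
        rw [Finsupp.single_le_iff]; omega
      have h1 : N ≤ ∑ j ∈ T, (a - Finsupp.single i 1 : σ →₀ ℕ) j := by
        have h2 : ∑ j ∈ T, a j = ∑ j ∈ T, (a - Finsupp.single i 1 : σ →₀ ℕ) j +
            ∑ j ∈ T, (Finsupp.single i 1 : σ →₀ ℕ) j := by
          rw [← Finset.sum_add_distrib]
          refine Finset.sum_congr rfl fun j _ => ?_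
          rw [← Finsupp.add_apply, tsub_add_cancel_of_le hle]
        have h3 : ∑ j ∈ T, (Finsupp.single i 1 : σ →₀ ℕ) j = 1 := by
          simp [Finsupp.single_apply, hi]
        have h4 : N + 1 ≤ ∑ i ∈ T, a i := ha
        omega
      have h5 : monomial a (1 : k) =
          monomial (a - Finsupp.single i 1) 1 * monomial (Finsupp.single i 1) 1 := by
        rw [monomial_mul, one_mul, tsub_add_cancel_of_le hle]
      rw [SetLike.mem_coe]
      change monomial a (1 : k) ∈ _
      rw [h5, pow_succ]
      exact Ideal.mul_mem_mul (ih _ h1) (monomial_mem_monomialIdeal ⟨i, hi, by simp⟩)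
  · induction N with
    | zero =>
      have : degOn T 0 = Set.univ := by ext; simp [degOn]
      rw [this, monomialIdeal_univ]; exact le_top
    | succ N ih =>
      rw [pow_succ]
      refine (Ideal.mul_mono_left ih).trans ?_
      rw [monomialIdeal, monomialIdeal, Ideal.span_mul_span', Ideal.span_le]
      rintro _ ⟨_, ⟨a, ha, rfl⟩, _, ⟨b, ⟨i, hi, hb⟩, rfl⟩, rfl⟩
      simp only [monomial_mul, one_mul]
      refine monomial_mem_monomialIdeal ?_
      have h1 : 1 ≤ ∑ i ∈ T, b i :=
        (Nat.one_le_iff_ne_zero.mpr hb).trans (Finset.single_le_sum (fun _ _ => Nat.zero_le _) hi)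
      have h2 : N ≤ ∑ i ∈ T, a i := ha
      change N + 1 ≤ _
      simp only [Finsupp.add_apply, Finset.sum_add_distrib]
      omega

/-- Extending primary monomial ideals along `θ` does not produce new elements of `E`, provided this
is so for the ideal of the variables in `T`. -/
theorem comap_map_monomialIdeal_le_of_primary [Finite σ] {E O : Type*} [CommRing E] [CommRing O]
    {ψ : MvPolynomial σ k →+* E} {θ : E →+* O} (hflat : (θ.comp ψ).Flat) {T : Finset σ}
    (base : ((monomialIdeal k (posOn T)).map (θ.comp ψ)).comap θ ≤
      (monomialIdeal k (posOn T)).map ψ)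
    {U : Set (σ →₀ ℕ)} (hU : IsUpperOn T U) (hN : ∃ N, degOn T N ⊆ U) :
    ((monomialIdeal k U).map (θ.comp ψ)).comap θ ≤ (monomialIdeal k U).map ψ := by
  classical
  obtain ⟨𝔞, h𝔞⟩ : ∃ 𝔞, 𝔞 = monomialIdeal k U := ⟨_, rfl⟩
  induction 𝔞 using WellFoundedGT.induction generalizing U with
  | ind 𝔞 ih =>
  subst h𝔞
  intro z hz
  rw [Ideal.mem_comap] at hz
  by_cases h0 : (0 : σ →₀ ℕ) ∈ U
  · have : U = Set.univ := Set.eq_univ_of_forall fun b => hU 0 h0 b (by simp)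
    rw [this, monomialIdeal_univ, Ideal.map_top]
    trivial
  by_cases hall : ∀ i ∈ T, Finsupp.single i 1 ∈ U
  · have : U = posOn T := by
      refine subset_antisymm (fun a ha => ?_) ?_
      · by_contra hc
        refine h0 (hU a ha 0 fun i hi => ?_)
        by_contra h
        exact hc ⟨i, hi, by simpa using h⟩
      · rintro a ⟨i, hi, h⟩
        refine hU _ (hall i hi) a fun j _ => ?_
        rw [Finsupp.single_apply]
        split_ifs with hij
        · subst hij; omega
        · omega
    subst this
    exact base hz
  push Not at hall
  obtain ⟨i, hi, hiU⟩ := hall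
  -- The induction compares `I_U` with `I_U + (X_i)` and `(I_U : X_i)`. Both are strictly larger,
  -- since `X_i ∉ I_U` while `I_U` is proper and contains a power of `X_i`.
  set c : σ →₀ ℕ := Finsupp.single i 1 with hc
  set V : Set (σ →₀ ℕ) := U ∪ posOn {i} with hV
  have hVu : IsUpperOn T V :=
    hU.union ((isUpperOn_posOn _).mono (Finset.singleton_subset_iff.mpr hi))
  set W : Set (σ →₀ ℕ) := {a | c + a ∈ U} with hW
  have hWu : IsUpperOn T W := hU.colon c
  have hUW : U ⊆ W := fun a ha => hU.isUpperSet le_add_self ha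
  obtain ⟨N, hN⟩ := hN
  have h1 : monomialIdeal k U < monomialIdeal k V := by
    refine lt_of_le_not_ge (monomialIdeal_mono Set.subset_union_left) fun h => ?_
    refine hiU ((monomialIdeal_le_iff hU.isUpperSet).mp h (Or.inr ⟨i, by simp, by simp [hc]⟩))
  have h2 : monomialIdeal k U < monomialIdeal k W := by
    refine lt_of_le_not_ge (monomialIdeal_mono hUW) fun h => ?_
    have hWU := (monomialIdeal_le_iff hU.isUpperSet).mp h
    have hNU : N • c ∈ U := hN (by
      simp [degOn, hc, Finsupp.single_apply, hi])
    -- If `(I_U : X_i)` were equal to `I_U`, factors `X_i` could be cancelled one at a time until `1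
    -- ∈ I_U`.
    have : ∀ m : ℕ, m • c ∉ U := by
      intro m
      induction m with
      | zero => simpa using h0
      | succ m ihm =>
        intro hm
        refine ihm (hWU ?_)
        change c + m • c ∈ U
        rwa [succ_nsmul, add_comm] at hm
    exact this N hNU
  have hzV : z ∈ (monomialIdeal k V).map ψ :=
    ih _ h1 hVu ⟨N, hN.trans Set.subset_union_left⟩ rfl
      (Ideal.map_mono (monomialIdeal_mono Set.subset_union_left) hz)
  rw [hV, monomialIdeal_union, monomialIdeal_posOn, Finset.coe_singleton, Set.image_singleton,
    Ideal.map_sup, Ideal.map_span, Set.image_singleton, Submodule.mem_sup] at hzV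
  obtain ⟨y, hy, w, hw, rfl⟩ := hzV
  obtain ⟨w, rfl⟩ := Ideal.mem_span_singleton'.mp hw
  have hX : (X i : MvPolynomial σ k) = monomial c 1 := rfl
  -- Subtracting `y` leaves `w X_i`. Flatness of `θ.comp ψ` puts `θ w` into the extended colon
  -- ideal, and induction brings `w` back to `E`; flatness of `ψ` alone is not needed.
  have hθy : θ y ∈ (monomialIdeal k U).map (θ.comp ψ) := by
    rw [← Ideal.map_map]; exact Ideal.mem_map_of_mem _ hy
  have hw' : (θ.comp ψ) (monomial c 1) * θ w ∈ (monomialIdeal k U).map (θ.comp ψ) := by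
    have := Ideal.sub_mem _ hz hθy
    rw [map_add, add_sub_cancel_left, map_mul, mul_comm] at this
    exact this
  have hwW : θ w ∈ (monomialIdeal k W).map (θ.comp ψ) :=
    flat_colon hflat (fun p hp => mem_monomialIdeal_of_monomial_mul_mem hU.isUpperSet c hp) hw'
  have hwW' : w ∈ (monomialIdeal k W).map ψ := ih _ h2 hWu ⟨N, hN.trans hUW⟩ rfl hwW
  refine Ideal.add_mem _ hy ?_
  have hle : Ideal.span {ψ (monomial c 1)} * (monomialIdeal k W).map ψ ≤
      (monomialIdeal k U).map ψ := by
    rw [← Set.image_singleton, ← Ideal.map_span, ← Ideal.map_mul]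
    refine Ideal.map_mono ?_
    rw [Ideal.span_singleton_mul_le_iff]
    intro p hp
    rw [mem_monomialIdeal hU.isUpperSet]
    rw [mem_monomialIdeal hWu.isUpperSet] at hp
    intro a ha
    obtain ⟨b, hb, hab⟩ : ∃ b ∈ p.support, a = c + b := by
      have := support_mul (monomial c (1 : k)) p ha
      rw [support_monomial, if_neg one_ne_zero, Finset.singleton_add, Finset.mem_vadd_finset] at this
      obtain ⟨b, hb, rfl⟩ := this
      exact ⟨b, hb, rfl⟩
    rw [hab]
    exact hp b hb
  rw [hX, mul_comm]
  exact hle (Ideal.mul_mem_mul (Ideal.mem_span_singleton_self _) hwW')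

/-- Krull's intersection theorem for the module `E ⧸ I`. -/
theorem mem_of_forall_mem_sup_pow {E : Type*} [CommRing E] [IsLocalRing E] [IsNoetherianRing E]
    (I : Ideal E) {z : E} (hz : ∀ N, z ∈ I ⊔ IsLocalRing.maximalIdeal E ^ N) : z ∈ I := by
  have := IsHausdorff.of_isLocalRing (IsLocalRing.maximalIdeal E) (E ⧸ I)
    (Ideal.IsPrime.ne_top inferInstance)
  rw [← Ideal.Quotient.eq_zero_iff_mem]
  refine this.haus' _ fun N => ?_
  rw [SModEq.zero]
  obtain ⟨y, hy, w, hw, rfl⟩ := Submodule.mem_sup.mp (hz N)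
  rw [map_add, Ideal.Quotient.eq_zero_iff_mem.mpr hy, zero_add]
  have : (Ideal.Quotient.mk I w) = w • (1 : E ⧸ I) := by
    rw [Algebra.smul_def, mul_one]; rfl
  rw [this]
  exact Submodule.smul_mem_smul hw trivial

/-- Adding `degOn T N` enlarges the extended ideal only by elements of the `N`-th power of the
maximal ideal. This reduces questions to ideals that contain a power of the ideal of the variables
in `T`. -/
theorem mem_map_monomialIdeal_of_forall {E : Type*} [CommRing E] [IsLocalRing E]
    [IsNoetherianRing E] {ψ : MvPolynomial σ k →+* E} {T : Finset σ}
    (hT : ∀ i ∈ T, ψ (X i) ∈ IsLocalRing.maximalIdeal E) (U : Set (σ →₀ ℕ)) {z : E}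
    (hz : ∀ N, z ∈ (monomialIdeal k (U ∪ degOn T N)).map ψ) : z ∈ (monomialIdeal k U).map ψ := by
  refine mem_of_forall_mem_sup_pow _ fun N => ?_
  have h := hz N
  rw [monomialIdeal_union, Ideal.map_sup, monomialIdeal_degOn, Ideal.map_pow] at h
  suffices hle : (monomialIdeal k (posOn T)).map ψ ≤ IsLocalRing.maximalIdeal E by
    exact sup_le_sup_left (Ideal.pow_right_mono hle N) ((monomialIdeal k U).map ψ) h
  rw [monomialIdeal_posOn, Ideal.map_span, Ideal.span_le]
  rintro _ ⟨_, ⟨i, hi, rfl⟩, rfl⟩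
  exact hT i hi

/-- The primary case applies to `U ∪ degOn T N` for every `N`, and Krull's theorem removes the extra
term. -/
theorem comap_map_monomialIdeal_le [Finite σ] {E O : Type*} [CommRing E] [CommRing O]
    [IsLocalRing E] [IsNoetherianRing E] {ψ : MvPolynomial σ k →+* E} {θ : E →+* O}
    (hflat : (θ.comp ψ).Flat) {T : Finset σ}
    (hT : ∀ i ∈ T, ψ (X i) ∈ IsLocalRing.maximalIdeal E)
    (base : ((monomialIdeal k (posOn T)).map (θ.comp ψ)).comap θ ≤
      (monomialIdeal k (posOn T)).map ψ)
    {U : Set (σ →₀ ℕ)} (hU : IsUpperOn T U) :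
    ((monomialIdeal k U).map (θ.comp ψ)).comap θ ≤ (monomialIdeal k U).map ψ := fun _ hz =>
  mem_map_monomialIdeal_of_forall hT _ fun N =>
    comap_map_monomialIdeal_le_of_primary hflat base (hU.union (isUpperOn_degOn T N))
      ⟨N, Set.subset_union_right⟩
      (Ideal.map_mono (monomialIdeal_mono Set.subset_union_left) hz)

/-- The monomial ideals (in the variables from `T`) that contain a given ideal have a least
element. -/
theorem le_map_monomialIdeal_iInter [Finite σ] {E : Type*} [CommRing E] [IsLocalRing E]
    [IsNoetherianRing E] {ψ : MvPolynomial σ k →+* E} (hψ : ψ.Flat) {T : Finset σ}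
    (hT : ∀ i ∈ T, ψ (X i) ∈ IsLocalRing.maximalIdeal E) (J : Ideal E) :
    J ≤ (monomialIdeal k (⋂ (U : Set (σ →₀ ℕ))
      (_ : IsUpperOn T U ∧ J ≤ (monomialIdeal k U).map ψ), U)).map ψ := by
  classical
  have := Fintype.ofFinite σ
  set U₀ := ⋂ (U : Set (σ →₀ ℕ)) (_ : IsUpperOn T U ∧ J ≤ (monomialIdeal k U).map ψ), U with hU₀
  intro z hz
  refine mem_map_monomialIdeal_of_forall hT _ fun N => ?_
  -- Flatness handles finite intersections only. Modulo degree at least `N` on `T`, only exponents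
  -- in the box below `b` matter, so it suffices to choose for each of them one `U` that omits it,
  -- if there is one.
  let b : σ →₀ ℕ := Finsupp.equivFunOnFinite.symm fun _ => N
  have hex : ∀ c : σ →₀ ℕ, ∃ U, (IsUpperOn T U ∧ J ≤ (monomialIdeal k U).map ψ) ∧
      (c ∉ U₀ → c ∉ U) := by
    intro c
    by_cases hc : c ∈ U₀
    · exact ⟨Set.univ, ⟨fun _ _ _ _ => trivial, by
        rw [monomialIdeal_univ, Ideal.map_top]; exact le_top⟩, fun h => absurd hc h⟩
    · rw [hU₀, Set.mem_iInter₂] at hc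
      push Not at hc
      obtain ⟨U, hU, hcU⟩ := hc
      exact ⟨U, hU, fun _ => hcU⟩
  choose V hV hVc using hex
  have h1 : J ≤ (monomialIdeal k (⋂ c ∈ Finset.Iic b, V c)).map ψ := by
    rw [monomialIdeal_biInter _ _ fun c _ => (hV c).1.isUpperSet, flat_map_biInf hψ]
    exact le_iInf₂ fun c _ => (hV c).2
  refine Ideal.map_mono (monomialIdeal_mono ?_) (h1 hz)
  intro a ha
  by_cases hN : N ≤ ∑ i ∈ T, a i
  · exact Or.inr hN
  · refine Or.inl ?_
    -- All the sets are determined by the coordinates in `T`, so `a` may be replaced by its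
    -- restriction to `T`, which lies in the box.
    let c : σ →₀ ℕ := a.filter (· ∈ T)
    have hca : ∀ i ∈ T, c i = a i := fun i hi => Finsupp.filter_apply_pos _ _ hi
    have hU₀u : IsUpperOn T U₀ := isUpperOn_iInter₂ fun U hU => hU.1
    have hcb : c ∈ Finset.Iic b := by
      rw [Finset.mem_Iic]
      intro i
      change c i ≤ N
      by_cases hi : i ∈ T
      · rw [hca i hi]
        have := Finset.single_le_sum (f := fun j => a j) (fun _ _ => Nat.zero_le _) hi
        omega
      · rw [Finsupp.filter_apply_neg _ _ hi]; exact Nat.zero_le _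
    have hcV : c ∈ V c := by
      refine (hV c).1 a ?_ c fun i hi => (hca i hi).ge
      rw [Set.mem_iInter₂] at ha
      exact ha c hcb
    have hc : c ∈ U₀ := by
      by_contra h
      exact hVc c h hcV
    exact hU₀u c hc a fun i hi => (hca i hi).le

/-- Primary decomposition of monomial ideals. -/
theorem IsUpperOn.exists_primary_decomposition [Finite σ] {T : Finset σ} {U : Set (σ →₀ ℕ)}
    (hU : IsUpperOn T U) : ∃ V : Finset σ → Set (σ →₀ ℕ),
      (∀ T' ∈ T.powerset, IsUpperOn T' (V T') ∧ U ⊆ V T' ∧ ∃ N, degOn T' N ⊆ V T') ∧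
      ⋂ T' ∈ T.powerset, V T' ⊆ U := by
  classical
  have := Fintype.ofFinite σ
  let trunc : ℕ → (σ →₀ ℕ) → (σ →₀ ℕ) := fun N a =>
    Finsupp.equivFunOnFinite.symm fun i => min (a i) N
  have htr : ∀ N a i, trunc N a i = min (a i) N := fun _ _ _ => rfl
  -- Dickson's lemma, in the form that a polynomial ring over an auxiliary field is noetherian:
  -- above some level `N` the size of a coordinate no longer affects membership in `U`.
  obtain ⟨N, hN⟩ : ∃ N, ∀ a ∈ U, trunc N a ∈ U := by
    let W : ℕ → Set (σ →₀ ℕ) := fun N => {a | trunc N a ∈ U}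
    have hWu : ∀ N, IsUpperSet (W N) := fun N a b hab ha =>
      hU.isUpperSet (fun i => min_le_min_right N (hab i)) ha
    have hWm : Monotone W := fun N M hNM a ha =>
      hU.isUpperSet (fun i => min_le_min_left (a i) hNM) ha
    obtain ⟨N, hN⟩ := monotone_stabilizes_iff_noetherian.mpr
      (inferInstance : IsNoetherianRing (MvPolynomial σ ℚ))
      ⟨fun N => monomialIdeal ℚ (W N), fun N M hNM => monomialIdeal_mono (hWm hNM)⟩
    refine ⟨N, fun a ha => ?_⟩
    let M := N + ∑ i, a i
    have hM : a ∈ W M := by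
      have : trunc M a = a := by
        ext i
        rw [htr, min_eq_left]
        exact (Finset.single_le_sum (f := fun j => a j) (fun _ _ => Nat.zero_le _)
          (Finset.mem_univ i)).trans (Nat.le_add_left _ _)
      change trunc M a ∈ U
      rwa [this]
    exact (monomialIdeal_le_iff (hWu N)).mp (hN M (Nat.le_add_right _ _)).ge hM
  let raise : Finset σ → (σ →₀ ℕ) → (σ →₀ ℕ) := fun T' a =>
    Finsupp.equivFunOnFinite.symm fun i => if i ∈ T' then a i else N
  have hra : ∀ T' a i, raise T' a i = if i ∈ T' then a i else N := fun _ _ _ => rfl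
  -- The first set is the saturation of `U` in the variables outside `T'`; the second makes the
  -- ideal primary to the variables in `T'`. The bound `N * T.card + 1` exceeds the degree on `T'`
  -- of every exponent whose coordinates in `T'` are below `N`.
  refine ⟨fun T' => {a | raise T' a ∈ U} ∪ degOn T' (N * T.card + 1), fun T' hT' => ⟨?_, ?_, ?_⟩, ?_⟩
  · refine IsUpperOn.union ?_ (isUpperOn_degOn _ _)
    intro a ha b hab
    refine hU.isUpperSet (fun i => ?_) ha
    rw [hra, hra]
    split_ifs with h
    · exact hab i h
    · exact le_rfl
  · intro a ha
    refine Or.inl (hU.isUpperSet (fun i => ?_) (hN a ha))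
    rw [hra, htr]
    split_ifs with h
    · exact min_le_left _ _
    · exact min_le_right _ _
  · exact ⟨_, Set.subset_union_right⟩
  · intro a ha
    rw [Set.mem_iInter₂] at ha
    -- The component that decides about `a` belongs to the coordinates in which `a` is still below
    -- `N`.
    have := ha (T.filter fun i => a i < N) (Finset.mem_powerset.mpr (Finset.filter_subset _ _))
    rcases this with h | h
    · refine hU _ (hN _ h) a fun i hi => ?_
      rw [htr, hra]
      simp only [Finset.mem_filter, hi, true_and]
      split_ifs with h'
      · exact min_le_left _ _
      · omega
    · exfalso
      change N * T.card + 1 ≤ _ at h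
      have h1 : ∑ i ∈ T.filter (fun i => a i < N), a i ≤
          ∑ i ∈ T.filter (fun i => a i < N), N :=
        Finset.sum_le_sum fun i hi => (Finset.mem_filter.mp hi).2.le
      rw [Finset.sum_const, smul_eq_mul, mul_comm] at h1
      have h2 := Nat.mul_le_mul_left N (Finset.card_filter_le T fun i => a i < N)
      omega

end Monomial

end Toroidal

/-! ### Local structure of étale algebras over polynomial rings -/

namespace Toroidal

section EtaleDomain

open TensorProduct

/-- Reduced artinian rings are von Neumann regular: the descending powers of `x` stabilize, which
makes `x * (x * c) - x` nilpotent. -/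
theorem exists_mul_self_mul_eq {B : Type*} [CommRing B] [IsArtinianRing B] [IsReduced B] (x : B) :
    ∃ c, x * (x * c) = x := by
  obtain ⟨n, c, hc⟩ := IsArtinian.exists_pow_succ_smul_dvd x (1 : B)
  refine ⟨c, ?_⟩
  simp only [smul_eq_mul, mul_one] at hc
  rw [← sub_eq_zero]
  refine eq_zero_of_pow_eq_zero (n := n + 1) ?_
  have : x * (x * c) - x = x * (x * c - 1) := by ring
  rw [this, mul_pow, pow_succ (x * c - 1), ← mul_assoc, mul_right_comm]
  have h : x ^ (n + 1) * (x * c - 1) = 0 := by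
    have : x ^ (n + 1) * (x * c - 1) = x * (x ^ (n + 1) * c - x ^ n) := by ring
    rw [this, hc, sub_self, mul_zero]
  rw [h, zero_mul]

/-- In an étale algebra over a normal domain, zero divisors are separated by idempotents. -/
theorem exists_idempotent_of_mul_eq_zero {R A : Type*} [CommRing R] [IsDomain R]
    [IsIntegrallyClosed R] [CommRing A] [Algebra R A] [Algebra.Etale R A] {a b : A}
    (hab : a * b = 0) : ∃ e : A, e * (1 - e) = 0 ∧ e * b = 0 ∧ (1 - e) * a = 0 := by
  let K := FractionRing R
  have hred : IsReduced (K ⊗[R] A) := Algebra.FormallyUnramified.isReduced_of_field K _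
  have hfin : Module.Finite K (K ⊗[R] A) := Algebra.FormallyUnramified.finite_of_free K _
  have hart : IsArtinianRing (K ⊗[R] A) := IsArtinianRing.of_finite K _
  let i : A →ₐ[R] A ⊗[R] K := Algebra.TensorProduct.includeLeft
  have hinj : Function.Injective i :=
    Algebra.TensorProduct.includeLeft_injective (IsFractionRing.injective R K)
  -- Over the fraction field the algebra is reduced and artinian, so `i a` has a quasi-inverse `c`,
  -- and `i a * c` is an idempotent.
  obtain ⟨c, hc⟩ : ∃ c, i a * (i a * c) = i a := by
    obtain ⟨c, hc⟩ := exists_mul_self_mul_eq (Algebra.TensorProduct.comm R A K (i a))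
    refine ⟨(Algebra.TensorProduct.comm R A K).symm c, ?_⟩
    apply (Algebra.TensorProduct.comm R A K).injective
    simpa using hc
  have hidem : (i a * c) * (i a * c) = i a * c := by
    have : (i a * c) * (i a * c) = (i a * (i a * c)) * c := by ring
    rw [this, hc]
  have hint : IsIntegral A (i a * c) := by
    refine ⟨Polynomial.X ^ 2 - Polynomial.X, ?_, ?_⟩
    · exact Polynomial.monic_X_pow_sub (Polynomial.degree_X_le.trans_lt (by norm_num))
    · simp [sq, hidem]
  -- The idempotent is integral over `A`. Integral closure commutes with the étale base change from
  -- `R` to `A`, and `R` is integrally closed in `K`, so the idempotent already lies in `A`.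
  obtain ⟨e, he⟩ : ∃ e, i e = i a * c := by
    obtain ⟨z, hz⟩ := (TensorProduct.toIntegralClosure_bijective_of_smooth
      (R := R) (S := A) (B := K)).2 ⟨_, hint⟩
    have hz' : (TensorProduct.toIntegralClosure R A K z : A ⊗[R] K) = i a * c := by rw [hz]
    rw [← hz']
    clear hz hz'
    induction z with
    | zero => exact ⟨0, by simp⟩
    | add x y hx hy =>
      obtain ⟨e, he⟩ := hx
      obtain ⟨f, hf⟩ := hy
      exact ⟨e + f, by rw [map_add, he, hf, map_add]; rfl⟩
    | tmul x y =>
      obtain ⟨r, hr⟩ := IsIntegrallyClosed.isIntegral_iff.mp y.2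
      refine ⟨r • x, ?_⟩
      change (r • x) ⊗ₜ[R] (1 : K) = x ⊗ₜ[R] (y : K)
      rw [← hr, TensorProduct.smul_tmul, Algebra.algebraMap_eq_smul_one]
  refine ⟨e, hinj ?_, hinj ?_, hinj ?_⟩
  · rw [map_mul, map_sub, map_one, he, mul_sub, mul_one, hidem, sub_self, map_zero]
  · rw [map_mul, he, mul_right_comm, ← map_mul, hab, map_zero, zero_mul]
  · rw [map_mul, map_sub, map_one, he, sub_mul, one_mul, mul_comm (i a * c), hc, sub_self, map_zero]

end EtaleDomain

open MvPolynomial TensorProduct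

/-! ### Étale algebras along coordinate strata -/

section Frame

variable {σ : Type*} {k : Type*} [Field k]

/-- Setting the variables in `T` to zero gives again a polynomial ring, that is, a normal domain to
which the idempotent argument applies. -/
theorem exists_ker_eq_monomialIdeal_posOn {σ : Type u} [Finite σ] (T : Finset σ) :
    ∃ (τ : Type u) (_ : Finite τ) (ρ : MvPolynomial σ k →+* MvPolynomial τ k),
      Function.Surjective ρ ∧ RingHom.ker ρ = monomialIdeal k (posOn T) := by
  classical
  let ρ : MvPolynomial σ k →ₐ[k] MvPolynomial {j // j ∉ T} k :=
    aeval fun j => if h : j ∈ T then 0 else X ⟨j, h⟩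
  let τ : MvPolynomial {j // j ∉ T} k →ₐ[k] MvPolynomial σ k := rename (↑)
  have hρτ : ∀ p, ρ (τ p) = p := by
    intro p
    have : ρ.comp τ = AlgHom.id k _ := by
      ext j
      simp [ρ, τ, j.2]
    exact congr($this p)
  have hτρ : ∀ p, p - τ (ρ p) ∈ monomialIdeal k (posOn T) := by
    intro p
    rw [← Ideal.Quotient.mk_eq_mk_iff_sub_mem]
    have : (Ideal.Quotient.mkₐ k (monomialIdeal k (posOn T))) =
        ((Ideal.Quotient.mkₐ k (monomialIdeal k (posOn T))).comp τ).comp ρ := by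
      ext j
      by_cases h : j ∈ T
      · simp only [ρ, Ideal.Quotient.mkₐ_eq_mk, AlgHom.coe_comp, Function.comp_apply, aeval_X,
          dif_pos h, map_zero]
        exact Ideal.Quotient.eq_zero_iff_mem.mpr
          (monomial_mem_monomialIdeal (⟨j, h, by simp⟩ : Finsupp.single j 1 ∈ posOn T))
      · simp [ρ, h, τ]
    exact congr($this p)
  refine ⟨{j // j ∉ T}, inferInstance, ρ.toRingHom, fun p => ⟨τ p, hρτ p⟩, ?_⟩
  ext p
  rw [RingHom.mem_ker]
  refine ⟨fun h => ?_, fun h => ?_⟩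
  · have h' : ρ p = 0 := h
    simpa [h'] using hτρ p
  · rw [monomialIdeal_posOn] at h
    have : Ideal.span (X '' (T : Set σ)) ≤ RingHom.ker ρ.toRingHom := by
      rw [Ideal.span_le]
      rintro _ ⟨j, hj, rfl⟩
      have : j ∈ T := hj
      simp [RingHom.mem_ker, ρ, this]
    exact this h

/-- Modulo the variables in `T`, the ring `A` is étale over a normal domain, where an idempotent
separates zero divisors. For a lift `e` of it, one of `e` and `1 - e` lies outside `p` and serves as
`s`. -/
theorem etale_exists_notMem_mul_mem [Finite σ] {A : Type*} [CommRing A]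
    {ψ : MvPolynomial σ k →+* A} (hψ : ψ.Etale) (p : Ideal A) [p.IsPrime] {T : Finset σ}
    (hT : ∀ i ∈ T, ψ (X i) ∈ p) {a b : A} (hab : a * b ∈ (monomialIdeal k (posOn T)).map ψ) :
    ∃ s ∉ p, s * a ∈ (monomialIdeal k (posOn T)).map ψ ∨
      s * b ∈ (monomialIdeal k (posOn T)).map ψ := by
  obtain ⟨τ, _, ρ, hρ, hker⟩ := exists_ker_eq_monomialIdeal_posOn (k := k) T
  have : IsIntegrallyClosed (MvPolynomial τ k) := UniqueFactorizationMonoid.instIsIntegrallyClosed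
  algebraize [ψ, ρ]
  have hIp : (monomialIdeal k (posOn T)).map ψ ≤ p := by
    rw [monomialIdeal_posOn, Ideal.map_span, Ideal.span_le]
    rintro _ ⟨_, ⟨i, hi, rfl⟩, rfl⟩
    exact hT i hi
  let j : A →ₐ[MvPolynomial σ k] MvPolynomial τ k ⊗[MvPolynomial σ k] A :=
    Algebra.TensorProduct.includeRight
  have hj : ∀ x, j x = 0 ↔ x ∈ (monomialIdeal k (posOn T)).map ψ := by
    intro x
    have h := mem_map_ker_iff_tmul (O := A)
      (Algebra.linearMap (MvPolynomial σ k) (MvPolynomial τ k)) x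
    have hk : LinearMap.ker (Algebra.linearMap (MvPolynomial σ k) (MvPolynomial τ k)) =
      monomialIdeal k (posOn T) := hker
    rw [hk] at h
    refine Iff.trans ?_ h.symm
    rw [← (TensorProduct.comm _ _ _).map_eq_zero_iff]
    simp [j]
  have hjs : Function.Surjective j := by
    intro z
    induction z with
    | zero => exact ⟨0, map_zero _⟩
    | add x y hx hy =>
      obtain ⟨x, rfl⟩ := hx
      obtain ⟨y, rfl⟩ := hy
      exact ⟨x + y, map_add _ _ _⟩
    | tmul x y =>
      obtain ⟨r, rfl⟩ := hρ x
      refine ⟨r • y, ?_⟩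
      change 1 ⊗ₜ (r • y) = _
      rw [← TensorProduct.smul_tmul, Algebra.smul_def, mul_one]
      rfl
  obtain ⟨e, h1, h2, h3⟩ := exists_idempotent_of_mul_eq_zero (R := MvPolynomial τ k)
    (a := j a) (b := j b) (by rw [← map_mul, hj]; exact hab)
  obtain ⟨e, rfl⟩ := hjs e
  rw [← map_one j, ← map_sub, ← map_mul, hj] at h1 h3
  rw [← map_mul, hj] at h2
  by_cases he : e ∈ p
  · refine ⟨1 - e, fun h => ?_, Or.inl h3⟩
    exact (Ideal.ne_top_iff_one p).mp (Ideal.IsPrime.ne_top inferInstance)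
      (by simpa using p.add_mem h he)
  · exact ⟨e, he, Or.inr h2⟩

/-- The ideal need not be prime in `A`, since a coordinate stratum may have several components. In
the localization at `p` the factor from `etale_exists_notMem_mul_mem` becomes a unit, and only the
component through the point remains. -/
theorem etale_isPrime_map [Finite σ] {A O : Type*} [CommRing A] [CommRing O] [Algebra A O]
    {ψ : MvPolynomial σ k →+* A} (hψ : ψ.Etale) (p : Ideal A) [p.IsPrime]
    [IsLocalization.AtPrime O p] {T : Finset σ} (hT : ∀ i ∈ T, ψ (X i) ∈ p) :
    ((monomialIdeal k (posOn T)).map ((algebraMap A O).comp ψ)).IsPrime := by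
  have : IsLocalRing O := IsLocalization.AtPrime.isLocalRing O p
  rw [← Ideal.map_map]
  set I := (monomialIdeal k (posOn T)).map ψ with hI
  have hIp : I ≤ p := by
    rw [hI, monomialIdeal_posOn, Ideal.map_span, Ideal.span_le]
    rintro _ ⟨_, ⟨i, hi, rfl⟩, rfl⟩
    exact hT i hi
  refine ⟨?_, ?_⟩
  · refine ne_top_of_le_ne_top (Ideal.IsPrime.ne_top
      (IsLocalRing.maximalIdeal.isMaximal O).isPrime) ?_
    rw [← IsLocalization.AtPrime.map_eq_maximalIdeal p O]
    exact Ideal.map_mono hIp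
  · intro x y hxy
    obtain ⟨⟨a, s⟩, ha⟩ := IsLocalization.surj p.primeCompl x
    obtain ⟨⟨b, t⟩, hb⟩ := IsLocalization.surj p.primeCompl y
    have hab : algebraMap A O (a * b) ∈ I.map (algebraMap A O) := by
      rw [map_mul, ← ha, ← hb]
      have := Ideal.mul_mem_right (algebraMap A O s * algebraMap A O t) _ hxy
      convert this using 1
      ring
    obtain ⟨u, hu, hab⟩ := (IsLocalization.algebraMap_mem_map_algebraMap_iff p.primeCompl O I _).mp
      hab
    have hab' : (u * a) * b ∈ I := by rwa [mul_assoc]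
    obtain ⟨v, hv, h⟩ := etale_exists_notMem_mul_mem hψ p hT hab'
    have key : ∀ {x : O} {a : A} {s : p.primeCompl}, x * algebraMap A O s = algebraMap A O a →
        (∃ w ∈ p.primeCompl, w * a ∈ I) → x ∈ I.map (algebraMap A O) := by
      intro x a s hx hw
      rw [← Ideal.mul_unit_mem_iff_mem _ (IsLocalization.map_units O s), hx]
      exact (IsLocalization.algebraMap_mem_map_algebraMap_iff p.primeCompl O I _).mpr hw
    rcases h with h | h
    · exact Or.inl (key ha ⟨v * u, p.primeCompl.mul_mem hv hu, by rwa [mul_assoc]⟩)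
    · exact Or.inr (key hb ⟨v, hv, h⟩)

theorem _root_.RingHom.Etale.exists_lift {R A B : Type*} [CommRing R] [CommRing A] [CommRing B]
    {ψ : R →+* A} (hψ : ψ.Etale) (f : R →+* B) {I : Ideal B} (hI : IsNilpotent I)
    (g : A →+* B ⧸ I) (hg : (Ideal.Quotient.mk I).comp f = g.comp ψ) :
    ∃ φ : A →+* B, φ.comp ψ = f ∧ (Ideal.Quotient.mk I).comp φ = g := by
  algebraize [ψ, f]
  let g' : A →ₐ[R] B ⧸ I := { g with commutes' := fun r => congr($hg.symm r) }
  refine ⟨Algebra.FormallySmooth.lift I hI g', RingHom.ext fun r => ?_, RingHom.ext fun x => ?_⟩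
  · exact (Algebra.FormallySmooth.lift I hI g').commutes r
  · exact Algebra.FormallySmooth.mk_lift I hI g' x

/-- A test curve: infinitesimal lifting gives a map from `A` to `K[t]/(t^N)`, with `K` the residue
field of `p`, that sends each `X_i` with `i ∈ S` to `t`. It maps `p` into `(t)` and `s` to a unit,
so the hypothesis forces `t` to the power `∑ a_i` to vanish. -/
theorem etale_le_degree {A : Type*} [CommRing A]
    {ψ : MvPolynomial σ k →+* A} (hψ : ψ.Etale) (p : Ideal A) [p.IsPrime] {S : Finset σ}
    (hS : ∀ i ∈ S, ψ (X i) ∈ p) {a : σ →₀ ℕ} (ha : ∀ i ∉ S, a i = 0) {N : ℕ} {s : A} (hs : s ∉ p)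
    (h : s * ψ (monomial a 1) ∈ p ^ N) : N ≤ ∑ i ∈ S, a i := by
  classical
  let K := p.ResidueField
  let κ : A →+* K := algebraMap A K
  have hκ : ∀ x, κ x = 0 ↔ x ∈ p := fun x => Ideal.algebraMap_residueField_eq_zero
  let B := Polynomial K ⧸ Ideal.span {(Polynomial.X : Polynomial K) ^ N}
  let q : Polynomial K →+* B := Ideal.Quotient.mk _
  let I : Ideal B := Ideal.span {q Polynomial.X}
  have hI : I ^ N = ⊥ := by
    rw [Ideal.span_singleton_pow, ← map_pow]
    have : q (Polynomial.X ^ N) = 0 :=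
      Ideal.Quotient.eq_zero_iff_mem.mpr (Ideal.mem_span_singleton_self _)
    rw [this, Ideal.span_singleton_zero]
  have hInil : IsNilpotent I := ⟨N, hI⟩
  let f : MvPolynomial σ k →+* B := eval₂Hom
    (q.comp (Polynomial.C.comp (κ.comp (ψ.comp C))))
    (fun j => if j ∈ S then q Polynomial.X else q (Polynomial.C (κ (ψ (X j)))))
  have hfX : ∀ j, f (X j) = if j ∈ S then q Polynomial.X else q (Polynomial.C (κ (ψ (X j)))) :=
    fun j => eval₂Hom_X' _ _ _
  let g : A →+* B ⧸ I := (Ideal.Quotient.mk I).comp (q.comp (Polynomial.C.comp κ))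
  have hg : (Ideal.Quotient.mk I).comp f = g.comp ψ := by
    ext j
    · simp [f, g]
    · simp only [RingHom.comp_apply, hfX, g]
      split_ifs with hj
      · rw [(hκ _).mpr (hS j hj), map_zero, map_zero, map_zero, Ideal.Quotient.eq_zero_iff_mem]
        exact Ideal.mem_span_singleton_self _
      · rfl
  obtain ⟨φ, hφf, hφg⟩ := hψ.exists_lift f hInil g hg
  have hφ : ∀ x, Ideal.Quotient.mk I (φ x) = g x := fun x => congr($hφg x)
  have hφp : p ≤ I.comap φ := by
    intro x hx
    rw [Ideal.mem_comap, ← Ideal.Quotient.eq_zero_iff_mem, hφ]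
    simp [g, (hκ x).mpr hx]
  have hφs : IsUnit (φ s) := by
    rw [← IsNilpotent.isUnit_quotient_mk_iff hInil, hφ]
    exact ((isUnit_iff_ne_zero.mpr fun h => hs ((hκ s).mp h)).map
      ((Ideal.Quotient.mk I).comp (q.comp Polynomial.C)))
  have hφψ : ∀ r, φ (ψ r) = f r := fun r => congr($hφf r)
  have h0 : φ (s * ψ (monomial a 1)) = 0 := by
    have h1 : φ (s * ψ (monomial a 1)) ∈ (p ^ N).map φ := Ideal.mem_map_of_mem _ h
    rw [Ideal.map_pow] at h1
    have := Ideal.pow_right_mono (Ideal.map_le_iff_le_comap.mpr hφp) N h1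
    rwa [hI] at this
  rw [map_mul, hφs.mul_right_eq_zero, hφψ] at h0
  have h2 : f (monomial a 1) = q (Polynomial.X ^ ∑ i ∈ S, a i) := by
    rw [monomial_eq, map_mul, C_1, map_one, one_mul, Finsupp.prod, map_prod]
    rw [Finset.prod_subset (s₂ := S)]
    · rw [← Finset.prod_pow_eq_pow_sum, map_prod]
      refine Finset.prod_congr rfl fun i hi => ?_
      rw [map_pow, hfX, if_pos hi, map_pow]
    · intro i hi
      by_contra hc
      exact (Finsupp.mem_support_iff.mp hi) (ha i hc)
    · intro i _ hi
      rw [Finsupp.notMem_support_iff.mp hi, pow_zero, map_one]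
  rw [h2] at h0
  have h3 := Ideal.mem_span_singleton.mp (Ideal.Quotient.eq_zero_iff_mem.mp h0)
  exact (pow_dvd_pow_iff Polynomial.X_ne_zero Polynomial.not_isUnit_X).mp h3

/-- `ψ` presents the local ring `O` as étale-local over affine space, with the coordinates in `S`
vanishing at the closed point. -/
structure IsToricFrame {O : Type*} [CommRing O] [IsLocalRing O] (ψ : MvPolynomial σ k →+* O)
    (S : Finset σ) : Prop where
  noeth : IsNoetherianRing O
  flat : ψ.Flat
  mem : ∀ i ∈ S, ψ (X i) ∈ IsLocalRing.maximalIdeal O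
  prime : ∀ T ⊆ S, ((monomialIdeal k (posOn T)).map ψ).IsPrime
  le_degree : ∀ (a : σ →₀ ℕ) (N : ℕ), (∀ i ∉ S, a i = 0) →
    ψ (monomial a 1) ∈ IsLocalRing.maximalIdeal O ^ N → N ≤ ∑ i ∈ S, a i

theorem _root_.RingHom.Etale.isNoetherianRing {R A : Type*} [CommRing R] [CommRing A]
    [IsNoetherianRing R] {ψ : R →+* A} (hψ : ψ.Etale) : IsNoetherianRing A := by
  algebraize [ψ]
  exact Algebra.FiniteType.isNoetherianRing R A

theorem _root_.RingHom.Etale.isToricFrame [Finite σ] {A O : Type*} [CommRing A] [CommRing O]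
    [Algebra A O] [IsLocalRing O] {ψ : MvPolynomial σ k →+* A} (hψ : ψ.Etale) (p : Ideal A)
    [p.IsPrime] [IsLocalization.AtPrime O p] {S : Finset σ} (hS : ∀ i ∈ S, ψ (X i) ∈ p) :
    IsToricFrame ((algebraMap A O).comp ψ) S where
  noeth := by
    have := hψ.isNoetherianRing
    exact IsLocalization.isNoetherianRing p.primeCompl O inferInstance
  flat := by
    have h1 := (RingHom.Etale.iff_flat_and_formallyUnramified.mp hψ).1
    refine h1.comp ?_
    rw [RingHom.flat_algebraMap_iff]
    exact IsLocalization.flat O p.primeCompl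
  mem i hi := (IsLocalization.AtPrime.to_map_mem_maximal_iff O p _).mpr (hS i hi)
  prime T hT := etale_isPrime_map hψ p fun i hi => hS i (hT hi)
  le_degree a N ha h := by
    rw [← IsLocalization.AtPrime.map_eq_maximalIdeal p O, ← Ideal.map_pow, RingHom.comp_apply,
      IsLocalization.algebraMap_mem_map_algebraMap_iff p.primeCompl O] at h
    obtain ⟨s, hs, h⟩ := h
    exact etale_le_degree hψ p hS ha hs h

end Frame

end Toroidal

/-! ### Stalks of ideal sheaves -/

namespace Toroidal

variable {X Y : Scheme.{u}}

theorem exists_affineOpens_mem (x : X) {W : X.Opens} (hW : x ∈ W) :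
    ∃ U : X.affineOpens, x ∈ U.1 ∧ U.1 ≤ W := by
  obtain ⟨_, ⟨U, hU, rfl⟩, hxU, h⟩ :=
    X.isBasis_affineOpens.exists_subset_of_mem_open (show x ∈ (W : Set X) from hW) W.isOpen
  exact ⟨⟨U, hU⟩, hxU, h⟩

theorem germ_mem_maximalIdeal_iff {U : X.Opens} {x : X} (hx : x ∈ U) (a : Γ(X, U)) :
    X.presheaf.germ U x hx a ∈ IsLocalRing.maximalIdeal (X.presheaf.stalk x) ↔
      x ∉ X.basicOpen a := by
  rw [IsLocalRing.mem_maximalIdeal, mem_nonunits_iff, not_iff_not]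
  exact (X.mem_basicOpen a x hx).symm

/-- The prime ideal of the functions on `U` that vanish at `x`. -/
noncomputable def primeAt (U : X.affineOpens) (x : X) (hx : x ∈ U.1) : Ideal Γ(X, U.1) :=
  (IsLocalRing.maximalIdeal (X.presheaf.stalk x)).comap (X.presheaf.germ U.1 x hx).hom

instance (U : X.affineOpens) (x : X) (hx : x ∈ U.1) : (primeAt U x hx).IsPrime :=
  Ideal.IsPrime.comap _

theorem mem_primeAt {U : X.affineOpens} {x : X} {hx : x ∈ U.1} {a : Γ(X, U.1)} :
    a ∈ primeAt U x hx ↔ x ∉ X.basicOpen a :=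
  germ_mem_maximalIdeal_iff hx a

theorem isLocalization_stalk (U : X.affineOpens) (x : X) (hx : x ∈ U.1) :
    let := (X.presheaf.germ U.1 x hx).hom.toAlgebra
    IsLocalization.AtPrime (X.presheaf.stalk x) (primeAt U x hx) := by
  let := (X.presheaf.germ U.1 x hx).hom.toAlgebra
  have h : IsLocalization.AtPrime (X.presheaf.stalk x) (U.2.primeIdealOf ⟨x, hx⟩).asIdeal :=
    U.2.isLocalization_stalk ⟨x, hx⟩
  have h2 : primeAt U x hx = (U.2.primeIdealOf ⟨x, hx⟩).asIdeal := by
    ext a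
    exact IsLocalization.AtPrime.to_map_mem_maximal_iff (X.presheaf.stalk x)
      (U.2.primeIdealOf ⟨x, hx⟩).asIdeal a
  convert h

theorem germ_mem_map_iff {U : X.affineOpens} {x : X} {hx : x ∈ U.1} {I : Ideal Γ(X, U.1)}
    {a : Γ(X, U.1)} :
    X.presheaf.germ U.1 x hx a ∈ I.map (X.presheaf.germ U.1 x hx).hom ↔
      ∃ s, x ∈ X.basicOpen s ∧ s * a ∈ I := by
  let := (X.presheaf.germ U.1 x hx).hom.toAlgebra
  have := isLocalization_stalk U x hx
  refine (IsLocalization.algebraMap_mem_map_algebraMap_iff (primeAt U x hx).primeCompl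
    (X.presheaf.stalk x) I a).trans (exists_congr fun s => and_congr_left fun _ => ?_)
  rw [Ideal.mem_primeCompl_iff, mem_primeAt, not_not]

theorem exists_germ_mul_eq (U : X.affineOpens) {x : X} (hx : x ∈ U.1)
    (z : X.presheaf.stalk x) : ∃ a s : Γ(X, U.1), x ∈ X.basicOpen s ∧
      z * X.presheaf.germ U.1 x hx s = X.presheaf.germ U.1 x hx a := by
  let := (X.presheaf.germ U.1 x hx).hom.toAlgebra
  have := isLocalization_stalk U x hx
  obtain ⟨⟨a, s⟩, h⟩ := IsLocalization.surj (primeAt U x hx).primeCompl z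
  refine ⟨a, s, ?_, h⟩
  by_contra hc
  exact s.2 (mem_primeAt.mpr hc)

theorem germ_res_comp {U V : X.Opens} (h : V ≤ U) (x : X) (hx : x ∈ V) :
    (X.presheaf.germ V x hx).hom.comp (X.presheaf.map (homOfLE h).op).hom =
      (X.presheaf.germ U x (h hx)).hom := by
  rw [← CommRingCat.hom_comp, TopCat.Presheaf.germ_res]

theorem map_ideal_germ_of_le (J : X.IdealSheafData) {U V : X.affineOpens} (h : V.1 ≤ U.1) (x : X)
    (hx : x ∈ V.1) : (J.ideal U).map (X.presheaf.germ U.1 x (h hx)).hom =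
      (J.ideal V).map (X.presheaf.germ V.1 x hx).hom := by
  rw [← J.map_ideal' (homOfLE h).op, Ideal.map_map, germ_res_comp h]

theorem stalkIdeal_eq (J : X.IdealSheafData) (U : X.affineOpens) {x : X} (hx : x ∈ U.1) :
    stalkIdeal J x = (J.ideal U).map (X.presheaf.germ U.1 x hx).hom := by
  refine le_antisymm (iSup₂_le fun V hV => ?_)
    (le_iSup₂ (f := fun (U : X.affineOpens) (h : x ∈ U.1) =>
      (J.ideal U).map (X.presheaf.germ U.1 x h).hom) U hx)
  obtain ⟨W, hxW, hW⟩ := exists_affineOpens_mem x (show x ∈ U.1 ⊓ V.1 from ⟨hx, hV⟩)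
  rw [map_ideal_germ_of_le J (hW.trans inf_le_right) x hxW,
    map_ideal_germ_of_le J (hW.trans inf_le_left) x hxW]

theorem le_iff_stalkIdeal_le {I J : X.IdealSheafData} :
    I ≤ J ↔ ∀ x, stalkIdeal I x ≤ stalkIdeal J x := by
  refine ⟨fun h x => iSup₂_mono fun U hU => Ideal.map_mono (h U), fun h U => ?_⟩
  rw [U.2.ideal_le_iff]
  intro x hx
  rw [← stalkIdeal_eq, ← stalkIdeal_eq]
  exact h x

theorem stalkIdeal_mono {I J : X.IdealSheafData} (h : I ≤ J) (x : X) :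
    stalkIdeal I x ≤ stalkIdeal J x :=
  le_iff_stalkIdeal_le.mp h x

theorem ext_stalkIdeal {I J : X.IdealSheafData} (h : ∀ x, stalkIdeal I x = stalkIdeal J x) :
    I = J :=
  le_antisymm (le_iff_stalkIdeal_le.mpr fun x => (h x).le)
    (le_iff_stalkIdeal_le.mpr fun x => (h x).ge)

theorem stalkIdeal_top (x : X) : stalkIdeal (⊤ : X.IdealSheafData) x = ⊤ := by
  obtain ⟨U, hx, -⟩ := exists_affineOpens_mem x (W := ⊤) trivial
  rw [stalkIdeal_eq _ U hx]
  exact Ideal.map_top _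

theorem stalkIdeal_mul (I J : X.IdealSheafData) (x : X) :
    stalkIdeal (I * J) x = stalkIdeal I x * stalkIdeal J x := by
  obtain ⟨U, hx, -⟩ := exists_affineOpens_mem x (W := ⊤) trivial
  rw [stalkIdeal_eq _ U hx, stalkIdeal_eq _ U hx, stalkIdeal_eq _ U hx, ← Ideal.map_mul]
  rfl

theorem stalkIdeal_pow (I : X.IdealSheafData) (n : ℕ) (x : X) :
    stalkIdeal (I ^ n) x = stalkIdeal I x ^ n := by
  obtain ⟨U, hx, -⟩ := exists_affineOpens_mem x (W := ⊤) trivial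
  rw [stalkIdeal_eq _ U hx, stalkIdeal_eq _ U hx, ← Ideal.map_pow]
  rfl

theorem stalkIdeal_prod {ι : Type*} (s : Finset ι) (I : ι → X.IdealSheafData) (x : X) :
    stalkIdeal (∏ i ∈ s, I i) x = ∏ i ∈ s, stalkIdeal (I i) x := by
  classical
  induction s using Finset.induction_on with
  | empty =>
    rw [Finset.prod_empty, Finset.prod_empty, Ideal.one_eq_top]
    exact stalkIdeal_top x
  | insert a s ha ih => rw [Finset.prod_insert ha, Finset.prod_insert ha, stalkIdeal_mul, ih]

theorem stalkIdeal_iSup {ι : Sort*} (I : ι → X.IdealSheafData) (x : X) :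
    stalkIdeal (⨆ i, I i) x = ⨆ i, stalkIdeal (I i) x := by
  obtain ⟨U, hx, -⟩ := exists_affineOpens_mem x (W := ⊤) trivial
  simp only [stalkIdeal_eq _ U hx]
  rw [← Ideal.map_iSup]
  congr 1
  rw [← sSup_range, Scheme.IdealSheafData.ideal_sSup, ← Set.range_comp, sSup_range, iSup_apply]
  rfl

theorem stalkIdeal_inf (I J : X.IdealSheafData) (x : X) :
    stalkIdeal (I ⊓ J) x = stalkIdeal I x ⊓ stalkIdeal J x := by
  obtain ⟨U, hx, -⟩ := exists_affineOpens_mem x (W := ⊤) trivial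
  rw [stalkIdeal_eq _ U hx, stalkIdeal_eq _ U hx, stalkIdeal_eq _ U hx]
  let := (X.presheaf.germ U.1 x hx).hom.toAlgebra
  have := isLocalization_stalk U x hx
  exact IsLocalization.map_inf (primeAt U x hx).primeCompl (X.presheaf.stalk x) _ _

theorem stalkIdeal_biInf {ι : Type*} (s : Finset ι) (I : ι → X.IdealSheafData) (x : X) :
    stalkIdeal (⨅ i ∈ s, I i) x = ⨅ i ∈ s, stalkIdeal (I i) x := by
  classical
  induction s using Finset.induction_on with
  | empty => simp [stalkIdeal_top]
  | insert a s ha ih => rw [Finset.iInf_insert, Finset.iInf_insert, stalkIdeal_inf, ih]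

theorem germ_comp_stalkSpecializes {x y : X} (h : x ⤳ y) {U : X.Opens} (hy : y ∈ U) :
    (X.presheaf.stalkSpecializes h).hom.comp (X.presheaf.germ U y hy).hom =
      (X.presheaf.germ U x (h.mem_open U.2 hy)).hom := by
  rw [← CommRingCat.hom_comp, TopCat.Presheaf.germ_stalkSpecializes]

theorem stalkIdeal_of_specializes (I : X.IdealSheafData) {x y : X} (h : x ⤳ y) :
    stalkIdeal I x = (stalkIdeal I y).map (X.presheaf.stalkSpecializes h).hom := by
  obtain ⟨U, hy, -⟩ := exists_affineOpens_mem y (W := ⊤) trivial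
  rw [stalkIdeal_eq _ U hy, stalkIdeal_eq _ U (h.mem_open U.1.2 hy), Ideal.map_map,
    germ_comp_stalkSpecializes]

/-- On a noetherian affine open `I` has finitely many generators, and one denominator `t` that is
invertible at `x` serves all of them. -/
theorem exists_le_ideal_le [IsLocallyNoetherian X] {I J : X.IdealSheafData} {x : X}
    (h : stalkIdeal I x ≤ stalkIdeal J x) {W : X.Opens} (hW : x ∈ W) :
    ∃ U : X.affineOpens, x ∈ U.1 ∧ U.1 ≤ W ∧ I.ideal U ≤ J.ideal U := by
  obtain ⟨V, hx, hVW⟩ := exists_affineOpens_mem x hW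
  have hVn : IsNoetherianRing Γ(X, V.1) := IsLocallyNoetherian.component_noetherian V
  obtain ⟨G, hG⟩ := hVn.noetherian (I.ideal V)
  have hs : ∀ a : Γ(X, V.1), ∃ s, x ∈ X.basicOpen s ∧ (a ∈ G → s * a ∈ J.ideal V) := by
    intro a
    by_cases ha : a ∈ G
    · have h1 : X.presheaf.germ V.1 x hx a ∈ stalkIdeal I x := by
        rw [stalkIdeal_eq I V hx]
        exact Ideal.mem_map_of_mem _ (hG ▸ Submodule.subset_span ha)
      have h2 := h h1
      rw [stalkIdeal_eq J V hx] at h2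
      obtain ⟨s, hs, h⟩ := germ_mem_map_iff.mp h2
      exact ⟨s, hs, fun _ => h⟩
    · exact ⟨1, by rw [X.basicOpen_one]; exact hx, fun h => absurd h ha⟩
  choose s hs1 hs2 using hs
  let t := ∏ a ∈ G, s a
  have ht : x ∈ X.basicOpen t := by
    rw [X.mem_basicOpen _ _ hx, map_prod, IsUnit.prod_iff]
    exact fun a _ => (X.mem_basicOpen _ _ hx).mp (hs1 a)
  refine ⟨X.affineBasicOpen t, ht, (X.basicOpen_le t).trans hVW, ?_⟩
  have key : (I.ideal V).map (X.presheaf.map (homOfLE (X.basicOpen_le t)).op).hom ≤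
      (J.ideal V).map (X.presheaf.map (homOfLE (X.basicOpen_le t)).op).hom := by
    rw [← hG, Ideal.map_span, Ideal.span_le]
    rintro _ ⟨a, ha, rfl⟩
    have hu : IsUnit ((X.presheaf.map (homOfLE (X.basicOpen_le t)).op).hom t) :=
      RingedSpace.isUnit_res_basicOpen _ t
    rw [SetLike.mem_coe, ← Ideal.unit_mul_mem_iff_mem _ hu, ← map_mul]
    refine Ideal.mem_map_of_mem _ ?_
    obtain ⟨c, hc⟩ := Finset.dvd_prod_of_mem s ha
    change (∏ a ∈ G, s a) * a ∈ _
    rw [hc, mul_right_comm]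
    exact Ideal.mul_mem_right _ _ (hs2 a ha)
  rw [← I.map_ideal_basicOpen, ← J.map_ideal_basicOpen]
  exact key

theorem exists_ideal_eq [IsLocallyNoetherian X] {I J : X.IdealSheafData} {x : X}
    (h : stalkIdeal I x = stalkIdeal J x) : ∃ U : X.affineOpens, x ∈ U.1 ∧ I.ideal U = J.ideal U := by
  obtain ⟨V, hxV, -, hV⟩ := exists_le_ideal_le h.le (W := ⊤) trivial
  obtain ⟨U, hxU, hUV, hU⟩ := exists_le_ideal_le h.ge hxV
  refine ⟨U, hxU, le_antisymm ?_ hU⟩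
  rw [← I.map_ideal' (homOfLE hUV).op, ← J.map_ideal' (homOfLE hUV).op]
  exact Ideal.map_mono hV

/-! ### Pull-back -/

theorem appLE_SpecMap_fromSpec {U : X.Opens} (hU : IsAffineOpen U) {C : CommRingCat.{u}}
    (χ : Γ(X, U) ⟶ C) (e : ⊤ ≤ (Spec.map χ ≫ hU.fromSpec) ⁻¹ᵁ U) :
    (Spec.map χ ≫ hU.fromSpec).appLE U ⊤ e = χ ≫ (Scheme.ΓSpecIso C).inv := by
  have e' : ⊤ ≤ Spec.map χ ⁻¹ᵁ (hU.fromSpec ⁻¹ᵁ U) := e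
  have h : (Spec.map χ ≫ hU.fromSpec).appLE U ⊤ e =
      hU.fromSpec.app U ≫ (Spec.map χ).appLE (hU.fromSpec ⁻¹ᵁ U) ⊤ e' :=
    Scheme.Hom.comp_appLE ..
  have h2 (W : (Spec Γ(X, U)).Opens) (hW : W = ⊤) (e : ⊤ ≤ Spec.map χ ⁻¹ᵁ W)
      (i : Opposite.op (⊤ : (Spec Γ(X, U)).Opens) ⟶ Opposite.op W) :
      (Scheme.ΓSpecIso Γ(X, U)).inv ≫ (Spec _).presheaf.map i ≫ (Spec.map χ).appLE W ⊤ e =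
        χ ≫ (Scheme.ΓSpecIso C).inv := by
    subst hW
    rw [Scheme.Hom.map_appLE, Scheme.ΓSpecIso_inv_naturality]
    rfl
  rw [h, IsAffineOpen.fromSpec_app_self, Category.assoc]
  exact h2 _ hU.fromSpec_preimage_self _ _

theorem stalkMap_germ_appLE (f : X ⟶ Y) {U : Y.Opens} {V : X.Opens} (e : V ≤ f ⁻¹ᵁ U) (x : X)
    (hx : x ∈ V) (hfx : f x ∈ U) : (f.stalkMap x).hom.comp (Y.presheaf.germ U (f x) hfx).hom =
      (X.presheaf.germ V x hx).hom.comp (f.appLE U V e).hom := by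
  rw [← CommRingCat.hom_comp, ← CommRingCat.hom_comp, Scheme.Hom.germ_stalkMap, Scheme.Hom.appLE,
    Category.assoc, TopCat.Presheaf.germ_res]

theorem SpecMap_fromSpec_mem {U : X.Opens} (hU : IsAffineOpen U) {C : CommRingCat.{u}}
    (χ : Γ(X, U) ⟶ C) (t : Spec C) : (Spec.map χ ≫ hU.fromSpec) t ∈ U := by
  have : hU.fromSpec (Spec.map χ t) ∈ Set.range hU.fromSpec := ⟨_, rfl⟩
  rwa [IsAffineOpen.range_fromSpec] at this

theorem ideal_comap_eq_map (I : Y.IdealSheafData) (f : X ⟶ Y) (U : Y.affineOpens)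
    (V : X.affineOpens) (e : V.1 ≤ f ⁻¹ᵁ U.1) :
    (I.comap f).ideal V = (I.ideal U).map (f.appLE U.1 V.1 e).hom := by
  have hV : IsAffineOpen V.1 := V.2
  apply le_antisymm
  · obtain ⟨K, hK⟩ : ∃ K, K = (I.ideal U).map (f.appLE U.1 V.1 e).hom := ⟨_, rfl⟩
    rw [← hK]
    -- `I` vanishes on the closed subscheme of `V` that `K` cuts out, so `I ≤ (j ≫ f).ker`; the
    -- adjunction between `comap` and `map` turns this into `I.comap f ≤ j.ker`.
    obtain ⟨C, χ, hχ⟩ : ∃ (C : CommRingCat.{u}) (χ : Γ(X, V.1) ⟶ C), ∀ a, χ a = 0 ↔ a ∈ K :=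
      ⟨CommRingCat.of (Γ(X, V.1) ⧸ K), CommRingCat.ofHom (Ideal.Quotient.mk K),
        fun a => Ideal.Quotient.eq_zero_iff_mem⟩
    let j := Spec.map χ ≫ hV.fromSpec
    have hjV : ⊤ ≤ j ⁻¹ᵁ V.1 := fun t _ => SpecMap_fromSpec_mem hV χ t
    have h1 : I ≤ (j ≫ f).ker := by
      refine Scheme.IdealSheafData.le_ofIdeals_iff.mpr fun W a ha => ?_
      rw [RingHom.mem_ker]
      refine TopCat.Presheaf.section_ext (Spec C).sheaf _ _ _ fun t ht => ?_
      have hW' : (j ≫ f) t ∈ W.1 := ht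
      have hU' : (j ≫ f) t ∈ U.1 := e (hjV (show t ∈ ⊤ from trivial))
      have h2 : Y.presheaf.germ W.1 ((j ≫ f) t) hW' a ∈
          (I.ideal U).map (Y.presheaf.germ U.1 ((j ≫ f) t) hU').hom := by
        rw [← stalkIdeal_eq I U hU', stalkIdeal_eq I W hW']
        exact Ideal.mem_map_of_mem _ ha
      have h3 : ⊤ ≤ (j ≫ f) ⁻¹ᵁ U.1 := fun t _ => e (hjV (show t ∈ ⊤ from trivial))
      have h4 : (I.ideal U).map (Y.presheaf.germ U.1 ((j ≫ f) t) hU').hom ≤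
          RingHom.ker ((j ≫ f).stalkMap t).hom := by
        rw [Ideal.map_le_iff_le_comap, RingHom.comap_ker,
          stalkMap_germ_appLE (j ≫ f) h3 t trivial hU',
          ← Scheme.Hom.appLE_comp_appLE j f U.1 V.1 ⊤ e hjV, appLE_SpecMap_fromSpec hV χ hjV]
        intro b hb
        have h5 : χ (f.appLE U.1 V.1 e b) = 0 := (hχ _).mpr (hK ▸ Ideal.mem_map_of_mem _ hb)
        have h6 := congr((Spec C).presheaf.germ ⊤ t trivial ((Scheme.ΓSpecIso C).inv $h5))
        refine h6.trans ?_
        exact (RingHom.map_zero ((Spec C).presheaf.germ ⊤ t trivial).hom) ▸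
          congr((Spec C).presheaf.germ ⊤ t trivial $(RingHom.map_zero (Scheme.ΓSpecIso C).inv.hom))
      have h5 := h4 h2
      rw [RingHom.mem_ker] at h5
      refine ((Scheme.Hom.germ_stalkMap_apply (j ≫ f) W.1 t ht a).symm.trans h5).trans ?_
      exact (RingHom.map_zero ((Spec C).presheaf.germ ((j ≫ f) ⁻¹ᵁ W.1) t ht).hom).symm
    have h2 : I.comap f ≤ j.ker := by
      rw [← Scheme.IdealSheafData.le_map_iff_comap_le, Scheme.IdealSheafData.map_ker]
      exact h1
    intro a ha
    have h3 := Scheme.Hom.ideal_ker_le j V (h2 V ha)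
    have h4 : (j.appLE V.1 ⊤ hjV).hom a = 0 := by
      rw [Scheme.Hom.appLE, CommRingCat.hom_comp, RingHom.comp_apply, RingHom.mem_ker.mp h3]
      exact RingHom.map_zero _
    rw [appLE_SpecMap_fromSpec hV χ hjV] at h4
    have h5 : χ ≫ (Scheme.ΓSpecIso C).inv ≫ (Scheme.ΓSpecIso C).hom = χ := by simp
    rw [← hχ, ← h5, ← Category.assoc]
    refine Eq.trans congr((Scheme.ΓSpecIso C).hom.hom $h4) ?_
    exact RingHom.map_zero _
  · rw [Ideal.map_le_iff_le_comap]
    intro a ha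
    have h := (Scheme.IdealSheafData.le_map_comap (J := I) (f := f)) U ha
    have h1 := Scheme.Hom.ideal_ker_le _ U h
    rw [RingHom.mem_ker] at h1
    rw [Ideal.mem_comap, ← Scheme.IdealSheafData.ker_subschemeι (I.comap f),
      Scheme.Hom.ker_apply, RingHom.mem_ker]
    have hle : (I.comap f).subschemeι ⁻¹ᵁ V.1 ≤ ((I.comap f).subschemeι ≫ f) ⁻¹ᵁ U.1 :=
      fun z hz => e hz
    have h2 : (((I.comap f).subschemeι ≫ f).appLE U.1 _ hle).hom a = 0 := by
      rw [Scheme.Hom.appLE, CommRingCat.hom_comp, RingHom.comp_apply, h1]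
      exact RingHom.map_zero _
    rw [← Scheme.Hom.appLE_comp_appLE (I.comap f).subschemeι f U.1 V.1 _ e le_rfl] at h2
    rw [Scheme.Hom.app_eq_appLE]
    exact h2

theorem stalkIdeal_comap (I : Y.IdealSheafData) (f : X ⟶ Y) (x : X) :
    stalkIdeal (I.comap f) x = (stalkIdeal I (f x)).map (f.stalkMap x).hom := by
  obtain ⟨U, hU, -⟩ := exists_affineOpens_mem (f x) (W := ⊤) trivial
  obtain ⟨V, hV, hVU⟩ := exists_affineOpens_mem x (W := f ⁻¹ᵁ U.1) hU
  rw [stalkIdeal_eq _ V hV, stalkIdeal_eq _ U hU, ideal_comap_eq_map I f U V hVU, Ideal.map_map,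
    Ideal.map_map, stalkMap_germ_appLE f hVU x hV hU]

/-! ### Ideal sheaves with prescribed stalk at one point -/

/-- The hypothesis `h𝔠` matters if `η` lies in `U` but not in the basic open set: then a power of
`f` lies in the contracted ideal, and both sides are the unit ideal. -/
theorem contraction_map_basicOpen (η : X) (𝔠 : Ideal (X.presheaf.stalk η))
    (h𝔠 : ∃ n, IsLocalRing.maximalIdeal (X.presheaf.stalk η) ^ n ≤ 𝔠) {U : X.Opens}
    (hU : IsAffineOpen U) (f : Γ(X, U)) :
    (⨅ h : η ∈ U, 𝔠.comap (X.presheaf.germ U η h).hom).map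
      (X.presheaf.map (homOfLE (X.basicOpen_le f)).op).hom =
      ⨅ h : η ∈ X.basicOpen f, 𝔠.comap (X.presheaf.germ (X.basicOpen f) η h).hom := by
  let := (X.presheaf.map (homOfLE (X.basicOpen_le f)).op).hom.toAlgebra
  have hloc : IsLocalization.Away f Γ(X, X.basicOpen f) := hU.isLocalization_basicOpen f
  by_cases hη : η ∈ U
  · by_cases hf : η ∈ X.basicOpen f
    · rw [iInf_pos hη, iInf_pos hf]
      change ((𝔠.comap _).map (algebraMap Γ(X, U) Γ(X, X.basicOpen f))) = _
      rw [← germ_res_comp (X.basicOpen_le f) η hf, ← Ideal.comap_comap]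
      exact IsLocalization.map_under (Submonoid.powers f) Γ(X, X.basicOpen f) _
    · rw [iInf_pos hη, iInf_neg hf]
      obtain ⟨n, hn⟩ := h𝔠
      have h1 : f ^ n ∈ 𝔠.comap (X.presheaf.germ U η hη).hom := by
        rw [Ideal.mem_comap, map_pow]
        exact hn (Ideal.pow_mem_pow ((germ_mem_maximalIdeal_iff hη f).mpr hf) n)
      have h2 : IsUnit ((X.presheaf.map (homOfLE (X.basicOpen_le f)).op).hom (f ^ n)) := by
        rw [map_pow]
        exact (RingedSpace.isUnit_res_basicOpen _ f).pow n
      exact Ideal.eq_top_of_isUnit_mem _ (Ideal.mem_map_of_mem _ h1) h2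
  · rw [iInf_neg hη, iInf_neg fun h => hη (X.basicOpen_le f h), Ideal.map_top]

/-- The ideal sheaf of all functions whose germ at `η` lies in the `𝔪_η`-primary ideal `𝔠`. -/
noncomputable def contractionIdeal (η : X) (𝔠 : Ideal (X.presheaf.stalk η))
    (h𝔠 : ∃ n, IsLocalRing.maximalIdeal (X.presheaf.stalk η) ^ n ≤ 𝔠) : X.IdealSheafData where
  ideal U := ⨅ h : η ∈ U.1, 𝔠.comap (X.presheaf.germ U.1 η h).hom
  map_ideal_basicOpen U f := by
    have hU' : IsAffineOpen U.1 := U.2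
    exact contraction_map_basicOpen η 𝔠 h𝔠 hU' f

theorem le_contractionIdeal_iff {J : X.IdealSheafData} {η : X} {𝔠 : Ideal (X.presheaf.stalk η)}
    {h𝔠 : ∃ n, IsLocalRing.maximalIdeal (X.presheaf.stalk η) ^ n ≤ 𝔠} :
    J ≤ contractionIdeal η 𝔠 h𝔠 ↔ stalkIdeal J η ≤ 𝔠 := by
  constructor
  · intro h
    obtain ⟨U, hU, -⟩ := exists_affineOpens_mem η (W := ⊤) trivial
    rw [stalkIdeal_eq J U hU, Ideal.map_le_iff_le_comap]
    exact (h U).trans (iInf_le _ hU)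
  · intro h U
    refine le_iInf fun hU => ?_
    rw [← Ideal.map_le_iff_le_comap, ← stalkIdeal_eq]
    exact h

theorem stalkIdeal_contractionIdeal {η : X} {𝔠 : Ideal (X.presheaf.stalk η)}
    {h𝔠 : ∃ n, IsLocalRing.maximalIdeal (X.presheaf.stalk η) ^ n ≤ 𝔠} {y : X} (h : η ⤳ y) :
    stalkIdeal (contractionIdeal η 𝔠 h𝔠) y = 𝔠.comap (X.presheaf.stalkSpecializes h).hom := by
  obtain ⟨U, hU, -⟩ := exists_affineOpens_mem y (W := ⊤) trivial
  rw [stalkIdeal_eq _ U hU]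
  change (⨅ h : η ∈ U.1, 𝔠.comap (X.presheaf.germ U.1 η h).hom).map _ = _
  rw [iInf_pos (show η ∈ U.1 from h.mem_open U.1.2 hU), ← germ_comp_stalkSpecializes h hU, ← Ideal.comap_comap]
  let := (X.presheaf.germ U.1 y hU).hom.toAlgebra
  have := isLocalization_stalk U y hU
  exact IsLocalization.map_under (primeAt U y hU).primeCompl (X.presheaf.stalk y) _

theorem stalkIdeal_contractionIdeal_of_not_specializes {η : X} {𝔠 : Ideal (X.presheaf.stalk η)}
    {h𝔠 : ∃ n, IsLocalRing.maximalIdeal (X.presheaf.stalk η) ^ n ≤ 𝔠} {y : X} (h : ¬ η ⤳ y) :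
    stalkIdeal (contractionIdeal η 𝔠 h𝔠) y = ⊤ := by
  rw [specializes_iff_forall_open] at h
  push Not at h
  obtain ⟨W, hW, hyW, hηW⟩ := h
  obtain ⟨U, hU, hUW⟩ := exists_affineOpens_mem y (W := ⟨W, hW⟩) hyW
  rw [stalkIdeal_eq _ U hU]
  change (⨅ h : η ∈ U.1, 𝔠.comap (X.presheaf.germ U.1 η h).hom).map _ = _
  rw [iInf_neg (fun h => hηW (hUW h)), Ideal.map_top]

end Toroidal

/-! ### Points of affine opens -/

namespace Toroidal

variable {X : Scheme.{u}}

theorem exists_primeAt_eq (U : X.affineOpens) (𝔭 : Ideal Γ(X, U.1)) [h𝔭 : 𝔭.IsPrime] :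
    ∃ (η : X) (hη : η ∈ U.1), primeAt U η hη = 𝔭 := by
  have hU : IsAffineOpen U.1 := U.2
  let t : Spec Γ(X, U.1) := ⟨𝔭, h𝔭⟩
  have ht : hU.fromSpec t ∈ U.1 := by
    have : hU.fromSpec t ∈ Set.range hU.fromSpec := ⟨_, rfl⟩
    rwa [IsAffineOpen.range_fromSpec] at this
  refine ⟨hU.fromSpec t, ht, ?_⟩
  ext a
  rw [mem_primeAt]
  have h : hU.fromSpec t ∈ X.basicOpen a ↔ a ∉ 𝔭 := by
    refine Iff.trans ?_ (PrimeSpectrum.mem_basicOpen a (⟨𝔭, h𝔭⟩ : PrimeSpectrum Γ(X, U.1)))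
    rw [← hU.fromSpec_preimage_basicOpen a]; rfl
  rw [h, not_not]

theorem specializes_iff_primeAt_le {U : X.affineOpens} {η y : X} (hη : η ∈ U.1) (hy : y ∈ U.1) :
    η ⤳ y ↔ primeAt U η hη ≤ primeAt U y hy := by
  constructor
  · intro h a ha
    rw [mem_primeAt] at ha ⊢
    exact fun hc => ha (h.mem_open (X.basicOpen a).2 hc)
  · intro h
    rw [specializes_iff_forall_open]
    intro W hW hyW
    have hU : IsAffineOpen U.1 := U.2
    obtain ⟨f, hf, hyf⟩ := hU.exists_basicOpen_le (V := ⟨W, hW⟩) ⟨y, hyW⟩ hy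
    by_contra hc
    have : f ∈ primeAt U η hη := mem_primeAt.mpr fun h => hc (hf h)
    exact mem_primeAt.mp (h this) hyf

theorem eq_of_primeAt_eq {U : X.affineOpens} {η y : X} {hη : η ∈ U.1} {hy : y ∈ U.1}
    (h : primeAt U η hη = primeAt U y hy) : η = y :=
  (((specializes_iff_primeAt_le hη hy).mpr h.le).antisymm
    ((specializes_iff_primeAt_le hy hη).mpr h.ge)).eq

theorem maximalIdeal_eq_map_primeAt (U : X.affineOpens) {y : X} (hy : y ∈ U.1) :
    IsLocalRing.maximalIdeal (X.presheaf.stalk y) =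
      (primeAt U y hy).map (X.presheaf.germ U.1 y hy).hom := by
  let := (X.presheaf.germ U.1 y hy).hom.toAlgebra
  have := isLocalization_stalk U y hy
  exact (IsLocalization.AtPrime.map_eq_maximalIdeal (primeAt U y hy) _).symm

theorem map_comap_germ (U : X.affineOpens) {y : X} (hy : y ∈ U.1)
    (𝔞 : Ideal (X.presheaf.stalk y)) :
    (𝔞.comap (X.presheaf.germ U.1 y hy).hom).map (X.presheaf.germ U.1 y hy).hom = 𝔞 := by
  let := (X.presheaf.germ U.1 y hy).hom.toAlgebra
  have := isLocalization_stalk U y hy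
  exact IsLocalization.map_under (primeAt U y hy).primeCompl _ 𝔞

/-- The generalization of `y` that belongs to a prime ideal of the local ring at `y`. -/
theorem exists_specializes_of_isPrime {y : X} (𝔭 : Ideal (X.presheaf.stalk y)) [h𝔭 : 𝔭.IsPrime] :
    ∃ (η : X) (h : η ⤳ y), IsLocalRing.maximalIdeal (X.presheaf.stalk η) =
        𝔭.map (X.presheaf.stalkSpecializes h).hom ∧
      (IsLocalRing.maximalIdeal (X.presheaf.stalk η)).comap (X.presheaf.stalkSpecializes h).hom
        = 𝔭 := by
  obtain ⟨U, hy, -⟩ := exists_affineOpens_mem y (W := ⊤) trivial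
  obtain ⟨η, hη, h⟩ := exists_primeAt_eq U (𝔭.comap (X.presheaf.germ U.1 y hy).hom)
  have hs : η ⤳ y := by
    rw [specializes_iff_primeAt_le hη hy, h]
    exact Ideal.comap_mono (IsLocalRing.le_maximalIdeal h𝔭.ne_top)
  refine ⟨η, hs, ?_, ?_⟩
  · rw [maximalIdeal_eq_map_primeAt U hη, h, ← germ_comp_stalkSpecializes hs hy, ← Ideal.map_map,
      map_comap_germ]
  · rw [← map_comap_germ U hy 𝔭, ← h, ← map_comap_germ U hy (Ideal.comap _ _), Ideal.comap_comap,
      germ_comp_stalkSpecializes]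
    rfl

/-- Generizations of `y` correspond to primes of its local ring, and specialization among them to
inclusion. -/
theorem specializes_of_comap_le {η w y : X} (h : η ⤳ y) (h' : w ⤳ y)
    (hle : (IsLocalRing.maximalIdeal _).comap (X.presheaf.stalkSpecializes h).hom ≤
      (IsLocalRing.maximalIdeal _).comap (X.presheaf.stalkSpecializes h').hom) : η ⤳ w := by
  obtain ⟨U, hy, -⟩ := exists_affineOpens_mem y (W := ⊤) trivial
  rw [specializes_iff_primeAt_le (h.mem_open U.1.2 hy) (h'.mem_open U.1.2 hy), primeAt, primeAt,
    ← germ_comp_stalkSpecializes h hy, ← germ_comp_stalkSpecializes h' hy, ← Ideal.comap_comap,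
    ← Ideal.comap_comap]
  exact Ideal.comap_mono hle

/-- The local ring at `η` is a localization of that at `y`, so a prime that does not become the unit
ideal contracts to itself. -/
theorem comap_stalkSpecializes_map_le {η y : X} (h : η ⤳ y) (𝔭 : Ideal (X.presheaf.stalk y))
    [h𝔭 : 𝔭.IsPrime] (ht : 𝔭.map (X.presheaf.stalkSpecializes h).hom ≠ ⊤) :
    (𝔭.map (X.presheaf.stalkSpecializes h).hom).comap (X.presheaf.stalkSpecializes h).hom ≤ 𝔭 := by
  obtain ⟨U, hy, -⟩ := exists_affineOpens_mem y (W := ⊤) trivial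
  have hη := h.mem_open U.1.2 hy
  intro z hz
  obtain ⟨a, s, hs, hzs⟩ := exists_germ_mul_eq U hy z
  have hsu : IsUnit (X.presheaf.germ U.1 y hy s) := (X.mem_basicOpen _ _ hy).mp hs
  have h𝔮 : (𝔭.comap (X.presheaf.germ U.1 y hy).hom).map (X.presheaf.germ U.1 η hη).hom =
      𝔭.map (X.presheaf.stalkSpecializes h).hom := by
    rw [← germ_comp_stalkSpecializes h hy, ← Ideal.map_map, map_comap_germ]
  have h1 : X.presheaf.germ U.1 η hη a ∈ 𝔭.map (X.presheaf.stalkSpecializes h).hom := by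
    have h2 := congr((X.presheaf.stalkSpecializes h).hom $hzs)
    have h3 := congr($(germ_comp_stalkSpecializes h hy) a)
    rw [RingHom.comp_apply] at h3
    refine h3 ▸ ?_
    refine h2 ▸ ?_
    rw [map_mul]
    exact Ideal.mul_mem_right _ _ hz
  rw [← h𝔮, germ_mem_map_iff] at h1
  obtain ⟨t, ht1, ht2⟩ := h1
  have ht3 : t ∉ 𝔭.comap (X.presheaf.germ U.1 y hy).hom := by
    intro hc
    refine ht (Ideal.eq_top_of_isUnit_mem _ ?_ ((X.mem_basicOpen _ _ hη).mp ht1))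
    rw [← h𝔮]
    exact Ideal.mem_map_of_mem _ hc
  have ha := ((Ideal.IsPrime.comap (X.presheaf.germ U.1 y hy).hom).mem_or_mem ht2).resolve_left ht3
  rw [Ideal.mem_comap] at ha
  have ha' : z * X.presheaf.germ U.1 y hy s ∈ 𝔭 := hzs ▸ ha
  exact (Ideal.mul_unit_mem_iff_mem _ hsu).mp ha'

theorem mem_ideal_vanishingIdeal {Z : Closeds X} {U : X.affineOpens} {a : Γ(X, U.1)} :
    a ∈ (Scheme.IdealSheafData.vanishingIdeal Z).ideal U ↔
      ∀ q ∈ U.1, q ∈ Z → q ∉ X.basicOpen a := by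
  have hU : IsAffineOpen U.1 := U.2
  have h (t : Spec Γ(X, U.1)) : hU.fromSpec t ∈ X.basicOpen a ↔ t ∈ PrimeSpectrum.basicOpen a := by
    rw [← hU.fromSpec_preimage_basicOpen a]; rfl
  rw [Scheme.IdealSheafData.vanishingIdeal_ideal, PrimeSpectrum.mem_vanishingIdeal]
  constructor
  · intro H q hq hqZ hc
    have hq' : q ∈ Set.range hU.fromSpec := by rwa [IsAffineOpen.range_fromSpec]
    obtain ⟨t, rfl⟩ := hq'
    exact (PrimeSpectrum.mem_basicOpen _ _).mp ((h t).mp hc) (H t hqZ)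
  · intro H t ht
    have htU : hU.fromSpec t ∈ U.1 := by
      have : hU.fromSpec t ∈ Set.range hU.fromSpec := ⟨_, rfl⟩
      rwa [IsAffineOpen.range_fromSpec] at this
    by_contra hc
    exact H _ htU ht ((h t).mpr ((PrimeSpectrum.mem_basicOpen _ _).mpr hc))

/-- If the functions `a` cut out `Z` on `U` and generate a prime ideal at `y ∈ Z`, then they
generate the ideal of `Z` at `y`. -/
theorem stalkIdeal_vanishingIdeal {Z : Closeds X} {U : X.affineOpens} {y : X} (hy : y ∈ U.1)
    {𝔞 : Ideal Γ(X, U.1)} (hZ : ∀ q (hq : q ∈ U.1), q ∈ Z ↔ 𝔞 ≤ primeAt U q hq)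
    (h𝔞 : (𝔞.map (X.presheaf.germ U.1 y hy).hom).IsPrime) :
    stalkIdeal (Scheme.IdealSheafData.vanishingIdeal Z) y =
      𝔞.map (X.presheaf.germ U.1 y hy).hom := by
  rw [stalkIdeal_eq _ U hy]
  apply le_antisymm
  · rw [Ideal.map_le_iff_le_comap]
    intro a ha
    rw [mem_ideal_vanishingIdeal] at ha
    obtain ⟨η, hη, h⟩ := exists_primeAt_eq U
      ((𝔞.map (X.presheaf.germ U.1 y hy).hom).comap (X.presheaf.germ U.1 y hy).hom)
    rw [← h, mem_primeAt]
    exact ha η hη ((hZ η hη).mpr (h ▸ Ideal.le_comap_map))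
  · refine Ideal.map_mono fun a ha => mem_ideal_vanishingIdeal.mpr fun q hq hqZ => ?_
    exact mem_primeAt.mp ((hZ q hq).mp hqZ ha)

theorem stalkIdeal_vanishingIdeal_of_notMem {Z : Closeds X} {y : X} (hy : y ∉ Z) :
    stalkIdeal (Scheme.IdealSheafData.vanishingIdeal Z) y = ⊤ := by
  obtain ⟨U, hyU, hU⟩ := exists_affineOpens_mem y (W := Z.compl) hy
  rw [stalkIdeal_eq _ U hyU]
  have : (Scheme.IdealSheafData.vanishingIdeal Z).ideal U = ⊤ := by
    rw [Ideal.eq_top_iff_one, mem_ideal_vanishingIdeal]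
    exact fun q hq hqZ => absurd hqZ (hU hq)
  rw [this, Ideal.map_top]

theorem stalkIdeal_vanishingIdeal_le_maximalIdeal {Z : Closeds X} {y : X} (hy : y ∈ Z) :
    stalkIdeal (Scheme.IdealSheafData.vanishingIdeal Z) y ≤
      IsLocalRing.maximalIdeal (X.presheaf.stalk y) := by
  obtain ⟨U, hyU, -⟩ := exists_affineOpens_mem y (W := ⊤) trivial
  rw [stalkIdeal_eq _ U hyU, Ideal.map_le_iff_le_comap]
  exact fun a ha => mem_primeAt.mpr (mem_ideal_vanishingIdeal.mp ha y hyU hy)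

end Toroidal

/-! ### Charts of a pair -/

namespace Toroidal

/-- An irreducible closed set is the closure of its trace on any open set that it meets. -/
theorem irreducibleCloseds_eq_of_forall {X : Type*} [TopologicalSpace X] {V W : IrreducibleCloseds X}
    {U : Opens X} {y : X} (hy : y ∈ U) (hV : y ∈ V) (h : ∀ q ∈ U, q ∈ V ↔ q ∈ W) : V = W := by
  have key : ∀ V W : IrreducibleCloseds X, y ∈ V → (∀ q ∈ U, q ∈ V ↔ q ∈ W) → V ≤ W := by
    intro V W hV h
    have h1 := subset_closure_inter_of_isPreirreducible_of_isOpen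
      V.isIrreducible.isPreirreducible U.2 ⟨y, hV, hy⟩
    exact h1.trans (closure_minimal (fun q hq => (h q hq.2).mp hq.1) W.isClosed)
  exact le_antisymm (key V W hV h) (key W V ((h y hy).mp hV) fun q hq => (h q hq).symm)

variable {k : Type u} [Field k]

namespace LogPair

/-- `X` is quasi-compact, and near every point there are local coordinates such that the `D_i`
through that point are among the coordinate hyperplanes. -/
structure IsLocallySnc (P : LogPair k) : Prop where
  compactSpace : CompactSpace P.X
  exists_coordinates : ∀ p : P.X, ∃ (U : P.X.affineOpens) (n : ℕ) (x : Fin n → Γ(P.X, U.1)),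
    p ∈ U.1 ∧ P.IsCoordinates U x ∧ P.IsAdapted p U x

theorem IsSnc.isLocallySnc {P : LogPair k} (h : P.IsSnc) : P.IsLocallySnc where
  compactSpace := by
    have := h.quasiCompact
    exact QuasiCompact.compactSpace_of_compactSpace P.hom
  exists_coordinates := h.exists_coordinates

variable {P : LogPair k} {U : P.X.affineOpens} {n : ℕ} {x : Fin n → Γ(P.X, U.1)} {y η : P.X}

/-- The ring map `k[X_1, …, X_n] → Γ(X, U)` that belongs to functions `x_1, …, x_n` on `U`. -/
noncomputable def coordHom (x : Fin n → Γ(P.X, U.1)) : MvPolynomial (Fin n) k →+* Γ(P.X, U.1) :=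
  MvPolynomial.eval₂Hom (P.scalars U.1) x

/-- The ring map `k[X_1, …, X_n] → 𝒪_{X,y}` that belongs to functions `x_1, …, x_n` near `y`. -/
noncomputable def coordStalk (x : Fin n → Γ(P.X, U.1)) (hy : y ∈ U.1) :
    MvPolynomial (Fin n) k →+* P.X.presheaf.stalk y :=
  (P.X.presheaf.germ U.1 y hy).hom.comp (coordHom x)

open Classical in
/-- The coordinates whose vanishing loci are components of `Δ` through `y`. -/
noncomputable def faces (x : Fin n → Γ(P.X, U.1)) (y : P.X) : Finset (Fin n) :=
  {j | ∃ D ∈ P.Δ, y ∈ D ∧ ∀ q ∈ U.1, q ∈ D ↔ q ∉ P.X.basicOpen (x j)}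

theorem mem_faces {j : Fin n} : j ∈ faces x y ↔
    ∃ D ∈ P.Δ, y ∈ D ∧ ∀ q ∈ U.1, q ∈ D ↔ q ∉ P.X.basicOpen (x j) := by
  simp [faces]

/-- The `x_j` are local coordinates on `U ∋ y` such that the components of `Δ` through `y` are
among the coordinate hyperplanes. -/
structure IsChart (x : Fin n → Γ(P.X, U.1)) (y : P.X) : Prop where
  mem : y ∈ U.1
  etale : P.IsCoordinates U x
  adapted : P.IsAdapted y U x

theorem IsLocallySnc.exists_isChart (hP : P.IsLocallySnc) (y : P.X) :
    ∃ (U : P.X.affineOpens) (n : ℕ) (x : Fin n → Γ(P.X, U.1)), IsChart x y := by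
  obtain ⟨U, n, x, h1, h2, h3⟩ := hP.exists_coordinates y
  exact ⟨U, n, x, h1, h2, h3⟩

theorem coordHom_X (j : Fin n) : coordHom x (.X j) = x j :=
  MvPolynomial.eval₂_X _ _ _

theorem coordStalk_X (hy : y ∈ U.1) (j : Fin n) :
    coordStalk x hy (.X j) = P.X.presheaf.germ U.1 y hy (x j) :=
  congr(P.X.presheaf.germ U.1 y hy $(coordHom_X j))

theorem comp_coordStalk (h : η ⤳ y) (hy : y ∈ U.1) :
    (P.X.presheaf.stalkSpecializes h).hom.comp (coordStalk x hy) =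
      coordStalk x (h.mem_open U.1.2 hy) := by
  rw [coordStalk, ← RingHom.comp_assoc, germ_comp_stalkSpecializes]; rfl

theorem map_posOn_coordHom (T : Finset (Fin n)) :
    (monomialIdeal k (posOn T)).map (coordHom x) = Ideal.span (x '' T) := by
  rw [monomialIdeal_posOn, Ideal.map_span, ← Set.image_comp]
  congr 1
  exact Set.image_congr fun j _ => coordHom_X j

theorem map_posOn_coordStalk (hy : y ∈ U.1) (T : Finset (Fin n)) :
    (monomialIdeal k (posOn T)).map (coordStalk x hy) =
      (Ideal.span (x '' T)).map (P.X.presheaf.germ U.1 y hy).hom := by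
  rw [coordStalk, ← Ideal.map_map, map_posOn_coordHom]

theorem IsCoordinates.isToricFrame (h : P.IsCoordinates U x) (hy : y ∈ U.1) {S : Finset (Fin n)}
    (hS : ∀ j ∈ S, y ∉ P.X.basicOpen (x j)) : IsToricFrame (coordStalk x hy) S := by
  let := (P.X.presheaf.germ U.1 y hy).hom.toAlgebra
  have := isLocalization_stalk U y hy
  exact RingHom.Etale.isToricFrame (O := P.X.presheaf.stalk y) (A := Γ(P.X, U.1)) h
    (primeAt U y hy) fun j hj => by
      rw [mem_primeAt]
      exact (coordHom_X (x := x) j).symm ▸ hS j hj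

/-- `X_j` is a non-zero-divisor modulo the variables in `T`, and stays one by flatness. If it lay in
the extended ideal, that ideal would be the whole ring. -/
theorem _root_.Toroidal.IsToricFrame.X_notMem {σ O : Type*} [CommRing O] [IsLocalRing O]
    {ψ : MvPolynomial σ k →+* O} {S T : Finset σ} (h : IsToricFrame ψ S) (hT : T ⊆ S) {j : σ}
    (hj : j ∉ T) : ψ (.X j) ∉ (monomialIdeal k (posOn T)).map ψ := by
  intro hc
  refine (h.prime T hT).ne_top ((Ideal.eq_top_iff_one _).mpr ?_)
  refine flat_colon h.flat (r := .X j) (I := monomialIdeal k (posOn T)) ?_ (by rwa [mul_one])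
  intro p hp
  have h1 := mem_monomialIdeal_of_monomial_mul_mem (isUpperOn_posOn T).isUpperSet
    (Finsupp.single j 1) hp
  convert h1 using 3
  ext a
  refine exists_congr fun i => and_congr_right fun hi => ?_
  have : i ≠ j := fun h => hj (h ▸ hi)
  simp [this.symm]

theorem IsCoordinates.stalkIdeal_vanishingIdeal (h : P.IsCoordinates U x) (hy : y ∈ U.1)
    {Z : Closeds P.X} {T : Finset (Fin n)}
    (hZ : ∀ q ∈ U.1, q ∈ Z ↔ ∀ j ∈ T, q ∉ P.X.basicOpen (x j)) (hyZ : y ∈ Z) :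
    stalkIdeal (Scheme.IdealSheafData.vanishingIdeal Z) y =
      (monomialIdeal k (posOn T)).map (coordStalk x hy) := by
  have hp := (h.isToricFrame hy ((hZ y hy).mp hyZ)).prime T subset_rfl
  rw [map_posOn_coordStalk] at hp ⊢
  refine Toroidal.stalkIdeal_vanishingIdeal hy (fun q hq => ?_) hp
  rw [hZ q hq, Ideal.span_le, Set.image_subset_iff]
  exact forall₂_congr fun j hj => mem_primeAt.symm

namespace IsChart

theorem of_specializes (h : IsChart x y) (hs : η ⤳ y) : IsChart x η where
  mem := hs.mem_open U.1.2 h.mem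
  etale := h.etale
  adapted D hD hη := h.adapted D hD (hs.mem_closed D.isClosed hη)

theorem mem_faces_iff_of_specializes (h : IsChart x y) (hs : η ⤳ y) {j : Fin n} :
    j ∈ faces x η ↔ j ∈ faces x y ∧ η ∉ P.X.basicOpen (x j) := by
  have hη := hs.mem_open U.1.2 h.mem
  simp only [mem_faces]
  constructor
  · rintro ⟨D, hD, hηD, hj⟩
    exact ⟨⟨D, hD, hs.mem_closed D.isClosed hηD, hj⟩, (hj η hη).mp hηD⟩
  · rintro ⟨⟨D, hD, -, hj⟩, h⟩
    exact ⟨D, hD, (hj η hη).mpr h, hj⟩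

theorem faces_subset_of_specializes (h : IsChart x y) (hs : η ⤳ y) : faces x η ⊆ faces x y :=
  fun _ hj => ((h.mem_faces_iff_of_specializes hs).mp hj).1

theorem notMem_basicOpen (h : IsChart x y) {j : Fin n} (hj : j ∈ faces x y) :
    y ∉ P.X.basicOpen (x j) := by
  obtain ⟨D, -, hyD, h'⟩ := mem_faces.mp hj
  exact (h' y h.mem).mp hyD

theorem isToricFrame (h : IsChart x y) : IsToricFrame (coordStalk x h.mem) (faces x y) :=
  h.etale.isToricFrame h.mem fun _ hj => h.notMem_basicOpen hj

theorem stalkIdeal_component (h : IsChart x y) {D : IrreducibleCloseds P.X} (hyD : y ∈ D)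
    {j : Fin n} (hj : ∀ q ∈ U.1, q ∈ D ↔ q ∉ P.X.basicOpen (x j)) :
    stalkIdeal (Scheme.IdealSheafData.vanishingIdeal (⟨D, D.isClosed⟩ : Closeds P.X)) y =
      Ideal.span {coordStalk x h.mem (.X j)} := by
  rw [h.etale.stalkIdeal_vanishingIdeal (T := {j}) h.mem (fun q hq => ?_) hyD, monomialIdeal_posOn,
    Ideal.map_span, Finset.coe_singleton, Set.image_singleton, Set.image_singleton]
  refine (hj q hq).trans ⟨fun h i hi => ?_, fun h => h j (Finset.mem_singleton_self j)⟩
  rwa [Finset.mem_singleton.mp hi]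

/-- Different coordinates belong to different components, since `X_i` is not in the ideal generated
by `X_j` at `y` (`X_notMem`). A component through `y` is determined by its trace on `U`. -/
theorem exists_components (h : IsChart x y) : ∃ D : Fin n → IrreducibleCloseds P.X,
    (∀ j ∈ faces x y, D j ∈ P.Δ ∧ y ∈ D j ∧ ∀ q ∈ U.1, q ∈ D j ↔ q ∉ P.X.basicOpen (x j)) ∧
    Set.InjOn D (faces x y) ∧ ∀ D' ∈ P.Δ, y ∈ D' → ∃ j ∈ faces x y, D j = D' := by
  have : Nonempty (IrreducibleCloseds P.X) :=
    ⟨⟨closure {y}, isIrreducible_singleton.closure, isClosed_closure⟩⟩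
  have h1 : ∀ j, j ∈ faces x y → ∃ D ∈ P.Δ, y ∈ D ∧ ∀ q ∈ U.1, q ∈ D ↔ q ∉ P.X.basicOpen (x j) :=
    fun j => mem_faces.mp
  choose! D hD using h1
  refine ⟨D, hD, ?_, ?_⟩
  · intro i hi j hj hij
    by_contra hne
    have h1 := h.stalkIdeal_component (hD i hi).2.1 (hD i hi).2.2
    have h2 := h.stalkIdeal_component (hD j hj).2.1 (hD j hj).2.2
    rw [hij, h2] at h1
    refine h.isToricFrame.X_notMem (T := {j}) (j := i) (Finset.singleton_subset_iff.mpr hj)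
      (by simpa using hne) ?_
    rw [monomialIdeal_posOn, Ideal.map_span, Finset.coe_singleton, Set.image_singleton,
      Set.image_singleton, h1]
    exact Ideal.mem_span_singleton_self _
  · intro D' hD' hy
    obtain ⟨j, hj⟩ := h.adapted D' hD' hy
    have hjf : j ∈ faces x y := mem_faces.mpr ⟨D', hD', hy, hj⟩
    refine ⟨j, hjf, irreducibleCloseds_eq_of_forall h.mem (hD j hjf).2.1 fun q hq => ?_⟩
    rw [(hD j hjf).2.2 q hq, hj q hq]

theorem stalkIdeal_divisorIdeal (h : IsChart x y) {D : Fin n → IrreducibleCloseds P.X}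
    (hD : ∀ j ∈ faces x y, D j ∈ P.Δ ∧ y ∈ D j ∧ ∀ q ∈ U.1, q ∈ D j ↔ q ∉ P.X.basicOpen (x j))
    (hinj : Set.InjOn D (faces x y)) (hsurj : ∀ D' ∈ P.Δ, y ∈ D' → ∃ j ∈ faces x y, D j = D')
    (m : IrreducibleCloseds P.X → ℕ) :
    stalkIdeal (P.divisorIdeal m) y = Ideal.span {coordStalk x h.mem
      (MvPolynomial.monomial (∑ j ∈ faces x y, Finsupp.single j (m (D j))) 1)} := by
  classical
  have h1 : (faces x y).image D ⊆ P.Δ := by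
    rw [Finset.image_subset_iff]
    exact fun j hj => (hD j hj).1
  rw [divisorIdeal, stalkIdeal_prod]
  simp only [stalkIdeal_pow]
  rw [← Finset.prod_subset h1, Finset.prod_image hinj, MvPolynomial.monomial_sum_one,
    map_prod, ← Ideal.prod_span_singleton]
  · refine Finset.prod_congr rfl fun j hj => ?_
    rw [h.stalkIdeal_component (hD j hj).2.1 (hD j hj).2.2, Ideal.span_singleton_pow, ← map_pow,
      MvPolynomial.X_pow_eq_monomial]
  · intro D' hD' hne
    rw [stalkIdeal_vanishingIdeal_of_notMem, ← Ideal.one_eq_top, one_pow]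
    intro hy
    obtain ⟨j, hj, rfl⟩ := hsurj D' hD' hy
    exact hne (Finset.mem_image_of_mem _ hj)

end IsChart

/-! ### Toroidal ideals at a point -/

/-- An ideal of the local ring at `y` that is generated by monomials in the equations of the
components of `Δ`. -/
def IsMonomialAt (P : LogPair k) (y : P.X) (𝔠 : Ideal (P.X.presheaf.stalk y)) : Prop :=
  ∃ M : Set (IrreducibleCloseds P.X → ℕ), 𝔠 = ⨆ m ∈ M, stalkIdeal (P.divisorIdeal m) y

theorem _root_.Toroidal.monomial_add_one {σ : Type*} (a b : σ →₀ ℕ) :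
    MvPolynomial.monomial (a + b) (1 : k) =
      MvPolynomial.monomial a 1 * MvPolynomial.monomial b 1 := by
  rw [MvPolynomial.monomial_mul, one_mul]

/-- Components that miss `y` contribute units, so only the multiplicities along the coordinates in
`faces x y` count; this is why the exponent sets are upper on `faces x y`. -/
theorem IsChart.isMonomialAt_iff (h : IsChart x y) {𝔠 : Ideal (P.X.presheaf.stalk y)} :
    P.IsMonomialAt y 𝔠 ↔ ∃ V : Set (Fin n →₀ ℕ), IsUpperOn (faces x y) V ∧
      𝔠 = (monomialIdeal k V).map (coordStalk x h.mem) := by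
  classical
  obtain ⟨D, hD, hinj, hsurj⟩ := h.exists_components
  let e : (IrreducibleCloseds P.X → ℕ) → (Fin n →₀ ℕ) :=
    fun m => ∑ j ∈ faces x y, Finsupp.single j (m (D j))
  have he (m) (i) (hi : i ∈ faces x y) : e m i = m (D i) := by
    simp only [e, Finsupp.finsetSum_apply, Finsupp.single_apply]
    rw [Finset.sum_ite_eq' , if_pos hi]
  have he' (m) (i) (hi : i ∉ faces x y) : e m i = 0 := by
    simp only [e, Finsupp.finsetSum_apply, Finsupp.single_apply]
    rw [Finset.sum_ite_eq' , if_neg hi]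
  have key (m) : stalkIdeal (P.divisorIdeal m) y =
      Ideal.span {coordStalk x h.mem (MvPolynomial.monomial (e m) 1)} :=
    h.stalkIdeal_divisorIdeal hD hinj hsurj m
  constructor
  · rintro ⟨M, rfl⟩
    refine ⟨{b | ∃ m ∈ M, ∀ i ∈ faces x y, e m i ≤ b i}, ?_, ?_⟩
    · rintro a ⟨m, hm, ha⟩ b hab
      exact ⟨m, hm, fun i hi => (ha i hi).trans (hab i hi)⟩
    · apply le_antisymm
      · refine iSup₂_le fun m hm => ?_
        rw [key, Ideal.span_singleton_le_iff_mem]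
        exact Ideal.mem_map_of_mem _ (monomial_mem_monomialIdeal ⟨m, hm, fun i _ => le_rfl⟩)
      · rw [monomialIdeal, Ideal.map_span, Ideal.span_le]
        rintro _ ⟨_, ⟨b, ⟨m, hm, hb⟩, rfl⟩, rfl⟩
        have hle : e m ≤ b := by
          intro i
          by_cases hi : i ∈ faces x y
          · exact hb i hi
          · rw [he' m i hi]; exact Nat.zero_le _
        obtain ⟨c, rfl⟩ := exists_add_of_le hle
        refine (le_iSup₂ (f := fun m (_ : m ∈ M) => stalkIdeal (P.divisorIdeal m) y) m hm) ?_
        rw [key]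
        change coordStalk x h.mem (MvPolynomial.monomial (e m + c) 1) ∈ _
        rw [monomial_add_one, map_mul]
        exact Ideal.mul_mem_right _ _ (Ideal.mem_span_singleton_self _)
  · rintro ⟨V, hV, rfl⟩
    refine ⟨{m | e m ∈ V}, le_antisymm ?_ (iSup₂_le fun m hm => ?_)⟩
    · rw [monomialIdeal, Ideal.map_span, Ideal.span_le]
      rintro _ ⟨_, ⟨b, hb, rfl⟩, rfl⟩
      -- At `D i` only the term with index `i` survives, because `D` is injective on `faces x y`.
      let m : IrreducibleCloseds P.X → ℕ := fun D' =>
        (∑ i ∈ faces x y, if D i = D' then b i else 0)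
      have hm (i) (hi : i ∈ faces x y) : m (D i) = b i := by
        simp only [m]
        rw [Finset.sum_eq_single i, if_pos rfl]
        · intro j hj hji
          rw [if_neg fun hc => hji (hinj hj hi hc)]
        · exact fun hc => absurd hi hc
      have hmV : e m ∈ V := hV b hb _ fun i hi => by rw [he m i hi, hm i hi]
      have hle : e m ≤ b := by
        intro i
        by_cases hi : i ∈ faces x y
        · rw [he m i hi, hm i hi]
        · rw [he' m i hi]; exact Nat.zero_le _
      obtain ⟨c, hc⟩ := exists_add_of_le hle
      refine (le_iSup₂ (f := fun m (_ : m ∈ {m | e m ∈ V}) =>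
        stalkIdeal (P.divisorIdeal m) y) m hmV) ?_
      rw [key, hc]
      change coordStalk x h.mem (MvPolynomial.monomial (e m + c) 1) ∈ _
      rw [monomial_add_one, map_mul]
      exact Ideal.mul_mem_right _ _ (Ideal.mem_span_singleton_self _)
    · rw [key, Ideal.span_singleton_le_iff_mem]
      exact Ideal.mem_map_of_mem _ (monomial_mem_monomialIdeal hm)

theorem IsLocallySnc.isLocallyNoetherian (hP : P.IsLocallySnc) : IsLocallyNoetherian P.X := by
  choose U n x h using hP.exists_isChart
  refine isLocallyNoetherian_of_affine_cover (S := U) ?_ fun y => ?_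
  · rw [eq_top_iff]
    intro y _
    exact Opens.mem_iSup.mpr ⟨y, (h y).mem⟩
  · have : (coordHom (x y)).Etale := (h y).etale
    exact this.isNoetherianRing

theorem _root_.Toroidal.stalkIdeal_biSup {X : Scheme.{u}} {ι : Type*} (M : Set ι) (I : ι → X.IdealSheafData)
    (x : X) : stalkIdeal (⨆ m ∈ M, I m) x = ⨆ m ∈ M, stalkIdeal (I m) x := by
  rw [stalkIdeal_iSup]
  simp_rw [stalkIdeal_iSup]

/-- On a locally noetherian scheme, ideal sheaves with equal stalks at `y` agree near `y`. Being
toroidal is thus a condition on stalks, and it is used in this form from here on. -/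
theorem IsLocallySnc.isToroidal_iff (hP : P.IsLocallySnc) {I : P.X.IdealSheafData} :
    P.IsToroidal I ↔ ∀ y, P.IsMonomialAt y (stalkIdeal I y) := by
  have := hP.isLocallyNoetherian
  refine forall_congr' fun y => ⟨?_, ?_⟩
  · rintro ⟨U, hy, M, hM⟩
    refine ⟨M, ?_⟩
    rw [stalkIdeal_eq _ U hy, hM]
    simp only [Ideal.map_iSup, stalkIdeal_eq _ U hy]
  · rintro ⟨M, hM⟩
    rw [← stalkIdeal_biSup] at hM
    obtain ⟨U, hy, hU⟩ := exists_ideal_eq hM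
    refine ⟨U, hy, M, hU.trans ?_⟩
    rw [← sSup_image, Scheme.IdealSheafData.ideal_sSup, ← Set.image_comp, sSup_image, iSup_apply]
    simp only [iSup_apply, Function.comp]

end LogPair

end Toroidal

/-! ### Generic points of strata -/

namespace Toroidal

variable {k : Type u} [Field k]

namespace LogPair

variable {P : LogPair k} {U : P.X.affineOpens} {n : ℕ} {x : Fin n → Γ(P.X, U.1)} {y η w : P.X}

/-- The maximal ideal at `η` is generated by the equations of the components of `Δ` through `η`:
then `η` is the generic point of `X`, or of a stratum. -/
def IsStratumPoint (P : LogPair k) (η : P.X) : Prop :=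
  IsLocalRing.maximalIdeal (P.X.presheaf.stalk η) = ⨆ D ∈ P.Δ, ⨆ (_ : η ∈ D),
    stalkIdeal (Scheme.IdealSheafData.vanishingIdeal (⟨D, D.isClosed⟩ : Closeds P.X)) η

namespace IsChart

theorem isStratumPoint_iff (h : IsChart x y) : P.IsStratumPoint y ↔
    IsLocalRing.maximalIdeal (P.X.presheaf.stalk y) =
      (monomialIdeal k (posOn (faces x y))).map (coordStalk x h.mem) := by
  obtain ⟨D, hD, hinj, hsurj⟩ := h.exists_components
  refine Eq.congr_right (le_antisymm ?_ ?_)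
  · refine iSup₂_le fun D' hD' => iSup_le fun hy => ?_
    obtain ⟨j, hj, rfl⟩ := hsurj D' hD' hy
    rw [h.stalkIdeal_component hy (hD j hj).2.2, Ideal.span_singleton_le_iff_mem,
      monomialIdeal_posOn]
    exact Ideal.mem_map_of_mem _ (Ideal.subset_span ⟨j, hj, rfl⟩)
  · rw [monomialIdeal_posOn, Ideal.map_span, Ideal.span_le]
    rintro _ ⟨_, ⟨j, hj, rfl⟩, rfl⟩
    have h1 : coordStalk x h.mem (.X j) ∈ stalkIdeal (Scheme.IdealSheafData.vanishingIdeal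
        (⟨D j, (D j).isClosed⟩ : Closeds P.X)) y := by
      rw [h.stalkIdeal_component (hD j hj).2.1 (hD j hj).2.2]
      exact Ideal.mem_span_singleton_self _
    refine SetLike.le_def.mp (le_iSup₂_of_le (D j) (hD j hj).1 ?_) h1
    exact le_iSup (fun _ : y ∈ D j => stalkIdeal (Scheme.IdealSheafData.vanishingIdeal
      (⟨D j, (D j).isClosed⟩ : Closeds P.X)) y) (hD j hj).2.1

/-- The equations through `η` generate a prime ideal at `y` that extends to the maximal ideal at
`η`, and a prime is recovered from its localization. -/
theorem comap_maximalIdeal (h : IsChart x y) (hs : η ⤳ y) (hη : P.IsStratumPoint η) :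
    (IsLocalRing.maximalIdeal (P.X.presheaf.stalk η)).comap (P.X.presheaf.stalkSpecializes hs).hom =
      (monomialIdeal k (posOn (faces x η))).map (coordStalk x h.mem) := by
  have h1 := ((h.of_specializes hs).isStratumPoint_iff).mp hη
  rw [← comp_coordStalk hs h.mem, ← Ideal.map_map] at h1
  have := h.isToricFrame.prime _ (h.faces_subset_of_specializes hs)
  apply le_antisymm
  · rw [h1]
    apply comap_stalkSpecializes_map_le hs
    rw [← h1]
    exact Ideal.IsPrime.ne_top inferInstance
  · rw [← Ideal.map_le_iff_le_comap, ← h1]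

theorem map_posOn_le_comap (h : IsChart x y) (hs : η ⤳ y) {T : Finset (Fin n)}
    (hT : T ⊆ faces x η) : (monomialIdeal k (posOn T)).map (coordStalk x h.mem) ≤
      (IsLocalRing.maximalIdeal (P.X.presheaf.stalk η)).comap
        (P.X.presheaf.stalkSpecializes hs).hom := by
  rw [← Ideal.map_le_iff_le_comap, Ideal.map_map, comp_coordStalk hs h.mem, monomialIdeal_posOn,
    Ideal.map_span, Ideal.span_le]
  rintro _ ⟨_, ⟨j, hj, rfl⟩, rfl⟩
  exact (h.of_specializes hs).isToricFrame.mem j (hT hj)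

/-- The prime of a stratum point is generated by the coordinates in its faces, so it lies in the
prime of every `w` at which these vanish. -/
theorem specializes_of_faces_subset (h : IsChart x y) (hs : η ⤳ y) (hw : w ⤳ y)
    (hη : P.IsStratumPoint η) (hf : faces x η ⊆ faces x w) : η ⤳ w := by
  refine specializes_of_comap_le hs hw ?_
  rw [h.comap_maximalIdeal hs hη]
  exact h.map_posOn_le_comap hw hf

/-- The point belongs to the prime generated by the coordinates in `T`; `X_notMem` shows that no
further face passes through it. For nonempty `T = faces x y` it is the generic point of the smallest
stratum through `y`. -/
theorem exists_isStratumPoint (h : IsChart x y) {T : Finset (Fin n)} (hT : T ⊆ faces x y) :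
    ∃ η, η ⤳ y ∧ P.IsStratumPoint η ∧ faces x η = T := by
  have := h.isToricFrame.prime T hT
  obtain ⟨η, hs, h1, h2⟩ := exists_specializes_of_isPrime
    ((monomialIdeal k (posOn T)).map (coordStalk x h.mem))
  have hf : faces x η = T := by
    ext j
    rw [h.mem_faces_iff_of_specializes hs, ← germ_mem_maximalIdeal_iff (hs.mem_open U.1.2 h.mem),
      ← coordStalk_X, ← comp_coordStalk hs h.mem]
    change _ ∧ coordStalk x h.mem (.X j) ∈ Ideal.comap (P.X.presheaf.stalkSpecializes hs).hom
      (IsLocalRing.maximalIdeal (P.X.presheaf.stalk η)) ↔ _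
    rw [h2]
    constructor
    · rintro ⟨-, hj⟩
      by_contra hc
      exact h.isToricFrame.X_notMem hT hc hj
    · intro hj
      refine ⟨hT hj, ?_⟩
      rw [monomialIdeal_posOn]
      exact Ideal.mem_map_of_mem _ (Ideal.subset_span ⟨j, hj, rfl⟩)
  refine ⟨η, hs, ?_, hf⟩
  rw [(h.of_specializes hs).isStratumPoint_iff, h1, Ideal.map_map, comp_coordStalk hs h.mem, hf]

/-- The associated primes of a monomial ideal in the equations through `η` are contained in the
prime of `η`, so passing to `η` and contracting loses nothing. -/
theorem comap_map_monomialIdeal (h : IsChart x y) (hs : η ⤳ y) (hη : P.IsStratumPoint η)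
    {V : Set (Fin n →₀ ℕ)} (hV : IsUpperOn (faces x η) V) :
    ((monomialIdeal k V).map (coordStalk x (hs.mem_open U.1.2 h.mem))).comap
      (P.X.presheaf.stalkSpecializes hs).hom = (monomialIdeal k V).map (coordStalk x h.mem) := by
  have hf := h.isToricFrame
  have := hf.noeth
  apply le_antisymm
  · rw [← comp_coordStalk hs h.mem]
    refine comap_map_monomialIdeal_le (T := faces x η) ?_ (fun i hi => ?_) ?_ hV
    · rw [comp_coordStalk hs h.mem]
      exact (h.of_specializes hs).isToricFrame.flat
    · exact hf.mem i (h.faces_subset_of_specializes hs hi)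
    · rw [comp_coordStalk hs h.mem, ← ((h.of_specializes hs).isStratumPoint_iff).mp hη,
        h.comap_maximalIdeal hs hη]
  · rw [← Ideal.map_le_iff_le_comap, Ideal.map_map, comp_coordStalk hs h.mem]

theorem map_monomialIdeal_biInter (h : IsChart x y) {ι : Type*} (s : Finset ι)
    (V : ι → Set (Fin n →₀ ℕ)) (hV : ∀ i ∈ s, IsUpperOn (faces x y) (V i)) :
    (monomialIdeal k (⋂ i ∈ s, V i)).map (coordStalk x h.mem) =
      ⨅ i ∈ s, (monomialIdeal k (V i)).map (coordStalk x h.mem) := by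
  rw [monomialIdeal_biInter s V fun i hi => (hV i hi).isUpperSet, flat_map_biInf h.isToricFrame.flat]

theorem isMonomialAt_map (h : IsChart x y) {V : Set (Fin n →₀ ℕ)} (hV : IsUpperOn (faces x y) V) :
    P.IsMonomialAt y ((monomialIdeal k V).map (coordStalk x h.mem)) :=
  h.isMonomialAt_iff.mpr ⟨V, hV, rfl⟩

theorem isMonomialAt_top (h : IsChart x y) : P.IsMonomialAt y ⊤ := by
  rw [← Ideal.map_top (coordStalk x h.mem), ← monomialIdeal_univ]
  exact h.isMonomialAt_map fun _ _ _ _ => Set.mem_univ _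

theorem isMonomialAt_biInf (h : IsChart x y) {ι : Type*} (s : Finset ι)
    {𝔠 : ι → Ideal (P.X.presheaf.stalk y)} (h𝔠 : ∀ i ∈ s, P.IsMonomialAt y (𝔠 i)) :
    P.IsMonomialAt y (⨅ i ∈ s, 𝔠 i) := by
  choose! V hV h𝔠 using fun i hi => h.isMonomialAt_iff.mp (h𝔠 i hi)
  rw [biInf_congr h𝔠, ← h.map_monomialIdeal_biInter s V hV]
  exact h.isMonomialAt_map (isUpperOn_iInter₂ hV)

theorem isMonomialAt_pow (h : IsChart x y) (hy : P.IsStratumPoint y) (N : ℕ) :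
    P.IsMonomialAt y (IsLocalRing.maximalIdeal (P.X.presheaf.stalk y) ^ N) := by
  rw [h.isStratumPoint_iff.mp hy, ← Ideal.map_pow, ← monomialIdeal_degOn]
  exact h.isMonomialAt_map (isUpperOn_degOn _ N)

end IsChart

/-- At a specialization of `η` the contraction is monomial with the same exponents, by
`comap_map_monomialIdeal`; at all other points it is the unit ideal. -/
theorem IsLocallySnc.isToroidal_contractionIdeal (hP : P.IsLocallySnc) (hη : P.IsStratumPoint η)
    {𝔠 : Ideal (P.X.presheaf.stalk η)} (hm : P.IsMonomialAt η 𝔠)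
    (h𝔠 : ∃ N, IsLocalRing.maximalIdeal (P.X.presheaf.stalk η) ^ N ≤ 𝔠) :
    P.IsToroidal (contractionIdeal η 𝔠 h𝔠) := by
  rw [hP.isToroidal_iff]
  intro y
  obtain ⟨U, n, x, h⟩ := hP.exists_isChart y
  by_cases hs : η ⤳ y
  · obtain ⟨V, hV, rfl⟩ := (h.of_specializes hs).isMonomialAt_iff.mp hm
    rw [stalkIdeal_contractionIdeal hs, h.comap_map_monomialIdeal hs hη hV]
    exact h.isMonomialAt_map (hV.mono (h.faces_subset_of_specializes hs))
  · rw [stalkIdeal_contractionIdeal_of_not_specializes hs]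
    exact h.isMonomialAt_top

theorem IsLocallySnc.isToroidal_biInf (hP : P.IsLocallySnc) {ι : Type*} (s : Finset ι)
    {I : ι → P.X.IdealSheafData} (hI : ∀ i ∈ s, P.IsToroidal (I i)) :
    P.IsToroidal (⨅ i ∈ s, I i) := by
  rw [hP.isToroidal_iff]
  intro y
  obtain ⟨U, n, x, h⟩ := hP.exists_isChart y
  rw [stalkIdeal_biInf]
  exact h.isMonomialAt_biInf s fun i hi => hP.isToroidal_iff.mp (hI i hi) y

/-- Each primary component of `𝔠` belongs to a set of faces through `y`, and its contraction from
the corresponding stratum point is a global toroidal ideal. Whether that contains `J` is tested at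
this point alone, where it follows from `hJ` by generization. -/
theorem IsLocallySnc.exists_isToroidal_stalkIdeal_le (hP : P.IsLocallySnc)
    {J : P.X.IdealSheafData} {𝔠 : Ideal (P.X.presheaf.stalk y)} (hm : P.IsMonomialAt y 𝔠)
    (hJ : stalkIdeal J y ≤ 𝔠) : ∃ I, P.IsToroidal I ∧ J ≤ I ∧ stalkIdeal I y ≤ 𝔠 := by
  obtain ⟨U, n, x, h⟩ := hP.exists_isChart y
  obtain ⟨V, hV, rfl⟩ := h.isMonomialAt_iff.mp hm
  obtain ⟨W, hW, hWV⟩ := hV.exists_primary_decomposition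
  have key : ∀ T ∈ (faces x y).powerset, ∃ I, P.IsToroidal I ∧ J ≤ I ∧
      stalkIdeal I y ≤ (monomialIdeal k (W T)).map (coordStalk x h.mem) := by
    intro T hT
    obtain ⟨hWT, hVW, N, hN⟩ := hW T hT
    obtain ⟨η, hs, hη, rfl⟩ := h.exists_isStratumPoint (Finset.mem_powerset.mp hT)
    have hη' := h.of_specializes hs
    have h𝔠 : IsLocalRing.maximalIdeal (P.X.presheaf.stalk η) ^ N ≤
        (monomialIdeal k (W (faces x η))).map (coordStalk x hη'.mem) := by
      rw [hη'.isStratumPoint_iff.mp hη, ← Ideal.map_pow, ← monomialIdeal_degOn]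
      exact Ideal.map_mono (monomialIdeal_mono hN)
    refine ⟨contractionIdeal η _ ⟨N, h𝔠⟩,
      hP.isToroidal_contractionIdeal hη (hη'.isMonomialAt_map hWT) _, ?_, ?_⟩
    · rw [le_contractionIdeal_iff, stalkIdeal_of_specializes J hs]
      refine (Ideal.map_mono hJ).trans ?_
      rw [Ideal.map_map, comp_coordStalk hs h.mem]
      exact Ideal.map_mono (monomialIdeal_mono hVW)
    · rw [stalkIdeal_contractionIdeal hs, h.comap_map_monomialIdeal hs hη hWT]
  have : Nonempty P.X.IdealSheafData := ⟨⊤⟩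
  choose! I hI hJI hle using key
  refine ⟨⨅ T ∈ (faces x y).powerset, I T, hP.isToroidal_biInf _ hI, le_iInf₂ hJI, ?_⟩
  rw [stalkIdeal_biInf]
  refine (iInf₂_mono hle).trans ?_
  rw [← h.map_monomialIdeal_biInter _ _ fun T hT =>
    (hW T hT).1.mono (Finset.mem_powerset.mp hT)]
  exact Ideal.map_mono (monomialIdeal_mono hWV)

theorem IsLocallySnc.exists_isLeast_isMonomialAt (hP : P.IsLocallySnc)
    (J : Ideal (P.X.presheaf.stalk y)) : ∃ 𝔥, IsLeast {𝔠 | P.IsMonomialAt y 𝔠 ∧ J ≤ 𝔠} 𝔥 := by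
  obtain ⟨U, n, x, h⟩ := hP.exists_isChart y
  have hf := h.isToricFrame
  have := hf.noeth
  refine ⟨_, ⟨h.isMonomialAt_map ?_, le_map_monomialIdeal_iInter hf.flat hf.mem J⟩, ?_⟩
  · exact isUpperOn_iInter₂ fun V hV => hV.1
  · rintro 𝔠 ⟨hm, hJ⟩
    obtain ⟨V, hV, rfl⟩ := h.isMonomialAt_iff.mp hm
    exact Ideal.map_mono (monomialIdeal_mono (Set.iInter₂_subset V ⟨hV, hJ⟩))

/-- A stratum point is the generic point of an irreducible component of the intersection of all `D`
through it. There are finitely many such intersections, and each has finitely many components. -/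
theorem IsLocallySnc.finite_setOf_isStratumPoint (hP : P.IsLocallySnc) :
    {η | P.IsStratumPoint η}.Finite := by
  have := hP.isLocallyNoetherian
  have := hP.compactSpace
  have : IsNoetherian P.X := {}
  classical
  have h1 (s : Finset (IrreducibleCloseds P.X)) :
      {η | P.IsStratumPoint η ∧ P.Δ.filter (fun D => η ∈ D) = s}.Finite := by
    obtain ⟨F, hF, h0, h2, h3⟩ := NoetherianSpace.exists_finite_set_isClosed_irreducible
      (s := ⋂ D ∈ s, (D : Set P.X)) (isClosed_biInter fun D _ => D.isClosed)
    lift F to Finset (Set P.X) using hF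
    refine (F.finite_toSet.biUnion (t := fun t => {η | IsGenericPoint η t}) fun t _ =>
      Set.Subsingleton.finite fun η hη w hw => hη.eq hw).subset ?_
    rintro η ⟨hη, hs⟩
    have hηs : η ∈ ⋂ D ∈ s, (D : Set P.X) := by
      rw [Set.mem_iInter₂, ← hs]
      exact fun D hD => (Finset.mem_filter.mp hD).2
    have hcl : closure {η} ⊆ ⋃₀ (F : Set (Set P.X)) := by
      rw [← h3]
      exact closure_minimal (Set.singleton_subset_iff.mpr hηs)
        (isClosed_biInter fun D _ => D.isClosed)
    obtain ⟨t, htF, ht⟩ := isIrreducible_iff_sUnion_isClosed.mp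
      (isIrreducible_singleton (x := η)).closure F h0 hcl
    simp only [Set.mem_iUnion]
    refine ⟨t, htF, ?_⟩
    have hw := (h2 t htF).isGenericPoint_genericPoint_closure
    rw [(h0 t htF).closure_eq] at hw
    have hwη : (h2 t htF).genericPoint ⤳ η :=
      hw.specializes (ht (subset_closure (Set.mem_singleton η)))
    obtain ⟨U, n, x, h⟩ := hP.exists_isChart η
    have hηw := h.specializes_of_faces_subset (specializes_refl η) hwη hη fun j hj => by
      obtain ⟨D, hD, hηD, hj⟩ := mem_faces.mp hj
      refine mem_faces.mpr ⟨D, hD, ?_, hj⟩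
      have hwt : (h2 t htF).genericPoint ∈ ⋂ D ∈ s, (D : Set P.X) := by
        rw [h3]
        exact ⟨t, htF, hw.mem⟩
      rw [Set.mem_iInter₂, ← hs] at hwt
      exact hwt D (Finset.mem_filter.mpr ⟨hD, hηD⟩)
    rw [(hηw.antisymm hwη).eq]
    exact hw
  refine (Set.Finite.biUnion (P.Δ.powerset.finite_toSet) fun s _ => h1 s).subset fun η hη => ?_
  simp only [Set.mem_iUnion]
  exact ⟨P.Δ.filter (fun D => η ∈ D),
    Finset.mem_coe.mpr (Finset.mem_powerset.mpr (Finset.filter_subset _ _)), hη, rfl⟩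

end LogPair

end Toroidal

/-! ### The toroidal hull, and multiplicities along strata -/

namespace Toroidal

variable {k : Type u} [Field k]

namespace LogPair

variable {P : LogPair k} {U : P.X.affineOpens} {n : ℕ} {x : Fin n → Γ(P.X, U.1)} {y η w : P.X}

/-- Every `y` has a generizing stratum point `η` with the same faces, and the stalk at `y` of the
toroidal ideal `I` is the contraction of its stalk at `η`. -/
theorem IsLocallySnc.le_of_forall_isStratumPoint (hP : P.IsLocallySnc) {K I : P.X.IdealSheafData}
    (hI : P.IsToroidal I) (h : ∀ η, P.IsStratumPoint η → stalkIdeal K η ≤ stalkIdeal I η) :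
    K ≤ I := by
  rw [le_iff_stalkIdeal_le]
  intro y
  obtain ⟨U, n, x, hy⟩ := hP.exists_isChart y
  obtain ⟨η, hs, hη, hf⟩ := hy.exists_isStratumPoint subset_rfl
  obtain ⟨V, hV, hIV⟩ := hy.isMonomialAt_iff.mp (hP.isToroidal_iff.mp hI y)
  have h1 := h η hη
  rw [stalkIdeal_of_specializes K hs, stalkIdeal_of_specializes I hs, hIV, Ideal.map_map,
    comp_coordStalk hs hy.mem, Ideal.map_le_iff_le_comap,
    hy.comap_map_monomialIdeal hs hη (by rwa [hf])] at h1
  rwa [hIV]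

/-- For each point there is a toroidal ideal containing `J` whose stalk is least there. Intersecting
these over the stratum points gives a least one, because stratum points detect inclusion. Their
finiteness keeps the intersection toroidal. -/
theorem IsLocallySnc.isLeast_toroidalHull (hP : P.IsLocallySnc) (J : P.X.IdealSheafData) :
    IsLeast {I : P.X.IdealSheafData | P.IsToroidal I ∧ J ≤ I} (P.toroidalHull J) := by
  have key : ∀ η, ∃ I, P.IsToroidal I ∧ J ≤ I ∧
      ∀ I', P.IsToroidal I' → J ≤ I' → stalkIdeal I η ≤ stalkIdeal I' η := by
    intro η
    obtain ⟨𝔥, ⟨hm, hJ⟩, hle⟩ := hP.exists_isLeast_isMonomialAt (stalkIdeal J η)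
    obtain ⟨I, hI, hJI, hIle⟩ := hP.exists_isToroidal_stalkIdeal_le hm hJ
    exact ⟨I, hI, hJI, fun I' hI' hJI' =>
      hIle.trans (hle ⟨hP.isToroidal_iff.mp hI' η, stalkIdeal_mono hJI' η⟩)⟩
  choose I hI hJI hle using key
  have hfin := hP.finite_setOf_isStratumPoint
  have h : IsLeast {I : P.X.IdealSheafData | P.IsToroidal I ∧ J ≤ I}
      (⨅ η ∈ hfin.toFinset, I η) := by
    refine ⟨⟨hP.isToroidal_biInf _ fun η _ => hI η, le_iInf₂ fun η _ => hJI η⟩, ?_⟩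
    rintro I' ⟨hI', hJI'⟩
    refine hP.le_of_forall_isStratumPoint hI' fun η hη => ?_
    refine le_trans (stalkIdeal_mono ?_ η) (hle η I' hI' hJI')
    exact iInf₂_le η (hfin.mem_toFinset.mpr hη)
  rwa [toroidalHull, h.isGLB.sInf_eq]

theorem mult_congr {X Y : Scheme.{u}} {I : X.IdealSheafData} {J : Y.IdealSheafData} {x : X} {y : Y}
    (h : ∀ m : ℕ, stalkIdeal I x ≤ IsLocalRing.maximalIdeal (X.presheaf.stalk x) ^ m ↔
      stalkIdeal J y ≤ IsLocalRing.maximalIdeal (Y.presheaf.stalk y) ^ m) :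
    mult I x = mult J y :=
  iSup_congr fun m => iSup_congr_Prop (h m) fun _ => rfl

/-- The functions whose germ at `η` lies in the `m`-th power of the maximal ideal form a toroidal
ideal sheaf. It contains the hull as soon as it contains `J`. -/
theorem IsLocallySnc.mult_toroidalHull (hP : P.IsLocallySnc) (J : P.X.IdealSheafData)
    (hη : P.IsStratumPoint η) : mult (P.toroidalHull J) η = mult J η := by
  obtain ⟨⟨hH, hJH⟩, hle⟩ := hP.isLeast_toroidalHull J
  obtain ⟨U, n, x, h⟩ := hP.exists_isChart η
  refine mult_congr fun m => ⟨(stalkIdeal_mono hJH η).trans, fun hm => ?_⟩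
  rw [← le_contractionIdeal_iff (h𝔠 := ⟨m, le_rfl⟩)] at hm ⊢
  exact hle ⟨hP.isToroidal_contractionIdeal hη (h.isMonomialAt_pow hη m) _, hm⟩

theorem IsChart.map_monomialIdeal_le_pow_iff (h : IsChart x y) {V : Set (Fin n →₀ ℕ)}
    (hV : IsUpperOn (faces x y) V) (m : ℕ) :
    (monomialIdeal k V).map (coordStalk x h.mem) ≤
      IsLocalRing.maximalIdeal (P.X.presheaf.stalk y) ^ m ↔ V ⊆ degOn (faces x y) m := by
  classical
  have hf := h.isToricFrame
  constructor
  · intro hle a ha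
    -- Coordinates outside the faces are dropped, because `le_degree` needs an exponent supported on
    -- the faces.
    let b : Fin n →₀ ℕ := Finsupp.equivFunOnFinite.symm fun i => if i ∈ faces x y then a i else 0
    have hb : b ∈ V := hV a ha b fun i hi => by simp [b, hi]
    have h1 := hf.le_degree b m (fun i hi => by simp [b, hi])
      (hle (Ideal.mem_map_of_mem _ (monomial_mem_monomialIdeal hb)))
    refine h1.trans (Finset.sum_congr rfl fun i hi => ?_).le
    simp [b, hi]
  · intro hle
    refine (Ideal.map_mono (monomialIdeal_mono hle)).trans ?_
    rw [monomialIdeal_degOn, Ideal.map_pow]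
    refine Ideal.pow_right_mono ?_ m
    rw [monomialIdeal_posOn, Ideal.map_span, Ideal.span_le]
    rintro _ ⟨_, ⟨i, hi, rfl⟩, rfl⟩
    exact hf.mem i hi

theorem IsLocallySnc.mult_eq_of_specializes (hP : P.IsLocallySnc) {I : P.X.IdealSheafData}
    (hI : P.IsToroidal I) (h : IsChart x y) (hs : η ⤳ y) (hf : faces x η = faces x y) :
    mult I y = mult I η := by
  obtain ⟨V, hV, hIV⟩ := h.isMonomialAt_iff.mp (hP.isToroidal_iff.mp hI y)
  refine mult_congr fun m => ?_
  rw [stalkIdeal_of_specializes I hs, hIV, Ideal.map_map, comp_coordStalk hs h.mem,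
    h.map_monomialIdeal_le_pow_iff hV,
    (h.of_specializes hs).map_monomialIdeal_le_pow_iff (hf.symm ▸ hV), hf]

/-! ### Strata -/

theorem isGenericPoint_genericPoint {X : Scheme.{u}} (W : IrreducibleCloseds X) :
    IsGenericPoint W.isIrreducible.genericPoint (W : Set X) := by
  have h := W.isIrreducible.isGenericPoint_genericPoint_closure
  rwa [W.isClosed.closure_eq] at h

theorem genericPoint_specializes_of_mem {X : Scheme.{u}} {W : IrreducibleCloseds X} {y : X}
    (hy : y ∈ W) : W.isIrreducible.genericPoint ⤳ y :=
  (isGenericPoint_genericPoint W).specializes hy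

theorem closure_subset_of_mem {X : Scheme.{u}} {W : IrreducibleCloseds X} {y : X}
    (hy : y ∈ W) : closure {y} ⊆ (W : Set X) :=
  closure_minimal (Set.singleton_subset_iff.mpr hy) W.isClosed

/-- The stratum point `η` with the same faces as the generic point `w` of `W` generizes `w` and
still lies on every member of `s`. Maximality of `W` forces `η = w`. -/
theorem IsStratum.isStratumPoint (hP : P.IsLocallySnc) {W : IrreducibleCloseds P.X}
    (hW : P.IsStratum W) : P.IsStratumPoint W.isIrreducible.genericPoint ∧
      ∃ D ∈ P.Δ, W.isIrreducible.genericPoint ∈ D := by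
  obtain ⟨s, ⟨D₀, hD₀⟩, hs, hmax⟩ := hW
  set w := W.isIrreducible.genericPoint with hwdef
  have hw := isGenericPoint_genericPoint W
  have hwD : ∀ D ∈ s, w ∈ D := Set.mem_iInter₂.mp (hmax.prop hw.mem)
  refine ⟨?_, D₀, hs hD₀, hwD D₀ hD₀⟩
  obtain ⟨U, n, x, h⟩ := hP.exists_isChart w
  obtain ⟨η, hη, hst, hf⟩ := h.exists_isStratumPoint subset_rfl
  let V : IrreducibleCloseds P.X := ⟨closure {η}, isIrreducible_singleton.closure, isClosed_closure⟩
  have hηD : ∀ D ∈ s, η ∈ D := by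
    intro D hD
    obtain ⟨j, hj⟩ := h.adapted D (hs hD) (hwD D hD)
    have hjf : j ∈ faces x η := hf ▸ mem_faces.mpr ⟨D, hs hD, hwD D hD, hj⟩
    exact (hj η (hη.mem_open U.1.2 h.mem)).mpr ((h.of_specializes hη).notMem_basicOpen hjf)
  have hV : (V : Set P.X) ⊆ ⋂ D ∈ s, (D : Set P.X) :=
    Set.subset_iInter₂ fun D hD => closure_subset_of_mem (hηD D hD)
  have hWV : W ≤ V := by
    change (W : Set P.X) ⊆ closure {η}
    rw [← hw.def]
    exact closure_minimal (Set.singleton_subset_iff.mpr hη.mem_closure) isClosed_closure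
  have hηW : η ∈ W := (hmax.le_of_ge hV hWV) (subset_closure (Set.mem_singleton η))
  have : η = w := (hη.antisymm (genericPoint_specializes_of_mem hηW)).eq
  exact this ▸ hst

/-- Take all components through `η`. A larger irreducible set in their intersection has a generic
point lying on all of them, which is then in the closure of `η` by `specializes_of_faces_subset`. -/
theorem IsStratumPoint.isStratum (hP : P.IsLocallySnc) (hη : P.IsStratumPoint η)
    (hD : ∃ D ∈ P.Δ, η ∈ D) : P.IsStratum
      ⟨closure {η}, isIrreducible_singleton.closure, isClosed_closure⟩ := by
  classical
  obtain ⟨D₀, hD₀, hηD₀⟩ := hD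
  refine ⟨P.Δ.filter fun D => η ∈ D, ⟨D₀, Finset.mem_filter.mpr ⟨hD₀, hηD₀⟩⟩,
    Finset.filter_subset _ _, ?_, ?_⟩
  · exact Set.subset_iInter₂ fun D hD => closure_subset_of_mem (Finset.mem_filter.mp hD).2
  · intro V hV hle
    have hηV : η ∈ V := hle (subset_closure (Set.mem_singleton η))
    have hwη := genericPoint_specializes_of_mem hηV
    obtain ⟨U, n, x, h⟩ := hP.exists_isChart η
    have hηw : η ⤳ V.isIrreducible.genericPoint := by
      refine h.specializes_of_faces_subset (specializes_refl η) hwη hη fun j hj => ?_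
      obtain ⟨D, hD, hηD, hj⟩ := mem_faces.mp hj
      exact mem_faces.mpr ⟨D, hD, Set.mem_iInter₂.mp (hV (isGenericPoint_genericPoint V).mem) D
        (Finset.mem_filter.mpr ⟨hD, hηD⟩), hj⟩
    intro v hv
    exact (hηw.trans (genericPoint_specializes_of_mem hv)).mem_closure

theorem IsLocallySnc.isToroidallyEquimultiple_toroidalHull_iff (hP : P.IsLocallySnc)
    (J : P.X.IdealSheafData) (Z : Closeds P.X) (m : ℕ) :
    P.IsToroidallyEquimultiple (P.toroidalHull J) Z m ↔ P.IsToroidallyEquimultiple J Z m := by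
  refine forall₃_congr fun W hW _ => ?_
  rw [multAlong, multAlong, hP.mult_toroidalHull J (hW.isStratumPoint hP).1]

theorem IsToroidalCenter.exists_isStratum {Z : Closeds P.X} (hZ : P.IsToroidalCenter Z)
    (hy : y ∈ Z) : ∃ W, P.IsStratum W ∧ y ∈ W ∧ (W : Set P.X) ⊆ Z := by
  obtain ⟨𝒲, h1, -, h3⟩ := hZ
  have hy' : y ∈ (Z : Set P.X) := hy
  rw [h3, Set.mem_iUnion₂] at hy'
  obtain ⟨W, hW, hyW⟩ := hy'
  exact ⟨W, h1 W hW, hyW, h3 ▸ Set.subset_biUnion_of_mem hW⟩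

/-- For `z ∈ Z`, the smallest stratum through `z` lies inside a stratum `W ⊆ Z`. At its generic
point `η` the same faces vanish as at `z`, so a toroidal ideal has the same multiplicity at both. -/
theorem IsLocallySnc.isEquimultiple_iff (hP : P.IsLocallySnc) {I : P.X.IdealSheafData}
    (hI : P.IsToroidal I) {Z : Closeds P.X} (hZ : P.IsToroidalCenter Z) (m : ℕ) :
    P.IsEquimultiple I Z m ↔ P.IsToroidallyEquimultiple I Z m := by
  constructor
  · intro h W hW hWZ
    exact h _ (hWZ (isGenericPoint_genericPoint W).mem)
  · intro h z hz
    obtain ⟨W, hW, hzW, hWZ⟩ := hZ.exists_isStratum hz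
    obtain ⟨hw, D, hD, hwD⟩ := hW.isStratumPoint hP
    have hwz := genericPoint_specializes_of_mem hzW
    obtain ⟨U, n, x, hc⟩ := hP.exists_isChart z
    obtain ⟨η, hs, hη, hf⟩ := hc.exists_isStratumPoint subset_rfl
    have hwη := hc.specializes_of_faces_subset hwz hs hw
      (hf.symm ▸ hc.faces_subset_of_specializes hwz)
    rw [hP.mult_eq_of_specializes hI hc hs hf]
    let V : IrreducibleCloseds P.X :=
      ⟨closure {η}, isIrreducible_singleton.closure, isClosed_closure⟩
    have hηW : η ∈ W := hwη.mem_closed W.isClosed (isGenericPoint_genericPoint W).mem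
    have hV : P.IsStratum V := hη.isStratum hP ⟨D, hD, hwη.mem_closed D.isClosed hwD⟩
    have h1 := h V hV ((closure_subset_of_mem hηW).trans hWZ)
    have h2 : V.isIrreducible.genericPoint = η :=
      (isGenericPoint_genericPoint V).eq isGenericPoint_closure
    rwa [multAlong, h2] at h1

/-! ### Toroidal centers have normal crossings -/

theorem scalars_res {U V : P.X.Opens} (h : V ≤ U) :
    (P.X.presheaf.map (homOfLE h).op).hom.comp (P.scalars U) = P.scalars V := by
  rw [scalars, scalars, ← CommRingCat.hom_comp, Category.assoc, Category.assoc,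
    ← P.X.presheaf.map_comp]
  rfl

theorem coordHom_res {V : P.X.affineOpens} (h : V.1 ≤ U.1) :
    coordHom (fun j => P.X.presheaf.map (homOfLE h).op (x j)) =
      (P.X.presheaf.map (homOfLE h).op).hom.comp (coordHom x) := by
  apply MvPolynomial.ringHom_ext
  · intro a
    rw [RingHom.comp_apply, coordHom, coordHom, MvPolynomial.eval₂Hom_C, MvPolynomial.eval₂Hom_C,
      ← scalars_res h]
    rfl
  · intro j
    rw [RingHom.comp_apply, coordHom_X, coordHom_X]

theorem IsCoordinates.exists_res (h : P.IsCoordinates U x) (hy : y ∈ U.1) {W : P.X.Opens}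
    (hW : y ∈ W) : ∃ (V : P.X.affineOpens) (hVU : V.1 ≤ U.1), V.1 ≤ W ∧ y ∈ V.1 ∧
      P.IsCoordinates V (fun j => P.X.presheaf.map (homOfLE hVU).op (x j)) := by
  have hU : IsAffineOpen U.1 := U.2
  obtain ⟨f, hf, hyf⟩ := hU.exists_basicOpen_le (V := W) ⟨y, hW⟩ hy
  obtain ⟨V, hV⟩ : ∃ V : P.X.affineOpens, V.1 = P.X.basicOpen f := ⟨P.X.affineBasicOpen f, rfl⟩
  have hVU : V.1 ≤ U.1 := hV.le.trans (P.X.basicOpen_le f)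
  refine ⟨V, hVU, hV.le.trans hf, hV.ge hyf, ?_⟩
  change (coordHom _).Etale
  rw [coordHom_res]
  let := (P.X.presheaf.map (homOfLE hVU).op).hom.toAlgebra
  have : IsLocalization.Away f Γ(P.X, V.1) := hU.isLocalization_of_eq_basicOpen f _ hV
  have h1 : (P.X.presheaf.map (homOfLE hVU).op).hom.Etale :=
    RingHom.etale_algebraMap.mpr (Algebra.Etale.of_isLocalizationAway f)
  exact RingHom.Etale.stableUnderComposition _ _ h h1

theorem mem_basicOpen_res {X : Scheme.{u}} {U V : X.Opens} (h : V ≤ U) (a : Γ(X, U)) {q : X}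
    (hq : q ∈ V) : q ∈ X.basicOpen (X.presheaf.map (homOfLE h).op a) ↔ q ∈ X.basicOpen a := by
  rw [Scheme.basicOpen_res]
  exact ⟨fun h => h.2, fun h => ⟨hq, h⟩⟩

theorem IsChart.exists_res (h : IsChart x y) {W : P.X.Opens} (hW : y ∈ W) :
    ∃ (V : P.X.affineOpens) (hVU : V.1 ≤ U.1), V.1 ≤ W ∧
      IsChart (fun j => P.X.presheaf.map (homOfLE hVU).op (x j)) y := by
  obtain ⟨V, hVU, hVW, hyV, hV⟩ := h.etale.exists_res h.mem hW
  refine ⟨V, hVU, hVW, hyV, hV, fun D hD hyD => ?_⟩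
  obtain ⟨j, hj⟩ := h.adapted D hD hyD
  exact ⟨j, fun q hq => (hj q (hVU hq)).trans (not_congr (mem_basicOpen_res hVU (x j) hq).symm)⟩

theorem mem_iff_stalkIdeal_vanishingIdeal_le {X : Scheme.{u}} {Z : Closeds X} {q : X} :
    q ∈ Z ↔ stalkIdeal (Scheme.IdealSheafData.vanishingIdeal Z) q ≤
      IsLocalRing.maximalIdeal (X.presheaf.stalk q) := by
  refine ⟨stalkIdeal_vanishingIdeal_le_maximalIdeal, fun h => ?_⟩
  by_contra hq
  rw [stalkIdeal_vanishingIdeal_of_notMem hq] at h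
  exact Ideal.IsPrime.ne_top inferInstance (top_le_iff.mp h)

/-- The ideal of a stratum at each of its points. -/
theorem IsChart.stalkIdeal_stratum (h : IsChart x y) {W : IrreducibleCloseds P.X} (hy : y ∈ W)
    (hW : P.IsStratumPoint W.isIrreducible.genericPoint) :
    stalkIdeal (Scheme.IdealSheafData.vanishingIdeal (⟨W, W.isClosed⟩ : Closeds P.X)) y =
      (monomialIdeal k (posOn (faces x W.isIrreducible.genericPoint))).map
        (coordStalk x h.mem) := by
  have hs := genericPoint_specializes_of_mem hy
  apply le_antisymm
  · rw [← h.comap_maximalIdeal hs hW, ← Ideal.map_le_iff_le_comap, ← stalkIdeal_of_specializes]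
    exact stalkIdeal_vanishingIdeal_le_maximalIdeal (isGenericPoint_genericPoint W).mem
  · rw [monomialIdeal_posOn, Ideal.map_span, Ideal.span_le]
    rintro _ ⟨_, ⟨j, hj, rfl⟩, rfl⟩
    obtain ⟨D, hD, hwD, hjD⟩ := mem_faces.mp hj
    have hle : (⟨W, W.isClosed⟩ : Closeds P.X) ≤ ⟨D, D.isClosed⟩ := by
      change (W : Set P.X) ⊆ D
      rw [← (isGenericPoint_genericPoint W).def]
      exact closure_subset_of_mem hwD
    refine stalkIdeal_mono (Scheme.IdealSheafData.vanishingIdeal_antimono hle) y ?_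
    rw [h.stalkIdeal_component (hs.mem_closed D.isClosed hwD) hjD]
    exact Ideal.mem_span_singleton_self _

/-- Near each of its points a toroidal center is the vanishing locus of the coordinates that belong
to the stratum through that point. -/
theorem IsToroidalCenter.exists_isOpen (hP : P.IsLocallySnc) {Z : Closeds P.X}
    (hZ : P.IsToroidalCenter Z) (hy : y ∈ Z) (h : IsChart x y) :
    ∃ T ⊆ faces x y, T.Nonempty ∧ ∃ O : P.X.Opens, y ∈ O ∧
      ∀ q ∈ O, q ∈ U.1 → (q ∈ Z ↔ ∀ j ∈ T, q ∉ P.X.basicOpen (x j)) := by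
  have := hP.isLocallyNoetherian
  obtain ⟨𝒲, h1, h2, h3⟩ := hZ
  have hy' : y ∈ (Z : Set P.X) := hy
  rw [h3, Set.mem_iUnion₂] at hy'
  obtain ⟨W, hW, hyW⟩ := hy'
  -- Strata are determined by their generic points, which are finite in number. Hence the union of
  -- the strata other than `W` is closed and can be avoided near `y`.
  have hfin : 𝒲.Finite := by
    refine Set.Finite.of_injOn (f := fun W => W.isIrreducible.genericPoint)
      (fun V hV => ((h1 V hV).isStratumPoint hP).1) (fun V _ V' _ hVV' => ?_)
      hP.finite_setOf_isStratumPoint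
    refine IrreducibleCloseds.ext ?_
    rw [← (isGenericPoint_genericPoint V).def, ← (isGenericPoint_genericPoint V').def]
    exact congrArg (fun w => closure {w}) hVV'
  have hcl : IsClosed (⋃ V ∈ 𝒲 \ {W}, (V : Set P.X)) :=
    (hfin.subset Set.sdiff_subset).isClosed_biUnion fun V _ => V.isClosed
  have hy1 : y ∉ ⋃ V ∈ 𝒲 \ {W}, (V : Set P.X) := by
    rw [Set.mem_iUnion₂]
    rintro ⟨V, ⟨hV, hVW⟩, hyV⟩
    exact Set.disjoint_left.mp (h2 V hV W hW hVW) hyV hyW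
  obtain ⟨hw, D₀, hD₀, hwD₀⟩ := (h1 W hW).isStratumPoint hP
  set w := W.isIrreducible.genericPoint with hwdef
  have hs : w ⤳ y := genericPoint_specializes_of_mem hyW
  obtain ⟨D, hD, hinj, hsurj⟩ := (h.of_specializes hs).exists_components
  have hDy (j) (hj : j ∈ faces x w) : y ∈ D j := hs.mem_closed (D j).isClosed (hD j hj).2.1
  -- `W` may be only one component of the intersection of the `D j`. At `y` its ideal lies in the
  -- sum `K` of their ideals, and this persists on a neighbourhood.
  let K : P.X.IdealSheafData := ⨆ j ∈ (faces x w : Set (Fin n)),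
    Scheme.IdealSheafData.vanishingIdeal (⟨D j, (D j).isClosed⟩ : Closeds P.X)
  have hK : stalkIdeal (Scheme.IdealSheafData.vanishingIdeal (⟨W, W.isClosed⟩ : Closeds P.X)) y ≤
      stalkIdeal K y := by
    rw [h.stalkIdeal_stratum hyW hw, stalkIdeal_biSup, monomialIdeal_posOn, Ideal.map_span,
      Ideal.span_le]
    rintro _ ⟨_, ⟨j, hj, rfl⟩, rfl⟩
    refine SetLike.le_def.mp (le_iSup₂ (f := fun j (_ : j ∈ (faces x w : Set (Fin n))) =>
      stalkIdeal (Scheme.IdealSheafData.vanishingIdeal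
        (⟨D j, (D j).isClosed⟩ : Closeds P.X)) y) j hj) ?_
    rw [h.stalkIdeal_component (hDy j hj) (hD j hj).2.2]
    exact Ideal.mem_span_singleton_self _
  obtain ⟨O, hyO, hO, hOK⟩ := exists_le_ideal_le hK (W := ⟨_, hcl.isOpen_compl⟩) hy1
  obtain ⟨j₀, hj₀⟩ := (h.of_specializes hs).adapted D₀ hD₀ hwD₀
  refine ⟨faces x w, h.faces_subset_of_specializes hs, ⟨j₀, mem_faces.mpr ⟨D₀, hD₀, hwD₀, hj₀⟩⟩,
    O.1, hyO, fun q hq hqU => ?_⟩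
  have hqD : (∀ j ∈ faces x w, q ∉ P.X.basicOpen (x j)) ↔ ∀ j ∈ faces x w, q ∈ D j :=
    forall₂_congr fun j hj => ((hD j hj).2.2 q hqU).symm
  rw [hqD]
  constructor
  · intro hqZ j hj
    have hqZ' : q ∈ (Z : Set P.X) := hqZ
    rw [h3, Set.mem_iUnion₂] at hqZ'
    obtain ⟨V, hV, hqV⟩ := hqZ'
    by_cases hVW : V = W
    · subst hVW
      exact (genericPoint_specializes_of_mem hqV).mem_closed (D j).isClosed (hD j hj).2.1
    · exact absurd (Set.mem_iUnion₂.mpr ⟨V, ⟨hV, hVW⟩, hqV⟩) (hO hq)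
  · intro hq'
    have hqW : q ∈ (⟨W, W.isClosed⟩ : Closeds P.X) := by
      rw [mem_iff_stalkIdeal_vanishingIdeal_le, stalkIdeal_eq _ O hq]
      refine (Ideal.map_mono hOK).trans ?_
      rw [← stalkIdeal_eq K O hq, stalkIdeal_biSup]
      exact iSup₂_le fun j hj => stalkIdeal_vanishingIdeal_le_maximalIdeal (hq' j hj)
    have : q ∈ (Z : Set P.X) := h3 ▸ Set.mem_iUnion₂.mpr ⟨W, hW, hqW⟩
    exact this

theorem IsLocallySnc.hasNormalCrossings (hP : P.IsLocallySnc) {Z : Closeds P.X}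
    (hZ : P.IsToroidalCenter Z) : P.HasNormalCrossings Z := by
  intro y hy
  obtain ⟨U, n, x, h⟩ := hP.exists_isChart y
  obtain ⟨T, -, hT, O, hyO, hO⟩ := hZ.exists_isOpen hP hy h
  obtain ⟨V, hVU, hVO, hV⟩ := h.exists_res hyO
  refine ⟨V, n, _, hV.mem, hV.etale, hV.adapted, T, hT, fun q hq => ?_⟩
  rw [hO q (hVO hq) (hVU hq)]
  refine forall₂_congr fun j _ => ?_
  rw [Scheme.basicOpen_res]
  exact ⟨fun h1 h2 => h1 h2.2, fun h1 h2 => h1 ⟨hq, h2⟩⟩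

end LogPair

end Toroidal

/-! ### Affine charts of a blow-up -/

namespace Toroidal

theorem mem_nonZeroDivisors_of_span_eq {R : Type*} [CommRing R] {a b : R}
    (ha : a ∈ nonZeroDivisors R) (h : Ideal.span {b} = Ideal.span {a}) : b ∈ nonZeroDivisors R := by
  obtain ⟨c, hc⟩ := Ideal.mem_span_singleton.mp (h ▸ Ideal.mem_span_singleton_self a)
  rw [hc] at ha
  exact (mul_mem_nonZeroDivisors.mp ha).1

theorem map_mem_nonZeroDivisors_of_flat {R S : Type*} [CommRing R] [CommRing S] {φ : R →+* S}
    (hφ : φ.Flat) {a : R} (ha : a ∈ nonZeroDivisors R) : φ a ∈ nonZeroDivisors S := by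
  algebraize [φ]
  have h := Module.Flat.isSMulRegular_of_nonZeroDivisors (M := S) ha
  refine mem_nonZeroDivisors_iff_right.mpr fun x hx => h ?_
  change a • x = a • (0 : S)
  rw [smul_zero, Algebra.smul_def, mul_comm]
  exact hx

variable {X Y B T : Scheme.{u}}

theorem hom_ext_of_fromSpec {f g : X ⟶ Y}
    (h : ∀ x, ∃ (U : X.Opens) (hU : IsAffineOpen U), x ∈ U ∧ hU.fromSpec ≫ f = hU.fromSpec ≫ g) :
    f = g := by
  choose U hU hx h using h
  refine (X.openCoverOfIsOpenCover U ?_).hom_ext _ _ fun x => ?_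
  · exact eq_top_iff.mpr fun x _ => Opens.mem_iSup.mpr ⟨x, hx x⟩
  · have h1 := h x
    rw [IsAffineOpen.fromSpec, Category.assoc, Category.assoc, cancel_epi] at h1
    exact h1

theorem flat_germ (U : X.affineOpens) {x : X} (hx : x ∈ U.1) :
    (X.presheaf.germ U.1 x hx).hom.Flat := by
  let := (X.presheaf.germ U.1 x hx).hom.toAlgebra
  have := isLocalization_stalk U x hx
  exact RingHom.flat_algebraMap_iff.mpr
    (IsLocalization.flat (X.presheaf.stalk x) (primeAt U x hx).primeCompl)

theorem isUnit_of_span_mul_eq {R : Type*} [CommRing R] {a e : R} (ha : a ∈ nonZeroDivisors R)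
    (h : Ideal.span {a} = Ideal.span {a * e}) : IsUnit e := by
  obtain ⟨z, hz⟩ := Ideal.mem_span_singleton.mp (h ▸ Ideal.mem_span_singleton_self a)
  refine IsUnit.of_mul_eq_one z ?_
  have h1 : (e * z - 1) * a = 0 := by linear_combination -hz
  exact sub_eq_zero.mp (mem_nonZeroDivisors_iff_right.mp ha _ h1)

theorem appLE_congr {f g : X ⟶ Y} (h : f = g) {U : Y.Opens} {V : X.Opens} (e : V ≤ f ⁻¹ᵁ U)
    (e' : V ≤ g ⁻¹ᵁ U) : f.appLE U V e = g.appLE U V e' := by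
  subst h; rfl

theorem IsCartier.exists_le {K : X.IdealSheafData} (hK : IsCartier K) {x : X} {W : X.Opens}
    (hW : x ∈ W) : ∃ V : X.affineOpens, x ∈ V.1 ∧ V.1 ≤ W ∧
      ∃ a ∈ nonZeroDivisors Γ(X, V.1), K.ideal V = Ideal.span {a} := by
  obtain ⟨U, hx, a, ha, hUa⟩ := hK x
  have hU : IsAffineOpen U.1 := U.2
  obtain ⟨V, hxV, hV⟩ := exists_affineOpens_mem x (W := U.1 ⊓ W) ⟨hx, hW⟩
  have hVU : V.1 ≤ U.1 := hV.trans inf_le_left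
  refine ⟨V, hxV, hV.trans inf_le_right, X.presheaf.map (homOfLE hVU).op a, ?_, ?_⟩
  · have h1 := Scheme.Hom.flat_appLE (𝟙 X) hU V.2 hVU
    have h2 : (𝟙 X : X ⟶ X).appLE U.1 V.1 hVU = X.presheaf.map (homOfLE hVU).op := by
      simp only [Scheme.Hom.appLE, Scheme.Hom.id_app]
      exact Category.id_comp _
    rw [h2] at h1
    exact map_mem_nonZeroDivisors_of_flat h1 ha
  · rw [← K.map_ideal' (homOfLE hVU).op, hUa, Ideal.map_span, Set.image_singleton]

theorem IsCartier.comap_of_isOpenImmersion {K : X.IdealSheafData} (hK : IsCartier K) (i : T ⟶ X)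
    [IsOpenImmersion i] : IsCartier (K.comap i) := by
  intro t
  obtain ⟨U, hx, a, ha, hUa⟩ := hK (i t)
  obtain ⟨V, htV, hV⟩ := exists_affineOpens_mem t (W := i ⁻¹ᵁ U.1) hx
  refine ⟨V, htV, i.appLE U.1 V.1 hV a,
    map_mem_nonZeroDivisors_of_flat (Scheme.Hom.flat_appLE i U.2 V.2 hV) ha, ?_⟩
  rw [ideal_comap_eq_map K i U V hV, hUa, Ideal.map_span, Set.image_singleton]

theorem ideal_comap_SpecMap (I : X.IdealSheafData) (U : X.affineOpens) {f : Γ(X, U.1)}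
    {R : CommRingCat.{u}} {ψ : Γ(X, U.1) ⟶ R} (h : (I.ideal U).map ψ.hom = Ideal.span {ψ f}) :
    (I.comap (Spec.map ψ ≫ U.2.fromSpec)).ideal ⟨⊤, isAffineOpen_top _⟩ =
      Ideal.span {(Scheme.ΓSpecIso R).inv (ψ f)} := by
  have hU : IsAffineOpen U.1 := U.2
  have e : (⊤ : (Spec R).Opens) ≤ (Spec.map ψ ≫ hU.fromSpec) ⁻¹ᵁ U.1 :=
    fun t _ => SpecMap_fromSpec_mem hU ψ t
  refine (ideal_comap_eq_map I _ U ⟨⊤, isAffineOpen_top _⟩ e).trans ?_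
  change Ideal.map ((Spec.map ψ ≫ hU.fromSpec).appLE U.1 ⊤ e).hom (I.ideal U) = _
  rw [appLE_SpecMap_fromSpec hU ψ e, CommRingCat.hom_comp, ← Ideal.map_map, h, Ideal.map_span,
    Set.image_singleton]

theorem ΓSpecIso_inv_mem_nonZeroDivisors {R : CommRingCat.{u}} {a : R}
    (ha : a ∈ nonZeroDivisors R) :
    (Scheme.ΓSpecIso R).inv a ∈ nonZeroDivisors Γ(Spec R, ⊤) := by
  refine map_mem_nonZeroDivisors_of_flat (φ := (Scheme.ΓSpecIso R).inv.hom) ?_ ha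
  exact RingHom.Flat.of_bijective (ConcreteCategory.bijective_of_isIso (Scheme.ΓSpecIso R).inv)

theorem isCartier_comap_SpecMap (I : X.IdealSheafData) (U : X.affineOpens) (f : Γ(X, U.1))
    {R : CommRingCat.{u}} (ψ : Γ(X, U.1) ⟶ R) (h : (I.ideal U).map ψ.hom = Ideal.span {ψ f})
    (hf : ψ f ∈ nonZeroDivisors R) : IsCartier (I.comap (Spec.map ψ ≫ U.2.fromSpec)) := fun _ =>
  ⟨⟨⊤, isAffineOpen_top _⟩, trivial, _, ΓSpecIso_inv_mem_nonZeroDivisors hf,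
    ideal_comap_SpecMap I U h⟩

/-- `C` is the universal `Γ(X, U)`-algebra over which `f` is a non-zero-divisor that generates the
image of `I`: the coordinate ring of a chart of the blow-up of `I`. -/
structure IsBlowUpChart (I : X.IdealSheafData) (U : X.affineOpens) (f : Γ(X, U.1))
    {C : CommRingCat.{u}} (φ : Γ(X, U.1) ⟶ C) : Prop where
  map_eq : (I.ideal U).map φ.hom = Ideal.span {φ f}
  mem : f ∈ I.ideal U
  mem_nonZeroDivisors : φ f ∈ nonZeroDivisors C
  exists_lift : ∀ (R : CommRingCat.{u}) (ψ : Γ(X, U.1) ⟶ R),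
    (I.ideal U).map ψ.hom = Ideal.span {ψ f} → ψ f ∈ nonZeroDivisors R → ∃ χ : C ⟶ R, φ ≫ χ = ψ
  unique_lift : ∀ (R : CommRingCat.{u}) (χ χ' : C ⟶ R),
    χ (φ f) ∈ nonZeroDivisors R → φ ≫ χ = φ ≫ χ' → χ = χ'

namespace IsBlowUpChart

variable {I : X.IdealSheafData} {U : X.affineOpens} {f : Γ(X, U.1)} {C : CommRingCat.{u}}
  {φ : Γ(X, U.1) ⟶ C}

theorem unique_lift_of_map_eq (hφ : IsBlowUpChart I U f φ) {R : CommRingCat.{u}} {χ χ' : C ⟶ R}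
    {ψ : Γ(X, U.1) ⟶ R} (hχ : φ ≫ χ = ψ) (hχ' : φ ≫ χ' = ψ) {a : R} (ha : a ∈ nonZeroDivisors R)
    (h : (I.ideal U).map ψ.hom = Ideal.span {a}) : χ = χ' := by
  refine hφ.unique_lift R χ χ' (mem_nonZeroDivisors_of_span_eq ha ?_) (hχ.trans hχ'.symm)
  rw [← h, ← hχ, CommRingCat.hom_comp, ← Ideal.map_map, hφ.map_eq, Ideal.map_span,
    Set.image_singleton]

/-- Equality is local on `T`; on affine opens where the pulled-back ideal is generated by a
non-zero-divisor it is the uniqueness clause for the chart ring. -/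
theorem hom_ext_aux (hφ : IsBlowUpChart I U f φ) {j : Spec C ⟶ X}
    (ej : (⊤ : (Spec C).Opens) ≤ j ⁻¹ᵁ U.1)
    (hj : j.appLE U.1 ⊤ ej = φ ≫ (Scheme.ΓSpecIso C).inv) {u v : T ⟶ Spec C}
    (h : u ≫ j = v ≫ j) (hI : IsCartier (I.comap (u ≫ j))) : u = v := by
  refine hom_ext_of_fromSpec fun t => ?_
  obtain ⟨V, htV, a, ha, hVa⟩ := hI t
  have hV : IsAffineOpen V.1 := V.2
  refine ⟨V.1, V.2, htV, ?_⟩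
  have hχ (u : T ⟶ Spec C) : φ ≫ (Scheme.ΓSpecIso C).inv ≫ u.appLE ⊤ V.1 le_top =
      (u ≫ j).appLE U.1 V.1 (fun _ _ => ej trivial) := by
    rw [← Scheme.Hom.appLE_comp_appLE u j U.1 ⊤ V.1 ej le_top, hj, Category.assoc]
  have h1 := hφ.unique_lift_of_map_eq (hχ u) ((hχ v).trans (appLE_congr h.symm _ _)) ha
    ((ideal_comap_eq_map I _ U V _).symm.trans hVa)
  rw [cancel_epi] at h1
  rw [← IsAffineOpen.SpecMap_appLE_fromSpec u (isAffineOpen_top _) hV le_top,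
    ← IsAffineOpen.SpecMap_appLE_fromSpec v (isAffineOpen_top _) hV le_top, h1]

theorem hom_ext (hφ : IsBlowUpChart I U f φ) {u v : T ⟶ Spec C}
    (h : u ≫ Spec.map φ ≫ U.2.fromSpec = v ≫ Spec.map φ ≫ U.2.fromSpec)
    (hI : IsCartier (I.comap (u ≫ Spec.map φ ≫ U.2.fromSpec))) : u = v := by
  have hU : IsAffineOpen U.1 := U.2
  have ej : (⊤ : (Spec C).Opens) ≤ (Spec.map φ ≫ hU.fromSpec) ⁻¹ᵁ U.1 :=
    fun t _ => SpecMap_fromSpec_mem hU φ t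
  exact hφ.hom_ext_aux ej (appLE_SpecMap_fromSpec hU φ ej) h hI

theorem isCartier (hφ : IsBlowUpChart I U f φ) :
    IsCartier (I.comap (Spec.map φ ≫ U.2.fromSpec)) :=
  isCartier_comap_SpecMap I U f φ hφ.map_eq hφ.mem_nonZeroDivisors

/-- Near a point of the blow-up at which `f` generates the inverse image ideal sheaf, the blow-up
maps to the chart. -/
theorem exists_chart_map (hφ : IsBlowUpChart I U f φ) {π : B ⟶ X} (hπ : IsBlowUp π I)
    {g : Spec C ⟶ B} (hg : g ≫ π = Spec.map φ ≫ U.2.fromSpec) {b : B} (hb : π b ∈ U.1)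
    (hf : stalkIdeal (I.comap π) b =
      Ideal.span {π.stalkMap b (X.presheaf.germ U.1 (π b) hb f)}) :
    ∃ (R : CommRingCat.{u}) (i : Spec R ⟶ B) (h : Spec R ⟶ Spec C), IsOpenImmersion i ∧
      b ∈ Set.range i ∧ h ≫ g = i := by
  have hU : IsAffineOpen U.1 := U.2
  obtain ⟨V, hbV, hVU, a, ha, hVa⟩ := hπ.1.exists_le (W := π ⁻¹ᵁ U.1) hb
  have hV : IsAffineOpen V.1 := V.2
  have hfI : f ∈ I.ideal U := hφ.mem
  have h1 : π.appLE U.1 V.1 hVU f ∈ Ideal.span {a} := by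
    rw [← hVa, ideal_comap_eq_map I π U V hVU]
    exact Ideal.mem_map_of_mem _ hfI
  obtain ⟨e, he⟩ := Ideal.mem_span_singleton.mp h1
  have hgerm : π.stalkMap b (X.presheaf.germ U.1 (π b) hb f) =
      B.presheaf.germ V.1 b hbV a * B.presheaf.germ V.1 b hbV e := by
    refine (RingHom.congr_fun (stalkMap_germ_appLE π hVU b hbV hb) f).trans ?_
    rw [RingHom.comp_apply, he, map_mul]
  -- Both `a` and `f = a e` generate the ideal at `b`, and `a` is a non-zero-divisor, so `e` is a
  -- unit there. After shrinking, `f` generates the ideal on a neighbourhood.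
  have hbe : b ∈ B.basicOpen e := by
    rw [B.mem_basicOpen _ _ hbV]
    refine isUnit_of_span_mul_eq (map_mem_nonZeroDivisors_of_flat (flat_germ V hbV) ha) ?_
    refine Eq.trans ?_ (hf.trans (congrArg (fun z => Ideal.span {z}) hgerm))
    rw [stalkIdeal_eq _ V hbV, hVa, Ideal.map_span, Set.image_singleton]
  obtain ⟨V', hbV', hV'e, a', ha', hVa'⟩ := hπ.1.exists_le (W := B.basicOpen e) hbe
  have hV'V : V'.1 ≤ V.1 := hV'e.trans (B.basicOpen_le e)
  have hV'U : V'.1 ≤ π ⁻¹ᵁ U.1 := hV'V.trans hVU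
  have hV' : IsAffineOpen V'.1 := V'.2
  have h2 : (I.comap π).ideal V' = Ideal.span {π.appLE U.1 V'.1 hV'U f} := by
    have h3 : π.appLE U.1 V'.1 hV'U f =
        (B.presheaf.map (homOfLE hV'V).op).hom a * (B.presheaf.map (homOfLE hV'V).op).hom e := by
      rw [← map_mul, ← he, ← Scheme.Hom.appLE_map π hVU (homOfLE hV'V).op]
      rfl
    have h4 : IsUnit ((B.presheaf.map (homOfLE hV'V).op).hom e) := by
      have h5 := (RingedSpace.isUnit_res_basicOpen _ e).map
        (B.presheaf.map (homOfLE hV'e).op).hom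
      have h6 : B.presheaf.map (homOfLE (B.basicOpen_le e)).op ≫ B.presheaf.map (homOfLE hV'e).op =
          B.presheaf.map (homOfLE hV'V).op := by
        rw [← B.presheaf.map_comp]; rfl
      rw [← h6]
      exact h5
    rw [h3, Ideal.span_singleton_mul_right_unit h4, ← (I.comap π).map_ideal' (homOfLE hV'V).op,
      hVa, Ideal.map_span, Set.image_singleton]
  have h3 := mem_nonZeroDivisors_of_span_eq ha' (h2.symm.trans hVa')
  have h4 := h2
  rw [ideal_comap_eq_map I π U V' hV'U] at h4
  obtain ⟨χ, hχ⟩ := hφ.exists_lift _ _ h4 h3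
  refine ⟨_, hV'.fromSpec, Spec.map χ, inferInstance, ?_, ?_⟩
  · rw [IsAffineOpen.range_fromSpec]
    exact hbV'
  · have h5 : Spec.map χ ≫ g ≫ π = hV'.fromSpec ≫ π := by
      rw [hg, ← Category.assoc, ← Spec.map_comp, hχ]
      exact IsAffineOpen.SpecMap_appLE_fromSpec π hU hV' hV'U
    have h6 : IsCartier (I.comap (hV'.fromSpec ≫ π)) := by
      rw [Scheme.IdealSheafData.comap_comp]
      exact hπ.1.comap_of_isOpenImmersion _
    exact (hπ.2 _ _ h6).unique (by rw [Category.assoc, h5]) rfl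

/-- Uniqueness of maps to the chart shows that `h` is the base change of the open immersion `i`
along `g`. -/
theorem isOpenImmersion_chart_map (hφ : IsBlowUpChart I U f φ) {π : B ⟶ X}
    {g : Spec C ⟶ B} (hg : g ≫ π = Spec.map φ ≫ U.2.fromSpec)
    {R : CommRingCat.{u}} {i : Spec R ⟶ B} [IsOpenImmersion i] {h : Spec R ⟶ Spec C}
    (hh : h ≫ g = i) : IsOpenImmersion h ∧ ∀ c : Spec C, g c ∈ Set.range i → c ∈ Set.range h := by
  let s : Spec R ⟶ Limits.pullback g i := Limits.pullback.lift h (𝟙 _) (by rw [hh, Category.id_comp])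
  have hs : s ≫ Limits.pullback.fst g i = h := Limits.pullback.lift_fst _ _ _
  have hs' : s ≫ Limits.pullback.snd g i = 𝟙 _ := Limits.pullback.lift_snd _ _ _
  have h1 : Limits.pullback.snd g i ≫ h = Limits.pullback.fst g i := by
    refine hφ.hom_ext ?_ ?_
    · rw [← hg, Category.assoc, reassoc_of% hh, ← Category.assoc, ← Category.assoc,
        Limits.pullback.condition]
    · rw [← hg, Category.assoc, reassoc_of% hh, ← Category.assoc, ← Limits.pullback.condition,
        Category.assoc, hg, Scheme.IdealSheafData.comap_comp]
      exact hφ.isCartier.comap_of_isOpenImmersion _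
  have : IsIso s := by
    refine ⟨Limits.pullback.snd g i, hs', Limits.pullback.hom_ext ?_ ?_⟩
    · rw [Category.assoc, hs, h1, Category.id_comp]
    · rw [Category.assoc, hs', Category.id_comp, Category.comp_id]
  constructor
  · rw [← hs]
    infer_instance
  · intro c hc
    have h2 : c ∈ Set.range (Limits.pullback.fst g i) := by
      rw [Scheme.Pullback.range_fst]
      exact hc
    obtain ⟨z, rfl⟩ := h2
    exact ⟨Limits.pullback.snd g i z, by rw [← Scheme.Hom.comp_apply, h1]⟩

/-- Write `f = a e` with a local generator `a`. On the chart `f` generates, so `e` becomes a unit in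
the local ring at `c`; since `g.stalkMap c` is local, `e` was a unit already at `g c`. -/
theorem stalkIdeal_chart_map (hφ : IsBlowUpChart I U f φ) {π : B ⟶ X} (hπ : IsBlowUp π I)
    {g : Spec C ⟶ B} (hg : g ≫ π = Spec.map φ ≫ U.2.fromSpec) (c : Spec C)
    (hb : π (g c) ∈ U.1) : stalkIdeal (I.comap π) (g c) =
      Ideal.span {π.stalkMap (g c) (X.presheaf.germ U.1 (π (g c)) hb f)} := by
  have hU : IsAffineOpen U.1 := U.2
  obtain ⟨V, hbV, hVU, a, ha, hVa⟩ := hπ.1.exists_le (W := π ⁻¹ᵁ U.1) hb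
  have h1 : π.appLE U.1 V.1 hVU f ∈ Ideal.span {a} := by
    rw [← hVa, ideal_comap_eq_map I π U V hVU]
    exact Ideal.mem_map_of_mem _ hφ.mem
  obtain ⟨e, he⟩ := Ideal.mem_span_singleton.mp h1
  have hgerm : π.stalkMap (g c) (X.presheaf.germ U.1 (π (g c)) hb f) =
      B.presheaf.germ V.1 (g c) hbV a * B.presheaf.germ V.1 (g c) hbV e := by
    refine (RingHom.congr_fun (stalkMap_germ_appLE π hVU (g c) hbV hb) f).trans ?_
    rw [RingHom.comp_apply, he, map_mul]
  have hK : stalkIdeal (I.comap π) (g c) = Ideal.span {B.presheaf.germ V.1 (g c) hbV a} := by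
    rw [stalkIdeal_eq _ V hbV, hVa, Ideal.map_span, Set.image_singleton]
  have hKc := stalkIdeal_comap (I.comap π) g c
  rw [← Scheme.IdealSheafData.comap_comp, hg, hK, stalkIdeal_eq _ ⟨⊤, isAffineOpen_top _⟩ trivial,
    ideal_comap_SpecMap I U hφ.map_eq, Ideal.map_span, Ideal.map_span, Set.image_singleton,
    Set.image_singleton] at hKc
  let F := (Spec C).presheaf.germ ⊤ c trivial ((Scheme.ΓSpecIso C).inv (φ f))
  have hF : g.stalkMap c (B.presheaf.germ V.1 (g c) hbV a) *
      g.stalkMap c (B.presheaf.germ V.1 (g c) hbV e) = F := by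
    rw [← map_mul, ← map_mul, ← he]
    have ej : (⊤ : (Spec C).Opens) ≤ (Spec.map φ ≫ hU.fromSpec) ⁻¹ᵁ U.1 :=
      fun t _ => SpecMap_fromSpec_mem hU φ t
    refine (RingHom.congr_fun (stalkMap_germ_appLE g (le_refl (g ⁻¹ᵁ V.1)) c hbV hbV) _).trans ?_
    have h2 : π.appLE U.1 V.1 hVU ≫ g.appLE V.1 (g ⁻¹ᵁ V.1) le_rfl =
        φ ≫ (Scheme.ΓSpecIso C).inv ≫ (Spec C).presheaf.map (homOfLE le_top).op := by
      rw [Scheme.Hom.appLE_comp_appLE, appLE_congr hg _ (le_top.trans ej),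
        ← Scheme.Hom.appLE_map _ ej (homOfLE le_top).op, appLE_SpecMap_fromSpec hU φ ej,
        Category.assoc]
    refine (congrArg ((Spec C).presheaf.germ (g ⁻¹ᵁ V.1) c hbV)
      (ConcreteCategory.congr_hom h2 f)).trans ?_
    exact RingHom.congr_fun (germ_res_comp (le_top : g ⁻¹ᵁ V.1 ≤ ⊤) c hbV) _
  have hFn : F ∈ nonZeroDivisors _ := map_mem_nonZeroDivisors_of_flat
    (flat_germ (⟨⊤, isAffineOpen_top _⟩ : (Spec C).affineOpens) (x := c) trivial)
    (ΓSpecIso_inv_mem_nonZeroDivisors hφ.mem_nonZeroDivisors)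
  have hunit : IsUnit (g.stalkMap c (B.presheaf.germ V.1 (g c) hbV e)) := by
    refine isUnit_of_span_mul_eq (a := g.stalkMap c (B.presheaf.germ V.1 (g c) hbV a)) ?_ ?_
    · exact mem_nonZeroDivisors_of_span_eq hFn hKc.symm
    · rw [hF]
      exact hKc.symm
  have hunit' : IsUnit (B.presheaf.germ V.1 (g c) hbV e) :=
    isUnit_of_map_unit (g.stalkMap c).hom _ hunit
  rw [hK]
  refine Eq.trans ?_ (congrArg (fun z => Ideal.span {z}) hgerm).symm
  exact (Ideal.span_singleton_mul_right_unit hunit' _).symm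

/-- The chart of the blow-up is the open subscheme where `f` generates the inverse image ideal
sheaf. -/
theorem exists_affineOpens (hφ : IsBlowUpChart I U f φ) {π : B ⟶ X} (hπ : IsBlowUp π I) :
    ∃ (V : B.affineOpens) (hV : V.1 ≤ π ⁻¹ᵁ U.1) (e : C ≅ Γ(B, V.1)),
      φ ≫ e.hom = π.appLE U.1 V.1 hV ∧ ∀ b (hb : π b ∈ U.1), stalkIdeal (I.comap π) b =
        Ideal.span {π.stalkMap b (X.presheaf.germ U.1 (π b) hb f)} → b ∈ V.1 := by
  have hU : IsAffineOpen U.1 := U.2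
  obtain ⟨g, hg, -⟩ := hπ.2 _ _ hφ.isCartier
  have key (b : B) (hb : π b ∈ U.1) (hf : stalkIdeal (I.comap π) b =
        Ideal.span {π.stalkMap b (X.presheaf.germ U.1 (π b) hb f)}) :
      ∃ (R : CommRingCat.{u}) (i : Spec R ⟶ B) (h : Spec R ⟶ Spec C), IsOpenImmersion i ∧
        b ∈ Set.range i ∧ h ≫ g = i ∧ IsOpenImmersion h ∧
          ∀ c : Spec C, g c ∈ Set.range i → c ∈ Set.range h := by
    obtain ⟨R, i, h, hi, hbi, hh⟩ := hφ.exists_chart_map hπ hg hb hf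
    exact ⟨R, i, h, hi, hbi, hh, hφ.isOpenImmersion_chart_map hg hh⟩
  have hgen (c : Spec C) : ∃ hb : π (g c) ∈ U.1, stalkIdeal (I.comap π) (g c) =
      Ideal.span {π.stalkMap (g c) (X.presheaf.germ U.1 (π (g c)) hb f)} := by
    have hb : π (g c) ∈ U.1 := by
      rw [← Scheme.Hom.comp_apply, hg]
      exact SpecMap_fromSpec_mem hU φ c
    exact ⟨hb, hφ.stalkIdeal_chart_map hπ hg c hb⟩
  -- Near each point of its image, `g` becomes the open immersion `i` after composing with the open
  -- immersion `h`, whose range contains the whole fibre of `g`. Injectivity, openness and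
  -- isomorphisms on stalks follow.
  have hopen : IsOpenImmersion g := by
    have hlocal (c : Spec C) : ∃ (R : CommRingCat.{u}) (i : Spec R ⟶ B) (h : Spec R ⟶ Spec C),
        IsOpenImmersion i ∧ h ≫ g = i ∧ IsOpenImmersion h ∧
          ∀ c' : Spec C, g c' = g c → c' ∈ Set.range h := by
      obtain ⟨hb, hf⟩ := hgen c
      obtain ⟨R, i, h, hi, hbi, hh, hho, hr⟩ := key _ hb hf
      exact ⟨R, i, h, hi, hh, hho, fun c' hc' => hr c' (hc' ▸ hbi)⟩
    have hinj : Function.Injective g := by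
      intro c c' hcc
      obtain ⟨R, i, h, hi, hh, hho, hr⟩ := hlocal c
      obtain ⟨t, rfl⟩ := hr c rfl
      obtain ⟨t', rfl⟩ := hr c' hcc.symm
      rw [← Scheme.Hom.comp_apply, ← Scheme.Hom.comp_apply, hh] at hcc
      rw [i.isOpenEmbedding.injective hcc]
    have hopenMap : IsOpenMap g := by
      rw [IsOpenMap]
      intro W hW
      rw [isOpen_iff_forall_mem_open]
      rintro _ ⟨c, hc, rfl⟩
      obtain ⟨R, i, h, hi, hh, hho, hr⟩ := hlocal c
      obtain ⟨t, rfl⟩ := hr c rfl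
      refine ⟨i '' (h ⁻¹' W), ?_, i.isOpenEmbedding.isOpenMap _ (hW.preimage h.continuous),
        ⟨t, hc, by rw [← hh, Scheme.Hom.comp_apply]⟩⟩
      rintro _ ⟨t', ht', rfl⟩
      exact ⟨h t', ht', by rw [← hh, Scheme.Hom.comp_apply]⟩
    have hstalk (c : Spec C) : IsIso (g.stalkMap c) := by
      obtain ⟨R, i, h, hi, hh, hho, hr⟩ := hlocal c
      obtain ⟨t, rfl⟩ := hr c rfl
      have : IsOpenImmersion (h ≫ g) := hh ▸ hi
      have : IsIso ((h ≫ g).stalkMap t) := (IsOpenImmersion.iff_isIso_stalkMap.mp this).2 t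
      have : IsIso (g.stalkMap (h t) ≫ h.stalkMap t) := by
        rw [← Scheme.Hom.stalkMap_comp]
        exact this
      exact IsIso.of_isIso_comp_right _ (h.stalkMap t)
    exact IsOpenImmersion.of_isIso_stalkMap g
      (.of_continuous_injective_isOpenMap g.continuous hinj hopenMap)
  have hV : IsAffineOpen g.opensRange := isAffineOpen_opensRange g
  have hVU : g.opensRange ≤ π ⁻¹ᵁ U.1 := by
    rintro _ ⟨c, rfl⟩
    exact (hgen c).1
  have e1 : (⊤ : (Spec C).Opens) ≤ g ⁻¹ᵁ g.opensRange := fun c _ => ⟨c, rfl⟩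
  have hiso : IsIso (g.appLE g.opensRange ⊤ e1) := by
    have h1 : IsIso (g.app g.opensRange) := g.isIso_app _ le_rfl
    have h2 : IsIso (homOfLE e1) := ⟨homOfLE le_top, Subsingleton.elim _ _, Subsingleton.elim _ _⟩
    rw [Scheme.Hom.appLE]
    infer_instance
  refine ⟨⟨g.opensRange, hV⟩, hVU,
    (Scheme.ΓSpecIso C).symm ≪≫ (asIso (g.appLE g.opensRange ⊤ e1)).symm, ?_, ?_⟩
  · have ej : (⊤ : (Spec C).Opens) ≤ (Spec.map φ ≫ hU.fromSpec) ⁻¹ᵁ U.1 :=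
      fun t _ => SpecMap_fromSpec_mem hU φ t
    have h1 : φ ≫ (Scheme.ΓSpecIso C).inv =
        π.appLE U.1 g.opensRange hVU ≫ g.appLE g.opensRange ⊤ e1 := by
      rw [Scheme.Hom.appLE_comp_appLE, appLE_congr hg _ ej, appLE_SpecMap_fromSpec hU φ ej]
    rw [Iso.trans_hom, Iso.symm_hom, Iso.symm_hom, asIso_inv, ← Category.assoc, h1, Category.assoc,
      IsIso.hom_inv_id, Category.comp_id]
  · intro b hb hf
    obtain ⟨R, i, h, hi, ⟨t, rfl⟩, hh, -⟩ := key b hb hf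
    exact ⟨h t, by rw [← Scheme.Hom.comp_apply, hh]⟩

end IsBlowUpChart

end Toroidal

/-! ### The monomial substitution of a blow-up chart -/

namespace Toroidal

open MvPolynomial TensorProduct

section BlowUpHom

variable {σ : Type*} {k : Type*} [Field k]

/-- The action on exponents of the substitution `X_j ↦ X_j X^e` for `j ∈ s`. -/
noncomputable def blowUpExp (s : Finset σ) (e a : σ →₀ ℕ) : σ →₀ ℕ := a + (∑ j ∈ s, a j) • e

variable (k) in
/-- The substitution `X_j ↦ X_j X^e` for `j ∈ s`. -/
noncomputable def blowUpHom [DecidableEq σ] (s : Finset σ) (e : σ →₀ ℕ) : MvPolynomial σ k →+* MvPolynomial σ k :=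
  eval₂Hom C fun j => X j * if j ∈ s then monomial e 1 else 1

theorem blowUpHom_C [DecidableEq σ] (s : Finset σ) (e : σ →₀ ℕ) (c : k) : blowUpHom k s e (C c) = C c :=
  eval₂Hom_C _ _ _

theorem blowUpHom_X [DecidableEq σ] (s : Finset σ) (e : σ →₀ ℕ) (j : σ) :
    blowUpHom k s e (X j) = X j * if j ∈ s then monomial e 1 else 1 :=
  eval₂Hom_X' _ _ _

theorem blowUpExp_add (s : Finset σ) (e a b : σ →₀ ℕ) :
    blowUpExp s e (a + b) = blowUpExp s e a + blowUpExp s e b := by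
  simp only [blowUpExp, Finsupp.add_apply, Finset.sum_add_distrib, add_smul]
  abel

theorem blowUpHom_monomial [DecidableEq σ] (s : Finset σ) (e a : σ →₀ ℕ) (c : k) :
    blowUpHom k s e (monomial a c) = monomial (blowUpExp s e a) c := by
  induction a using Finsupp.induction_linear generalizing c with
  | zero =>
    have : blowUpExp s e 0 = 0 := by simp [blowUpExp]
    rw [this]
    exact blowUpHom_C s e c
  | add a b ha hb =>
    rw [← mul_one c, ← monomial_mul, map_mul, ha, hb, monomial_mul, blowUpExp_add]
  | single j n =>
    have h1 : (monomial (Finsupp.single j n) c : MvPolynomial σ k) = C c * X j ^ n := by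
      rw [X_pow_eq_monomial, C_mul_monomial, mul_one]
    have h2 : ∑ i ∈ s, (Finsupp.single j n) i = if j ∈ s then n else 0 := by
      simp only [Finsupp.single_apply]
      rw [Finset.sum_ite_eq]
    rw [h1, map_mul, map_pow, blowUpHom_C, blowUpHom_X, blowUpExp, h2]
    split_ifs
    · rw [mul_pow, X_pow_eq_monomial, monomial_pow, monomial_mul, C_mul_monomial]
      simp
    · rw [mul_one, X_pow_eq_monomial, C_mul_monomial]
      simp

/-- As `e` vanishes on `s`, the degree on `s` is unchanged, so the added multiple of `e` is known
and can be subtracted. -/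
theorem blowUpExp_injective {s : Finset σ} {e : σ →₀ ℕ} (he : ∀ j ∈ s, e j = 0) :
    Function.Injective (blowUpExp s e) := by
  intro a b hab
  have key (a : σ →₀ ℕ) : ∑ j ∈ s, blowUpExp s e a j = ∑ j ∈ s, a j :=
    Finset.sum_congr rfl fun j hj => by simp [blowUpExp, he j hj]
  have h : ∑ j ∈ s, a j = ∑ j ∈ s, b j := by rw [← key a, ← key b, hab]
  rw [blowUpExp, blowUpExp, h] at hab
  exact add_right_cancel hab

theorem coeff_blowUpHom [DecidableEq σ] {s : Finset σ} {e : σ →₀ ℕ} (he : ∀ j ∈ s, e j = 0) (a : σ →₀ ℕ)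
    (p : MvPolynomial σ k) : coeff (blowUpExp s e a) (blowUpHom k s e p) = coeff a p := by
  classical
  induction p using MvPolynomial.induction_on' with
  | monomial b c =>
    rw [blowUpHom_monomial, coeff_monomial, coeff_monomial]
    exact if_congr (blowUpExp_injective he).eq_iff rfl rfl
  | add p q hp hq => rw [map_add, coeff_add, coeff_add, hp, hq]

/-- Injectivity on exponents excludes cancellation, so membership can be tested one monomial at a
time. -/
theorem comap_blowUpHom_le [DecidableEq σ] {s : Finset σ} {e : σ →₀ ℕ} (he : ∀ j ∈ s, e j = 0)
    {V : Set (σ →₀ ℕ)} (hV : IsUpperSet V) : (monomialIdeal k V).comap (blowUpHom k s e) ≤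
      monomialIdeal k (blowUpExp s e ⁻¹' V) := by
  intro p hp
  rw [Ideal.mem_comap, mem_monomialIdeal hV] at hp
  have hV' : IsUpperSet (blowUpExp s e ⁻¹' V) := by
    intro a b hab ha
    obtain ⟨c, rfl⟩ := exists_add_of_le hab
    rw [Set.mem_preimage, blowUpExp_add]
    exact hV le_self_add ha
  rw [mem_monomialIdeal hV']
  intro a ha
  refine hp _ ?_
  rw [mem_support_iff, coeff_blowUpHom he]
  exact mem_support_iff.mp ha

theorem IsUpperOn.preimage_blowUpExp {s S S' : Finset σ} {e : σ →₀ ℕ} (hs : s ⊆ S) (hS : S' ⊆ S)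
    {V : Set (σ →₀ ℕ)} (hV : IsUpperOn S' V) : IsUpperOn S (blowUpExp s e ⁻¹' V) := by
  intro a ha b hab
  refine hV _ ha _ fun j hj => ?_
  have h1 : ∑ j ∈ s, a j ≤ ∑ j ∈ s, b j := Finset.sum_le_sum fun j hj => hab j (hs hj)
  simp only [blowUpExp, Finsupp.add_apply, Finsupp.smul_apply, smul_eq_mul]
  exact add_le_add (hab j (hS hj)) (Nat.mul_le_mul_right _ h1)

/-- The degrees of `a` on `s` and on `S'` are at most its degree on `S`, so the substitution
multiplies degrees by at most `1 + ∑ j ∈ S', e j`. -/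
theorem preimage_blowUpExp_degOn_subset {s S S' : Finset σ} (e : σ →₀ ℕ) (hs : s ⊆ S) (hS : S' ⊆ S)
    (N : ℕ) : blowUpExp s e ⁻¹' degOn S' (N * (1 + ∑ j ∈ S', e j)) ⊆ degOn S N := by
  intro a ha
  have h1 : ∑ j ∈ s, a j ≤ ∑ j ∈ S, a j := Finset.sum_le_sum_of_subset hs
  have h2 : ∑ j ∈ S', a j ≤ ∑ j ∈ S, a j := Finset.sum_le_sum_of_subset hS
  have h3 : N * (1 + ∑ j ∈ S', e j) ≤ ∑ j ∈ S', blowUpExp s e a j := ha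
  simp only [blowUpExp, Finsupp.add_apply, Finsupp.smul_apply, smul_eq_mul,
    Finset.sum_add_distrib, ← Finset.mul_sum] at h3
  refine Nat.le_of_mul_le_mul_right (h3.trans ?_) (show 0 < 1 + ∑ j ∈ S', e j by omega)
  rw [mul_add, mul_one]
  exact add_le_add h2 (Nat.mul_le_mul_right _ h1)

theorem map_monomialIdeal_blowUpHom_le [DecidableEq σ] (s : Finset σ) (e : σ →₀ ℕ) (V : Set (σ →₀ ℕ)) :
    (monomialIdeal k (blowUpExp s e ⁻¹' V)).map (blowUpHom k s e) ≤ monomialIdeal k V := by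
  rw [monomialIdeal, Ideal.map_span, Ideal.span_le]
  rintro _ ⟨_, ⟨a, ha, rfl⟩, rfl⟩
  rw [blowUpHom_monomial]
  exact monomial_mem_monomialIdeal ha

end BlowUpHom

/-! ### Pushouts of rings -/

/-- `C` is the pushout of `A` and `S` over `R`. -/
structure IsRingPushout {R A S C : Type u} [CommRing R] [CommRing A] [CommRing S] [CommRing C]
    (Φ : R →+* A) (β : R →+* S) (φ : A →+* C) (ω : S →+* C) : Prop where
  comm : φ.comp Φ = ω.comp β
  exists_lift : ∀ (T : Type u) [CommRing T] (f : A →+* T) (g : S →+* T),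
    f.comp Φ = g.comp β → ∃ h : C →+* T, h.comp φ = f ∧ h.comp ω = g
  hom_ext : ∀ (T : Type u) [CommRing T] (h h' : C →+* T),
    h.comp φ = h'.comp φ → h.comp ω = h'.comp ω → h = h'
  induction : ∀ p : C → Prop, (∀ a s, p (φ a * ω s)) → (∀ x y, p x → p y → p (x + y)) → ∀ x, p x

theorem tmul_eq_mul {R A S : Type*} [CommRing R] [CommRing A] [CommRing S] [Algebra R A]
    [Algebra R S] (a : S) (b : A) : (a ⊗ₜ[R] b : S ⊗[R] A) = (a ⊗ₜ 1) * (1 ⊗ₜ b) := by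
  rw [Algebra.TensorProduct.tmul_mul_tmul, mul_one, one_mul]

/-- This is the tensor product. It is kept behind an interface that also fits rings of sections
identified with it only up to isomorphism; the last clause is `flat_contraction`. -/
theorem exists_isRingPushout {R A S : Type u} [CommRing R] [CommRing A] [CommRing S]
    (Φ : R →+* A) (β : R →+* S) : ∃ (C : CommRingCat.{u}) (φ : A →+* C) (ω : S →+* C),
      IsRingPushout Φ β φ ω ∧ (Φ.Etale → ω.Etale) ∧ (Φ.Flat → ∀ (K : Ideal S) (x : A),
        φ x ∈ K.map ω → x ∈ (K.comap β).map Φ) := by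
  algebraize [Φ, β]
  refine ⟨CommRingCat.of (S ⊗[R] A), (Algebra.TensorProduct.includeRight : A →ₐ[R] S ⊗[R] A),
    Algebra.TensorProduct.includeLeftRingHom, ⟨?_, ?_, ?_, ?_⟩, ?_, ?_⟩
  · ext r
    exact ((Algebra.TensorProduct.includeRight : A →ₐ[R] S ⊗[R] A).commutes r).trans
      ((Algebra.TensorProduct.includeLeft : S →ₐ[R] S ⊗[R] A).commutes r).symm
  · intro T _ f g hfg
    let := (f.comp Φ).toAlgebra
    let f' : A →ₐ[R] T := ⟨f, fun r => rfl⟩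
    let g' : S →ₐ[R] T := ⟨g, fun r => (RingHom.congr_fun hfg r).symm⟩
    have hc (x : S) (y : A) : Commute (g' x) (f' y) := Commute.all _ _
    refine ⟨(Algebra.TensorProduct.lift g' f' hc : S ⊗[R] A →ₐ[R] T), ?_, ?_⟩
    · ext a
      exact (Algebra.TensorProduct.lift_tmul g' f' hc 1 a).trans (by rw [map_one, one_mul]; rfl)
    · ext a
      exact (Algebra.TensorProduct.lift_tmul g' f' hc a 1).trans (by rw [map_one, mul_one]; rfl)
  · intro T _ h h' h1 h2
    refine RingHom.ext fun z => TensorProduct.induction_on (motive := fun z => h z = h' z) z ?_ ?_ ?_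
    · exact (map_zero h).trans (map_zero h').symm
    · intro a b
      rw [tmul_eq_mul a b]
      refine (map_mul h _ _).trans (Eq.trans ?_ (map_mul h' _ _).symm)
      exact congr_arg₂ _ (RingHom.congr_fun h2 a) (RingHom.congr_fun h1 b)
    · intro a b ha hb
      exact (map_add h a b).trans ((congr_arg₂ _ ha hb).trans (map_add h' a b).symm)
  · intro p h1 h2 z
    refine TensorProduct.induction_on (motive := p) z ?_ ?_ h2
    · have h3 := h1 0 0
      rwa [map_zero, zero_mul] at h3
    · intro a b
      rw [tmul_eq_mul a b, mul_comm]
      exact h1 b a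
  · intro hΦ
    have : Algebra.Etale R A := hΦ
    exact RingHom.etale_algebraMap.mpr (inferInstance : Algebra.Etale S (S ⊗[R] A))
  · intro hΦ K x hx
    have : Module.Flat R A := hΦ
    refine flat_contraction (O := A) (S := S) K ?_
    obtain ⟨c, hc⟩ : ∃ c : S ⊗[R] A →+* A ⊗[R] S, ∀ s a, c (s ⊗ₜ a) = a ⊗ₜ s :=
      ⟨(Algebra.TensorProduct.comm R S A : S ⊗[R] A →ₐ[R] A ⊗[R] S),
        Algebra.TensorProduct.comm_tmul R⟩
    have h1 : c (1 ⊗ₜ x) ∈ (K.map Algebra.TensorProduct.includeLeftRingHom).map c :=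
      Ideal.mem_map_of_mem c hx
    have h2 : c.comp Algebra.TensorProduct.includeLeftRingHom =
        (Algebra.TensorProduct.includeRight : S →ₐ[R] A ⊗[R] S) := RingHom.ext fun s => hc s 1
    rw [Ideal.map_map, h2, hc] at h1
    exact h1

end Toroidal

/-! ### Contraction of monomial ideals along a blow-up chart -/

namespace Toroidal

open MvPolynomial

section

variable {σ : Type} {k : Type u} [Field k] {s S S' : Finset σ} {e : σ →₀ ℕ}

theorem X_mem_monomialIdeal_posOn {T : Finset σ} {j : σ} (hj : j ∈ T) :
    (X j : MvPolynomial σ k) ∈ monomialIdeal k (posOn T) :=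
  monomial_mem_monomialIdeal ⟨j, hj, by simp⟩

theorem map_monomialIdeal_posOn_le {A : Type*} [CommRing A] {T : Finset σ}
    {ψ : MvPolynomial σ k →+* A} {K : Ideal A} (h : ∀ j ∈ T, ψ (X j) ∈ K) :
    (monomialIdeal k (posOn T)).map ψ ≤ K := by
  rw [monomialIdeal_posOn, Ideal.map_span, Ideal.span_le]
  rintro _ ⟨_, ⟨j, hj, rfl⟩, rfl⟩
  exact h j hj

variable [DecidableEq σ]

theorem blowUpHom_X_mem (he : s.Nonempty → e ∈ posOn S') {j : σ} (hj : j ∈ S' ∪ s) :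
    blowUpHom k s e (X j) ∈ monomialIdeal k (posOn S') := by
  rw [blowUpHom_X]
  rcases Finset.mem_union.mp hj with hj | hj
  · exact Ideal.mul_mem_right _ _ (X_mem_monomialIdeal_posOn hj)
  · rw [if_pos hj]
    exact Ideal.mul_mem_left _ _ (monomial_mem_monomialIdeal (he ⟨j, hj⟩))

/-- All coordinates in `S' ∪ s` die modulo the ideal `𝔟` of `S'` in `E`; for `j ∈ s` this is due to
the factor `X^e`. So `E ⧸ 𝔟` is a polynomial ring over the domain `O ⧸ 𝔭` in the variables from `s \
S'`. It is realized as the image of `ρ` in a larger polynomial ring. -/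
theorem isPrime_map_of_isRingPushout {O E : Type u} [CommRing O] [CommRing E]
    {ψ : MvPolynomial σ k →+* O} {α : O →+* E} {ω : MvPolynomial σ k →+* E}
    (h : IsRingPushout ψ (blowUpHom k s e) α ω) (he : s.Nonempty → e ∈ posOn S')
    (hp : ((monomialIdeal k (posOn (S' ∪ s))).map ψ).IsPrime) :
    ((monomialIdeal k (posOn S')).map ω).IsPrime := by
  obtain ⟨𝔭, h𝔭⟩ : ∃ 𝔭, 𝔭 = (monomialIdeal k (posOn (S' ∪ s))).map ψ := ⟨_, rfl⟩
  rw [← h𝔭] at hp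
  have h𝔭X (j : σ) (hj : j ∈ S' ∪ s) : ψ (X j) ∈ 𝔭 :=
    h𝔭 ▸ Ideal.mem_map_of_mem _ (X_mem_monomialIdeal_posOn hj)
  let y : σ → MvPolynomial σ (O ⧸ 𝔭) := fun j =>
    if j ∈ S' then 0 else if j ∈ s then X j else C (Ideal.Quotient.mk 𝔭 (ψ (X j)))
  let f : O →+* MvPolynomial σ (O ⧸ 𝔭) := C.comp (Ideal.Quotient.mk 𝔭)
  let g : MvPolynomial σ k →+* MvPolynomial σ (O ⧸ 𝔭) := eval₂Hom (f.comp (ψ.comp C)) y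
  have hgC (c : k) : g (C c) = f (ψ (C c)) := eval₂Hom_C _ _ _
  have hgX (j : σ) : g (X j) = y j := eval₂Hom_X' _ _ _
  have hf (j : σ) (hj : j ∈ S' ∪ s) : f (ψ (X j)) = 0 := by
    change C (Ideal.Quotient.mk 𝔭 (ψ (X j))) = 0
    rw [Ideal.Quotient.eq_zero_iff_mem.mpr (h𝔭X j hj), C_0]
  have hg : (monomialIdeal k (posOn S')).map g ≤ ⊥ :=
    map_monomialIdeal_posOn_le fun j hj => by
      rw [hgX, Ideal.mem_bot]
      exact if_pos hj
  have hfg : f.comp ψ = g.comp (blowUpHom k s e) := by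
    refine MvPolynomial.ringHom_ext (fun c => ?_) fun j => ?_
    · change f (ψ (C c)) = g (blowUpHom k s e (C c))
      rw [blowUpHom_C, hgC]
    · change f (ψ (X j)) = g (blowUpHom k s e (X j))
      by_cases hj : j ∈ S' ∪ s
      · rw [hf j hj]
        exact (Ideal.mem_bot.mp (hg (Ideal.mem_map_of_mem g (blowUpHom_X_mem he hj)))).symm
      · rw [Finset.mem_union, not_or] at hj
        rw [blowUpHom_X, if_neg hj.2, mul_one, hgX]
        simp only [y, if_neg hj.1, if_neg hj.2]
        rfl
  obtain ⟨ρ, hρα, hρω⟩ := h.exists_lift _ f g hfg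
  obtain ⟨𝔟, h𝔟⟩ : ∃ 𝔟, 𝔟 = (monomialIdeal k (posOn S')).map ω := ⟨_, rfl⟩
  have h𝔟X (j : σ) (hj : j ∈ S' ∪ s) : α (ψ (X j)) ∈ 𝔟 := by
    rw [← RingHom.comp_apply, h.comm, h𝔟]
    exact Ideal.mem_map_of_mem _ (blowUpHom_X_mem he hj)
  have hker : ∀ a ∈ 𝔭, ((Ideal.Quotient.mk 𝔟).comp α) a = 0 := by
    have : 𝔭 ≤ RingHom.ker ((Ideal.Quotient.mk 𝔟).comp α) := by
      rw [h𝔭]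
      exact map_monomialIdeal_posOn_le fun j hj => Ideal.Quotient.eq_zero_iff_mem.mpr (h𝔟X j hj)
    exact fun a ha => this ha
  -- `τ` recovers classes modulo `𝔟` from values of `ρ`, which gives `RingHom.ker ρ ≤ 𝔟`.
  let τ : MvPolynomial σ (O ⧸ 𝔭) →+* E ⧸ 𝔟 :=
    eval₂Hom (Ideal.Quotient.lift 𝔭 _ hker) fun j => Ideal.Quotient.mk 𝔟 (ω (X j))
  have hτf (x : O) : τ (f x) = Ideal.Quotient.mk 𝔟 (α x) := by
    refine (eval₂Hom_C _ _ _).trans ?_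
    exact Ideal.Quotient.lift_mk _ _ _
  have hτρ : τ.comp ρ = Ideal.Quotient.mk 𝔟 := by
    refine h.hom_ext _ _ _ ?_ ?_
    · ext x
      rw [RingHom.comp_assoc, hρα]
      exact hτf x
    · rw [RingHom.comp_assoc, hρω]
      refine MvPolynomial.ringHom_ext (fun c => ?_) fun j => ?_
      · rw [RingHom.comp_apply, hgC, hτf, ← RingHom.comp_apply α, h.comm, RingHom.comp_apply,
          blowUpHom_C]
        rfl
      · rw [RingHom.comp_apply, hgX]
        by_cases hj : j ∈ S'
        · simp only [y, if_pos hj]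
          rw [map_zero]
          exact (Ideal.Quotient.eq_zero_iff_mem.mpr
            (h𝔟 ▸ Ideal.mem_map_of_mem _ (X_mem_monomialIdeal_posOn hj))).symm
        by_cases hj' : j ∈ s
        · simp only [y, if_neg hj, if_pos hj']
          exact eval₂Hom_X' _ _ _
        · simp only [y, if_neg hj, if_neg hj']
          refine (hτf _).trans ?_
          rw [← RingHom.comp_apply α, h.comm, RingHom.comp_apply, blowUpHom_X, if_neg hj', mul_one]
          rfl
  have hb : 𝔟 = RingHom.ker ρ := by
    apply le_antisymm
    · rw [h𝔟]
      refine map_monomialIdeal_posOn_le fun j hj => ?_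
      rw [RingHom.mem_ker, ← RingHom.comp_apply, hρω, hgX]
      exact if_pos hj
    · intro x hx
      rw [← Ideal.Quotient.eq_zero_iff_mem, ← hτρ, RingHom.comp_apply, RingHom.mem_ker.mp hx,
        map_zero]
  rw [← h𝔟, hb]
  exact RingHom.ker_isPrime ρ

/-- The contraction passes through the pushout `E`. From `O'` to `E`, the ideal of `S'` is prime and
`hloc` clears denominators, so the result for primary monomial ideals applies. From `E` to `O`, flat
base change reduces to `blowUpHom`, where one counts exponents. -/
theorem comap_map_monomialIdeal_blowUp [Finite σ] {O O' : Type u} [CommRing O] [IsLocalRing O]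
    [CommRing O'] {ψ : MvPolynomial σ k →+* O} {ψ' : MvPolynomial σ k →+* O'} {θ : O →+* O'}
    (hψ : IsToricFrame ψ S) (hψ' : ψ'.Flat) (hθ : θ.comp ψ = ψ'.comp (blowUpHom k s e))
    (hs : s ⊆ S) (hS : S' ⊆ S) (he : ∀ j ∈ s, e j = 0) (he' : s.Nonempty → e ∈ posOn S')
    (hne : (monomialIdeal k (posOn S')).map ψ' ≠ ⊤)
    (hloc : ∀ (E : CommRingCat.{u}) (α : O →+* E) (ω : MvPolynomial σ k →+* E),
      IsRingPushout ψ (blowUpHom k s e) α ω → ∀ Θ : E →+* O', Θ.comp α = θ → Θ.comp ω = ψ' →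
      ∀ w, Θ w ∈ (monomialIdeal k (posOn S')).map ψ' →
        ∃ v, IsUnit (Θ v) ∧ v * w ∈ (monomialIdeal k (posOn S')).map ω)
    {V : Set (σ →₀ ℕ)} (hV : IsUpperOn S' V) : ((monomialIdeal k V).map ψ').comap θ ≤
      (monomialIdeal k (blowUpExp s e ⁻¹' V)).map ψ := by
  have := hψ.noeth
  obtain ⟨E, α, ω, hE, -, hcontr⟩ := exists_isRingPushout ψ (blowUpHom k s e)
  obtain ⟨Θ, hα, hω⟩ := hE.exists_lift _ θ ψ' hθ
  have hp := isPrime_map_of_isRingPushout hE he' (hψ.prime _ (Finset.union_subset hS hs))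
  have base : ((monomialIdeal k (posOn S')).map (Θ.comp ω)).comap Θ ≤
      (monomialIdeal k (posOn S')).map ω := by
    intro w hw
    rw [hω] at hw
    obtain ⟨v, hv, hvw⟩ := hloc E α ω hE Θ hα hω w hw
    refine (hp.mem_or_mem hvw).resolve_left fun hc => hne (Ideal.eq_top_of_isUnit_mem _ ?_ hv)
    rw [← hω, ← Ideal.map_map]
    exact Ideal.mem_map_of_mem _ hc
  intro z hz
  refine mem_map_monomialIdeal_of_forall hψ.mem _ fun N => ?_
  -- `E` need not be local, so Krull's theorem is used in `O`, at the end. The degree bound is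
  -- chosen so that its preimage lies in `degOn S N`.
  let V' : Set (σ →₀ ℕ) := V ∪ degOn S' (N * (1 + ∑ j ∈ S', e j))
  have hV' : IsUpperOn S' V' := hV.union (isUpperOn_degOn _ _)
  have h1 : α z ∈ (monomialIdeal k V').map ω := by
    refine comap_map_monomialIdeal_le_of_primary (θ := Θ) (hω ▸ hψ') base hV'
      ⟨_, Set.subset_union_right⟩ ?_
    rw [Ideal.mem_comap, ← RingHom.comp_apply, hα, hω]
    exact Ideal.map_mono (monomialIdeal_mono Set.subset_union_left) hz
  have h2 := Ideal.map_mono (comap_blowUpHom_le he hV'.isUpperSet) (hcontr hψ.flat _ _ h1)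
  refine Ideal.map_mono (monomialIdeal_mono ?_) h2
  rw [Set.preimage_union]
  exact Set.union_subset_union_right _ (preimage_blowUpExp_degOn_subset e hs hS N)

end

/-! ### The coordinate ring of a blow-up chart -/

section

variable {σ : Type} [DecidableEq σ] {k : Type u} [Field k] {s : Finset σ} {i : σ}
  {A B : Type u} [CommRing A] [CommRing B] {Φ : MvPolynomial σ k →+* A} {φ : A →+* B}
  {ω : MvPolynomial σ k →+* B}

theorem IsRingPushout.map_X (h : IsRingPushout Φ (blowUpHom k s (Finsupp.single i 1)) φ ω)
    (j : σ) : φ (Φ (X j)) = ω (X j) * if j ∈ s then ω (X i) else 1 := by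
  rw [← RingHom.comp_apply, h.comm, RingHom.comp_apply, blowUpHom_X, map_mul]
  congr 1
  split_ifs
  · rfl
  · rw [map_one]

theorem IsRingPushout.map_span_eq (h : IsRingPushout Φ (blowUpHom k s (Finsupp.single i 1)) φ ω)
    (hi : i ∉ s) : (Ideal.span ((fun j => Φ (X j)) '' (insert i s : Finset σ))).map φ =
      Ideal.span {φ (Φ (X i))} := by
  have hi' : φ (Φ (X i)) = ω (X i) := by rw [h.map_X, if_neg hi, mul_one]
  apply le_antisymm
  · rw [Ideal.map_span, Ideal.span_le]
    rintro _ ⟨_, ⟨j, hj, rfl⟩, rfl⟩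
    rw [SetLike.mem_coe, Ideal.mem_span_singleton]
    rcases Finset.mem_insert.mp (Finset.mem_coe.mp hj) with rfl | hj
    · exact dvd_rfl
    · refine ⟨ω (X j), ?_⟩
      change φ (Φ (X j)) = _
      rw [h.map_X, if_pos hj, hi', mul_comm]
  · rw [Ideal.span_singleton_le_iff_mem]
    exact Ideal.mem_map_of_mem _ (Ideal.subset_span
      ⟨i, Finset.mem_coe.mpr (Finset.mem_insert_self i s), rfl⟩)

theorem IsRingPushout.mem_nonZeroDivisors
    (h : IsRingPushout Φ (blowUpHom k s (Finsupp.single i 1)) φ ω) (hi : i ∉ s) (hω : ω.Flat) :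
    φ (Φ (X i)) ∈ nonZeroDivisors B := by
  rw [h.map_X, if_neg hi, mul_one]
  exact map_mem_nonZeroDivisors_of_flat hω (mem_nonZeroDivisors_of_ne_zero (X_ne_zero i))

/-- Since `X_i` generates the extended ideal, quotients `X_j / X_i` can be chosen in `T`; they are
the values of the map on the variables in `s`. -/
theorem IsRingPushout.exists_comp_eq
    (h : IsRingPushout Φ (blowUpHom k s (Finsupp.single i 1)) φ ω) (hi : i ∉ s) {T : Type u}
    [CommRing T] (ψ : A →+* T)
    (hψ : (Ideal.span ((fun j => Φ (X j)) '' (insert i s : Finset σ))).map ψ =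
      Ideal.span {ψ (Φ (X i))}) : ∃ χ : B →+* T, χ.comp φ = ψ := by
  have h1 (j : σ) (hj : j ∈ s) : ∃ t, ψ (Φ (X j)) = ψ (Φ (X i)) * t := by
    refine Ideal.mem_span_singleton.mp ?_
    rw [← hψ]
    exact Ideal.mem_map_of_mem _ (Ideal.subset_span
      ⟨j, Finset.mem_coe.mpr (Finset.mem_insert_of_mem hj), rfl⟩)
  choose! t ht using h1
  let g : MvPolynomial σ k →+* T :=
    eval₂Hom (ψ.comp (Φ.comp C)) fun j => if j ∈ s then t j else ψ (Φ (X j))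
  have hgX (j : σ) : g (X j) = if j ∈ s then t j else ψ (Φ (X j)) := eval₂Hom_X' _ _ _
  have hgC (c : k) : g (C c) = ψ (Φ (C c)) := eval₂Hom_C _ _ _
  clear_value g
  obtain ⟨χ, hχ, -⟩ := h.exists_lift _ ψ g (by
    refine MvPolynomial.ringHom_ext (fun c => ?_) fun j => ?_
    · rw [RingHom.comp_apply, RingHom.comp_apply, blowUpHom_C, hgC]
    · rw [RingHom.comp_apply, RingHom.comp_apply, blowUpHom_X, map_mul, hgX]
      split_ifs with hj
      · refine (ht j hj).trans ((mul_comm _ _).trans (congr_arg _ ?_))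
        refine Eq.trans ?_ (hgX i).symm
        rw [if_neg hi]
      · rw [map_one, mul_one])
  exact ⟨χ, hχ⟩

/-- The quotients `X_j / X_i` are unique once `X_i` is a non-zero-divisor. -/
theorem IsRingPushout.eq_of_comp_eq
    (h : IsRingPushout Φ (blowUpHom k s (Finsupp.single i 1)) φ ω) (hi : i ∉ s) {T : Type u}
    [CommRing T] {χ χ' : B →+* T} (hT : χ (φ (Φ (X i))) ∈ nonZeroDivisors T)
    (hχ : χ.comp φ = χ'.comp φ) : χ = χ' := by
  refine h.hom_ext _ _ _ hχ (MvPolynomial.ringHom_ext (fun c => ?_) fun j => ?_)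
  · have h1 : ω (C c) = φ (Φ (C c)) := by
      rw [← RingHom.comp_apply φ, h.comm, RingHom.comp_apply, blowUpHom_C]
    rw [RingHom.comp_apply, RingHom.comp_apply, h1]
    exact RingHom.congr_fun hχ _
  · have h1 (j : σ) : χ (φ (Φ (X j))) = χ' (φ (Φ (X j))) := RingHom.congr_fun hχ _
    rw [RingHom.comp_apply, RingHom.comp_apply]
    by_cases hj : j ∈ s
    · have h2 := h1 j
      rw [h.map_X j, if_pos hj, map_mul, map_mul] at h2
      have h3 : φ (Φ (X i)) = ω (X i) := by rw [h.map_X, if_neg hi, mul_one]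
      rw [← h3, ← h1 i] at h2
      have h4 : (χ (ω (X j)) - χ' (ω (X j))) * χ (φ (Φ (X i))) = 0 := by rw [sub_mul, h2, sub_self]
      exact sub_eq_zero.mp (mem_nonZeroDivisors_iff_right.mp hT _ h4)
    · have h2 := h1 j
      rwa [h.map_X j, if_neg hj, mul_one] at h2

end

end Toroidal

/-! ### Local models of the blow-up of a toroidal center -/

namespace Toroidal

/-- Otherwise every generator is `a` times a non-unit, so `a` lies in `𝔪 a`, which is impossible for
a non-zero-divisor. This is why the coordinate charts cover the blow-up. -/
theorem exists_span_eq_of_span_image {R ι : Type*} [CommRing R] [IsLocalRing R] {g : ι → R}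
    {T : Finset ι} {a : R} (ha : a ∈ nonZeroDivisors R)
    (h : Ideal.span (g '' T) = Ideal.span {a}) : ∃ i ∈ T, Ideal.span {g i} = Ideal.span {a} := by
  have h1 : ∀ j ∈ T, ∃ c, g j = a * c := fun j hj => Ideal.mem_span_singleton.mp
    (h ▸ Ideal.subset_span ⟨j, Finset.mem_coe.mpr hj, rfl⟩)
  choose! c hc using h1
  by_contra! hne
  have h2 : ∀ j ∈ T, c j ∈ IsLocalRing.maximalIdeal R := by
    intro j hj hu
    refine hne j hj ?_
    rw [hc j hj, Ideal.span_singleton_mul_right_unit (by simpa using hu)]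
  have h3 : a ∈ Ideal.span {a} * IsLocalRing.maximalIdeal R := by
    have : a ∈ Ideal.span (g '' T) := h ▸ Ideal.mem_span_singleton_self a
    refine Ideal.span_le.mpr ?_ this
    rintro _ ⟨j, hj, rfl⟩
    rw [hc j hj]
    exact Ideal.mul_mem_mul (Ideal.mem_span_singleton_self a) (h2 j hj)
  obtain ⟨z, hz, hza⟩ := Ideal.mem_span_singleton_mul.mp h3
  have h4 : (1 - z) * a = 0 := by rw [sub_mul, one_mul, mul_comm z a, hza, sub_self]
  have h5 := mem_nonZeroDivisors_iff_right.mp ha _ h4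
  rw [sub_eq_zero] at h5
  exact (Ideal.ne_top_iff_one _).mp (Ideal.IsPrime.ne_top inferInstance) (h5 ▸ hz)

section

variable {X Y : Scheme.{u}}

instance isPrime_primeAt (U : X.affineOpens) {y : X} (hy : y ∈ U.1) : (primeAt U y hy).IsPrime :=
  Ideal.IsPrime.comap _

theorem le_of_forall_map_germ_le {U : X.affineOpens} {I J : Ideal Γ(X, U.1)}
    (h : ∀ q (hq : q ∈ U.1), I.map (X.presheaf.germ U.1 q hq).hom ≤
      J.map (X.presheaf.germ U.1 q hq).hom) : I ≤ J := by
  intro a ha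
  let 𝔡 : Ideal Γ(X, U.1) := J.colon {a}
  suffices h1 : 𝔡 = ⊤ by
    have h2 : (1 : Γ(X, U.1)) ∈ 𝔡 := h1 ▸ Submodule.mem_top
    simpa [𝔡, Submodule.mem_colon_singleton] using h2
  by_contra hne
  obtain ⟨𝔪, h𝔪, hle⟩ := Ideal.exists_le_maximal 𝔡 hne
  have := h𝔪.isPrime
  obtain ⟨q, hq, rfl⟩ := exists_primeAt_eq U 𝔪
  obtain ⟨s, hs, hsa⟩ := germ_mem_map_iff.mp (h q hq (Ideal.mem_map_of_mem _ ha))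
  exact mem_primeAt.mp (hle (Submodule.mem_colon_singleton.mpr hsa)) hs

theorem comap_appLE_primeAt (f : X ⟶ Y) {U : Y.affineOpens} {V : X.affineOpens}
    (e : V.1 ≤ f ⁻¹ᵁ U.1) {w : X} (hw : w ∈ V.1) :
    (primeAt V w hw).comap (f.appLE U.1 V.1 e).hom = primeAt U (f w) (e hw) := by
  rw [primeAt, Ideal.comap_comap, ← stalkMap_germ_appLE f e w hw (e hw), ← Ideal.comap_comap,
    IsLocalRing.maximalIdeal_comap]
  rfl

end

variable {k : Type u} [Field k]

namespace LogPair

variable {P : LogPair k} {U : P.X.affineOpens} {n : ℕ} {x : Fin n → Γ(P.X, U.1)} {y η w : P.X}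

theorem IsCoordinates.ideal_vanishingIdeal (h : P.IsCoordinates U x) {Z : Closeds P.X}
    {T : Finset (Fin n)} (hZ : ∀ q ∈ U.1, q ∈ Z ↔ ∀ j ∈ T, q ∉ P.X.basicOpen (x j)) :
    (Scheme.IdealSheafData.vanishingIdeal Z).ideal U = Ideal.span (x '' T) := by
  have key : ∀ q (hq : q ∈ U.1), ((Scheme.IdealSheafData.vanishingIdeal Z).ideal U).map
      (P.X.presheaf.germ U.1 q hq).hom = (Ideal.span (x '' T)).map
      (P.X.presheaf.germ U.1 q hq).hom := by
    intro q hq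
    rw [← stalkIdeal_eq _ U hq]
    by_cases hqZ : q ∈ Z
    · rw [h.stalkIdeal_vanishingIdeal hq hZ hqZ, map_posOn_coordStalk]
    · rw [stalkIdeal_vanishingIdeal_of_notMem hqZ]
      rw [hZ q hq] at hqZ
      push Not at hqZ
      obtain ⟨j, hj, hqj⟩ := hqZ
      refine (Ideal.eq_top_of_isUnit_mem _ (Ideal.mem_map_of_mem _
        (Ideal.subset_span (Set.mem_image_of_mem x (Finset.mem_coe.mpr hj)))) ?_).symm
      exact (P.X.mem_basicOpen _ _ hq).mp hqj
  exact le_antisymm (le_of_forall_map_germ_le fun q hq => (key q hq).le)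
    (le_of_forall_map_germ_le fun q hq => (key q hq).ge)

theorem faces_subset_faces_res {V : P.X.affineOpens} (h : V.1 ≤ U.1) :
    faces x y ⊆ faces (fun j => P.X.presheaf.map (homOfLE h).op (x j)) y := by
  intro j hj
  obtain ⟨D, hD, hy, hq⟩ := mem_faces.mp hj
  exact mem_faces.mpr ⟨D, hD, hy, fun q hqV =>
    (hq q (h hqV)).trans (not_congr (mem_basicOpen_res h (x j) hqV).symm)⟩

theorem coordHom_C (c : k) : coordHom x (.C c) = P.scalars U.1 c :=
  MvPolynomial.eval₂Hom_C _ _ _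

end LogPair

open LogPair MvPolynomial

namespace PairBlowUp

variable {P P' : LogPair k} (b : PairBlowUp P P')

theorem scalars_appLE {U : P.X.Opens} {V : P'.X.Opens} (e : V ≤ b.π ⁻¹ᵁ U) (c : k) :
    b.π.appLE U V e (P.scalars U c) = P'.scalars V c := by
  have h : (Scheme.ΓSpecIso (CommRingCat.of k)).inv ≫ P'.hom.appTop ≫
      P'.X.presheaf.map (homOfLE le_top).op = ((Scheme.ΓSpecIso (CommRingCat.of k)).inv ≫
        P.hom.appTop ≫ P.X.presheaf.map (homOfLE le_top).op) ≫ b.π.appLE U V e := by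
    rw [b.hom_eq]
    simp only [Scheme.Hom.comp_appTop, Category.assoc]
    congr 2
    rw [Scheme.Hom.map_appLE]
    rfl
  exact (ConcreteCategory.congr_hom h c).symm

/-- Coordinates `z` on a chart of a blow-up over coordinates `x`, in which the exceptional divisor
is given by the monomial with exponent `e`. -/
structure IsModel {U : P.X.affineOpens} {V : P'.X.affineOpens} {n : ℕ} (x : Fin n → Γ(P.X, U.1))
    (z : Fin n → Γ(P'.X, V.1)) (s : Finset (Fin n)) (e : Fin n →₀ ℕ) : Prop where
  le : V.1 ≤ b.π ⁻¹ᵁ U.1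
  etale : P'.IsCoordinates V z
  pushout : IsRingPushout (coordHom x) (blowUpHom k s e) (b.π.appLE U.1 V.1 le).hom (coordHom z)
  exceptional : b.exceptionalIdeal.ideal V = Ideal.span {coordHom z (monomial e 1)}
  exp : e = 0 ∧ s = ∅ ∨ ∃ i ∉ s, e = Finsupp.single i 1

variable {b}

theorem exists_isModel_of_isBlowUpChart {U : P.X.affineOpens} {n : ℕ} {x : Fin n → Γ(P.X, U.1)}
    {s : Finset (Fin n)} {e : Fin n →₀ ℕ} {f : Γ(P.X, U.1)} {B : CommRingCat.{u}}
    {φ : Γ(P.X, U.1) →+* B} {ω : MvPolynomial (Fin n) k →+* B}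
    (h : IsRingPushout (coordHom x) (blowUpHom k s e) φ ω) (hω : ω.Etale)
    (hφ : IsBlowUpChart (Scheme.IdealSheafData.vanishingIdeal b.Z) U f (CommRingCat.ofHom φ))
    (hf : φ f = ω (monomial e 1)) (he : e = 0 ∧ s = ∅ ∨ ∃ i ∉ s, e = Finsupp.single i 1) :
    ∃ (V : P'.X.affineOpens) (z : Fin n → Γ(P'.X, V.1)), b.IsModel x z s e ∧
      ∀ w (hw : b.π w ∈ U.1), stalkIdeal b.exceptionalIdeal w =
        Ideal.span {b.π.stalkMap w (P.X.presheaf.germ U.1 (b.π w) hw f)} → w ∈ V.1 := by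
  obtain ⟨V, hV, ι, hι, hmem⟩ := hφ.exists_affineOpens b.isBlowUp
  have hι' : ι.hom.hom.comp φ = (b.π.appLE U.1 V.1 hV).hom :=
    congrArg CommRingCat.Hom.hom hι
  have hz : coordHom (fun j => ι.hom (ω (X j))) = ι.hom.hom.comp ω := by
    refine MvPolynomial.ringHom_ext (fun c => ?_) fun j => ?_
    · rw [coordHom_C, ← b.scalars_appLE hV, ← coordHom_C (x := x)]
      change (b.π.appLE U.1 V.1 hV).hom _ = ι.hom.hom (ω (C c))
      have h1 := RingHom.congr_fun h.comm (MvPolynomial.C c)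
      rw [RingHom.comp_apply, RingHom.comp_apply, blowUpHom_C] at h1
      rw [← hι', ← h1]
      rfl
    · exact coordHom_X j
  have hinv1 : ∀ c, ι.inv.hom (ι.hom.hom c) = c := fun c => ConcreteCategory.congr_hom ι.hom_inv_id c
  have hinv2 : ∀ c, ι.hom.hom (ι.inv.hom c) = c := fun c => ConcreteCategory.congr_hom ι.inv_hom_id c
  refine ⟨V, fun j => ι.hom (ω (X j)), ⟨hV, ?_, ⟨?_, ?_, ?_, ?_⟩, ?_, he⟩, hmem⟩
  · change (coordHom _).Etale
    rw [hz]
    exact RingHom.Etale.respectsIso.1 ω ι.commRingCatIsoToRingEquiv hω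
  · rw [hz, ← hι', RingHom.comp_assoc, h.comm, RingHom.comp_assoc]
  · intro T _ f g hfg
    obtain ⟨χ, h1, h2⟩ := h.exists_lift T f g hfg
    refine ⟨χ.comp ι.inv.hom, ?_, ?_⟩
    · rw [← hι', ← h1]
      exact RingHom.ext fun c => congrArg χ (hinv1 _)
    · rw [hz, ← h2]
      exact RingHom.ext fun c => congrArg χ (hinv1 _)
  · intro T _ χ χ' h1 h2
    have h3 := h.hom_ext T (χ.comp ι.hom.hom) (χ'.comp ι.hom.hom)
      (by rw [RingHom.comp_assoc, hι', h1, RingHom.comp_assoc, hι'])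
      (by rw [RingHom.comp_assoc, ← hz, h2, RingHom.comp_assoc, ← hz])
    ext c
    rw [← hinv2 c]
    exact RingHom.congr_fun h3 _
  · intro p h1 h2 c
    rw [← hinv2 c]
    refine h.induction (fun c => p (ι.hom.hom c)) (fun a q => ?_) (fun c c' hc hc' => ?_) _
    · rw [map_mul]
      have h3 := h1 a q
      rwa [hz, ← hι'] at h3
    · rw [map_add]
      exact h2 _ _ hc hc'
  · rw [exceptionalIdeal, ideal_comap_eq_map _ _ U V hV, ← hι', ← Ideal.map_map]
    have h1 := hφ.map_eq
    change Ideal.map φ _ = Ideal.span {φ f} at h1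
    rw [h1, Ideal.map_span, Set.image_singleton, hz, hf]
    rfl

theorem isBlowUpChart_one {Z : Closeds P.X} {U : P.X.affineOpens} {n : ℕ}
    {x : Fin n → Γ(P.X, U.1)} (hU : ∀ q ∈ U.1, q ∉ Z) {B : CommRingCat.{u}}
    {φ : Γ(P.X, U.1) →+* B} {ω : MvPolynomial (Fin n) k →+* B}
    (h : IsRingPushout (coordHom x) (blowUpHom k ∅ 0) φ ω) :
    IsBlowUpChart (Scheme.IdealSheafData.vanishingIdeal Z) U 1 (CommRingCat.ofHom φ) := by
  have hβ : blowUpHom k (∅ : Finset (Fin n)) 0 = RingHom.id _ := by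
    refine MvPolynomial.ringHom_ext (fun c => blowUpHom_C _ _ _) fun j => ?_
    rw [blowUpHom_X, if_neg (Finset.notMem_empty j), mul_one, RingHom.id_apply]
  rw [hβ] at h
  have hI : (Scheme.IdealSheafData.vanishingIdeal Z).ideal U = ⊤ :=
    (Ideal.eq_top_iff_one _).mpr (mem_ideal_vanishingIdeal.mpr fun q hq hqZ => absurd hqZ (hU q hq))
  refine ⟨?_, hI ▸ Submodule.mem_top, ?_, fun R ψ _ _ => ?_, fun R χ χ' _ hχ => ?_⟩
  · rw [hI, Ideal.map_top, map_one, Ideal.span_singleton_one]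
  · rw [map_one]
    exact one_mem _
  · obtain ⟨χ, hχ, -⟩ := h.exists_lift R ψ.hom (ψ.hom.comp (coordHom x)) rfl
    exact ⟨CommRingCat.ofHom χ, CommRingCat.hom_ext hχ⟩
  · have h1 : χ.hom.comp φ = χ'.hom.comp φ := congrArg CommRingCat.Hom.hom hχ
    refine CommRingCat.hom_ext (h.hom_ext R _ _ h1 ?_)
    have h2 := h.comm
    rw [RingHom.comp_id] at h2
    rw [← h2, ← RingHom.comp_assoc, h1, RingHom.comp_assoc]

theorem isBlowUpChart_coordinate {Z : Closeds P.X} {U : P.X.affineOpens} {n : ℕ}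
    {x : Fin n → Γ(P.X, U.1)} {s : Finset (Fin n)} {i : Fin n} (hi : i ∉ s)
    (hI : (Scheme.IdealSheafData.vanishingIdeal Z).ideal U =
      Ideal.span (x '' (insert i s : Finset (Fin n)))) {B : CommRingCat.{u}}
    {φ : Γ(P.X, U.1) →+* B} {ω : MvPolynomial (Fin n) k →+* B} (hω : ω.Flat)
    (h : IsRingPushout (coordHom x) (blowUpHom k s (Finsupp.single i 1)) φ ω) :
    IsBlowUpChart (Scheme.IdealSheafData.vanishingIdeal Z) U (x i) (CommRingCat.ofHom φ) := by
  have hx : (fun j => coordHom x (X j)) = x := funext fun j => coordHom_X j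
  have h1 := h.map_span_eq hi
  rw [hx, coordHom_X, ← hI] at h1
  refine ⟨h1, ?_, ?_, fun R ψ hψ _ => ?_, fun R χ χ' hn hχ => ?_⟩
  · rw [hI]
    exact Ideal.subset_span (Set.mem_image_of_mem x
      (Finset.mem_coe.mpr (Finset.mem_insert_self i s)))
  · have h2 := h.mem_nonZeroDivisors hi hω
    rwa [coordHom_X] at h2
  · rw [hI] at hψ
    obtain ⟨χ, hχ⟩ := h.exists_comp_eq hi ψ.hom (by rw [hx, coordHom_X]; exact hψ)
    exact ⟨CommRingCat.ofHom χ, CommRingCat.hom_ext hχ⟩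
  · refine CommRingCat.hom_ext (h.eq_of_comp_eq hi ?_ (congrArg CommRingCat.Hom.hom hχ))
    rw [coordHom_X]
    exact hn

/-- Over a neighbourhood of every point, a toroidal blow-up is covered by finitely many models. -/
theorem exists_finite_isModel (hP : P.IsLocallySnc) (hZ : P.IsToroidalCenter b.Z) (q : P.X) :
    ∃ (U : P.X.affineOpens) (n : ℕ) (x : Fin n → Γ(P.X, U.1)) (𝒱 : Set P'.X.affineOpens),
      IsChart x q ∧ 𝒱.Finite ∧ (∀ w, b.π w ∈ U.1 → ∃ V ∈ 𝒱, w ∈ V.1) ∧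
      ∀ V ∈ 𝒱, ∃ (z : Fin n → Γ(P'.X, V.1)) (s : Finset (Fin n)) (e : Fin n →₀ ℕ),
        b.IsModel x z s e ∧ s ⊆ faces x q ∧ ∀ j, e j ≠ 0 → j ∈ faces x q ∧ q ∈ b.Z := by
  obtain ⟨U₀, n, x₀, h₀⟩ := hP.exists_isChart q
  by_cases hw : q ∈ b.Z
  · obtain ⟨T, hT, -, O, hO, hOZ⟩ := hZ.exists_isOpen hP hw h₀
    obtain ⟨U, hU, hUO, h⟩ := h₀.exists_res hO
    obtain ⟨x, hx⟩ : ∃ x : Fin n → Γ(P.X, U.1),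
      x = fun j => P.X.presheaf.map (homOfLE hU).op (x₀ j) := ⟨_, rfl⟩
    have hT' : T ⊆ faces x q := hx ▸ hT.trans (faces_subset_faces_res hU)
    have hUZ : ∀ q ∈ U.1, q ∈ b.Z ↔ ∀ j ∈ T, q ∉ P.X.basicOpen (x j) := by
      intro q hq
      rw [hOZ q (hUO hq) (hU hq), hx]
      exact forall₂_congr fun j _ => not_congr (mem_basicOpen_res hU (x₀ j) hq).symm
    rw [← hx] at h
    have hI := h.etale.ideal_vanishingIdeal hUZ
    have key : ∀ i : T, ∃ (V : P'.X.affineOpens) (z : Fin n → Γ(P'.X, V.1)),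
        b.IsModel x z (T.erase i) (Finsupp.single i.1 1) ∧
        ∀ w (hw : b.π w ∈ U.1), stalkIdeal b.exceptionalIdeal w =
          Ideal.span {b.π.stalkMap w (P.X.presheaf.germ U.1 (b.π w) hw (x i))} → w ∈ V.1 := by
      rintro ⟨i, hiT⟩
      obtain ⟨B, φ, ω, hB, hω, -⟩ := exists_isRingPushout (coordHom x)
        (blowUpHom k (T.erase i) (Finsupp.single i 1))
      have hBc := isBlowUpChart_coordinate (Z := b.Z) (Finset.notMem_erase i T)
        (by rwa [Finset.insert_erase hiT])
        (RingHom.Etale.iff_flat_and_formallyUnramified.mp (hω h.etale)).1 hB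
      exact exists_isModel_of_isBlowUpChart hB (hω h.etale) hBc (by
        have h3 := hB.map_X i
        rwa [coordHom_X, if_neg (Finset.notMem_erase i T), mul_one] at h3)
        (Or.inr ⟨i, Finset.notMem_erase i T, rfl⟩)
    choose V z hV hmem using key
    refine ⟨U, n, x, Set.range V, h, Set.finite_range V, fun w hwU => ?_, ?_⟩
    · obtain ⟨V₁, hwV₁, a, ha, hV₁⟩ := b.isBlowUp.1 w
      have h1 : stalkIdeal b.exceptionalIdeal w =
          Ideal.span {P'.X.presheaf.germ V₁.1 w hwV₁ a} := by
        rw [stalkIdeal_eq _ V₁ hwV₁, exceptionalIdeal, hV₁, Ideal.map_span, Set.image_singleton]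
      have h2 : stalkIdeal b.exceptionalIdeal w = Ideal.span ((fun j => b.π.stalkMap w
          (P.X.presheaf.germ U.1 (b.π w) hwU (x j))) '' T) := by
        rw [exceptionalIdeal, stalkIdeal_comap, stalkIdeal_eq _ U hwU, hI, Ideal.map_map,
          Ideal.map_span, ← Set.image_comp]
        rfl
      obtain ⟨i, hiT, hi⟩ := exists_span_eq_of_span_image
        (map_mem_nonZeroDivisors_of_flat (flat_germ V₁ hwV₁) ha) (h2.symm.trans h1)
      exact ⟨_, ⟨⟨i, hiT⟩, rfl⟩, hmem ⟨i, hiT⟩ w hwU (h1.trans hi.symm)⟩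
    · rintro _ ⟨i, rfl⟩
      refine ⟨z i, _, _, hV i, (Finset.erase_subset _ T).trans hT', fun j hj => ⟨?_, hw⟩⟩
      have hji : j = i := by
        by_contra hc
        exact hj (Finsupp.single_eq_of_ne hc)
      exact hT' (hji ▸ i.2)
  · obtain ⟨U, hU, hUO, h⟩ := h₀.exists_res (W := ⟨(b.Z : Set P.X)ᶜ, b.Z.isClosed.isOpen_compl⟩) hw
    obtain ⟨x, hx⟩ : ∃ x : Fin n → Γ(P.X, U.1),
      x = fun j => P.X.presheaf.map (homOfLE hU).op (x₀ j) := ⟨_, rfl⟩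
    rw [← hx] at h
    -- Away from the center the blow-up is an isomorphism: the model with `s = ∅`, `e = 0` and local
    -- generator `1`.
    obtain ⟨B, φ, ω, hB, hω, -⟩ := exists_isRingPushout (coordHom x) (blowUpHom k ∅ 0)
    have hBc := isBlowUpChart_one (Z := b.Z) (fun q hq => hUO hq) hB
    obtain ⟨V, z, hV, hmem⟩ := exists_isModel_of_isBlowUpChart hB (hω h.etale) hBc
      (by rw [map_one]; exact (map_one ω).symm) (Or.inl ⟨rfl, rfl⟩)
    refine ⟨U, n, x, {V}, h, Set.finite_singleton V, fun w hwU => ⟨V, rfl, hmem w hwU ?_⟩, ?_⟩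
    · rw [exceptionalIdeal, stalkIdeal_comap, stalkIdeal_vanishingIdeal_of_notMem (hUO hwU),
        Ideal.map_top, map_one, map_one, Ideal.span_singleton_one]
    · rintro _ rfl
      exact ⟨z, _, _, hV, Finset.empty_subset _, fun j hj => absurd rfl hj⟩

end PairBlowUp

end Toroidal

/-! ### Coordinate hyperplanes and the boundary of a blow-up -/

namespace Toroidal

theorem exists_isOpen_closure_iff {X : Scheme.{u}} {V : X.affineOpens} [IsNoetherianRing Γ(X, V.1)]
    {ξ y : X} (hy : y ∈ V.1) (hξ : ξ ⤳ y) {a : Γ(X, V.1)}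
    (h : (IsLocalRing.maximalIdeal _).comap (X.presheaf.stalkSpecializes hξ).hom =
      (Ideal.span {a}).map (X.presheaf.germ V.1 y hy).hom) :
    ∃ O : X.Opens, y ∈ O ∧ ∀ q ∈ O, q ∈ V.1 → (q ∈ closure {ξ} ↔ q ∉ X.basicOpen a) := by
  have hξV := hξ.mem_open V.1.2 hy
  have h0 : primeAt V ξ hξV = (((IsLocalRing.maximalIdeal _).comap
      (X.presheaf.stalkSpecializes hξ).hom).comap (X.presheaf.germ V.1 y hy).hom) := by
    rw [Ideal.comap_comap, germ_comp_stalkSpecializes]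
    rfl
  rw [h] at h0
  have ha : a ∈ primeAt V ξ hξV := by
    rw [h0]
    exact Ideal.mem_map_of_mem _ (Ideal.mem_span_singleton_self a)
  obtain ⟨G, hG⟩ := (inferInstance : IsNoetherianRing Γ(X, V.1)).noetherian (primeAt V ξ hξV)
  have h1 : ∀ g ∈ G, ∃ s, y ∈ X.basicOpen s ∧ s * g ∈ Ideal.span {a} := by
    intro g hg
    have h2 : g ∈ primeAt V ξ hξV := hG ▸ Submodule.subset_span hg
    rw [h0] at h2
    exact germ_mem_map_iff.mp h2
  choose! s hs1 hs2 using h1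
  have hyt : y ∈ X.basicOpen (∏ g ∈ G, s g) := by
    rw [X.mem_basicOpen _ _ hy, map_prod, IsUnit.prod_iff]
    exact fun g hg => (X.mem_basicOpen _ _ hy).mp (hs1 g hg)
  refine ⟨X.basicOpen (∏ g ∈ G, s g), hyt, fun q hqO hq => ?_⟩
  have h3 : q ∈ closure {ξ} ↔ primeAt V ξ hξV ≤ primeAt V q hq := by
    rw [← specializes_iff_mem_closure, specializes_iff_primeAt_le hξV hq]
  rw [h3, ← mem_primeAt (hx := hq)]
  refine ⟨fun hle => hle ha, fun haq => ?_⟩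
  rw [← hG]
  refine Submodule.span_le.mpr fun g hg => ?_
  have h4 : s g * g ∈ primeAt V q hq :=
    (Ideal.span_singleton_le_iff_mem _).mpr haq (hs2 g hg)
  refine ((isPrime_primeAt V hq).mem_or_mem h4).resolve_left fun hc => ?_
  refine mem_primeAt.mp (?_ : (∏ g ∈ G, s g) ∈ primeAt V q hq) hqO
  exact Ideal.mem_of_dvd _ (Finset.dvd_prod_of_mem s hg) hc

variable {k : Type u} [Field k]

namespace LogPair

variable {P : LogPair k} {U : P.X.affineOpens} {n : ℕ} {x : Fin n → Γ(P.X, U.1)} {y : P.X}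

/-- `ξ` is the generic point of the branch through `y` of the hypersurface `(x_j = 0)`. -/
structure IsGenericAt (x : Fin n → Γ(P.X, U.1)) (y : P.X) (j : Fin n) (ξ : P.X) : Prop where
  specializes : ξ ⤳ y
  notMem_iff : ∀ i, ξ ∉ P.X.basicOpen (x i) ↔ i = j
  specializes_of_notMem : ∀ w, w ⤳ y → w ∉ P.X.basicOpen (x j) → ξ ⤳ w

/-- The hypersurface may be reducible on `U`, but its ideal at `y` is prime: exactly one branch
passes through `y`, and near `y` the hypersurface is that branch. -/
theorem IsCoordinates.exists_isGenericAt (h : P.IsCoordinates U x) (hy : y ∈ U.1) {j : Fin n}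
    (hj : y ∉ P.X.basicOpen (x j)) : ∃ ξ, IsGenericAt x y j ξ ∧ ∃ O : P.X.Opens, y ∈ O ∧
      ∀ q ∈ O, q ∈ U.1 → (q ∈ closure {ξ} ↔ q ∉ P.X.basicOpen (x j)) := by
  have hF : IsToricFrame (coordStalk x hy) {j} :=
    h.isToricFrame hy fun i hi => Finset.mem_singleton.mp hi ▸ hj
  have hp := hF.prime {j} subset_rfl
  obtain ⟨ξ, hs, h1, h2⟩ := exists_specializes_of_isPrime
    ((monomialIdeal k (posOn {j})).map (coordStalk x hy))
  have hspan : (monomialIdeal k (posOn {j})).map (coordStalk x hy) =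
      (Ideal.span {x j}).map (P.X.presheaf.germ U.1 y hy).hom := by
    rw [map_posOn_coordStalk, Finset.coe_singleton, Set.image_singleton]
  have hmem (w : P.X) (hw : w ⤳ y) (i : Fin n) : w ∉ P.X.basicOpen (x i) ↔
      coordStalk x hy (.X i) ∈ (IsLocalRing.maximalIdeal _).comap
        (P.X.presheaf.stalkSpecializes hw).hom := by
    rw [← germ_mem_maximalIdeal_iff (hw.mem_open U.1.2 hy), Ideal.mem_comap, ← RingHom.comp_apply,
      comp_coordStalk, coordStalk_X]
  refine ⟨ξ, ⟨hs, fun i => ?_, fun w hw hwj => specializes_of_comap_le hs hw ?_⟩, ?_⟩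
  · rw [hmem ξ hs, h2]
    refine ⟨fun h3 => ?_, fun h3 => ?_⟩
    · by_contra hne
      exact hF.X_notMem subset_rfl (by simpa using hne) h3
    · exact Ideal.mem_map_of_mem _ (X_mem_monomialIdeal_posOn (by simpa using h3))
  · rw [h2]
    refine map_monomialIdeal_posOn_le fun i hi => ?_
    rw [Finset.mem_singleton.mp hi]
    exact (hmem w hw j).mp hwj
  · have hU : (coordHom x).Etale := h
    have := hU.isNoetherianRing
    exact exists_isOpen_closure_iff hy hs (h2.trans hspan)

end LogPair

open LogPair MvPolynomial

namespace PairBlowUp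

variable {P P' : LogPair k} {b : PairBlowUp P P'}

/-- Over the complement of the center, the identity of an affine open is a blow-up chart with
generator `1`, so generizations above and below correspond. -/
theorem specializes_and_exists_of_notMem {w : P'.X} (hw : b.π w ∉ b.Z) :
    (∀ w', b.π w' ⤳ b.π w → w' ⤳ w) ∧ ∀ δ, δ ⤳ b.π w → ∃ w', b.π w' = δ := by
  obtain ⟨U, hwU, hU⟩ := exists_affineOpens_mem (b.π w)
    (W := ⟨(b.Z : Set P.X)ᶜ, b.Z.isClosed.isOpen_compl⟩) hw
  have hI : (Scheme.IdealSheafData.vanishingIdeal b.Z).ideal U = ⊤ :=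
    (Ideal.eq_top_iff_one _).mpr (mem_ideal_vanishingIdeal.mpr fun q hq hqZ =>
      absurd hqZ (hU hq))
  have hc : IsBlowUpChart (Scheme.IdealSheafData.vanishingIdeal b.Z) U 1 (𝟙 Γ(P.X, U.1)) := by
    refine ⟨?_, hI ▸ Submodule.mem_top, ?_, fun R ψ _ _ => ⟨ψ, Category.id_comp _⟩,
      fun R χ χ' _ hχ => by simpa using hχ⟩
    · rw [hI, Ideal.map_top, map_one, Ideal.span_singleton_one]
    · rw [map_one]
      exact one_mem _
  obtain ⟨V, hV, ι, hι, hmem⟩ := hc.exists_affineOpens b.isBlowUp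
  rw [Category.id_comp] at hι
  have hV' (w' : P'.X) (h : b.π w' ∈ U.1) : w' ∈ V.1 := by
    refine hmem w' h ?_
    rw [stalkIdeal_comap, stalkIdeal_vanishingIdeal_of_notMem (hU h), Ideal.map_top,
      map_one, map_one, Ideal.span_singleton_one]
  have hinv1 : ∀ c, ι.inv.hom (ι.hom.hom c) = c := fun c => ConcreteCategory.congr_hom ι.hom_inv_id c
  have hinv2 : ∀ c, ι.hom.hom (ι.inv.hom c) = c := fun c => ConcreteCategory.congr_hom ι.inv_hom_id c
  have hcomap (w' : P'.X) (h : w' ∈ V.1) : (primeAt V w' h).comap ι.hom.hom =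
      primeAt U (b.π w') (hV h) := by
    rw [hι, comap_appLE_primeAt]
  refine ⟨fun w' hs => ?_, fun δ hδ => ?_⟩
  · have hwU' := hs.mem_open U.1.2 hwU
    have h1 := (specializes_iff_primeAt_le hwU' hwU).mp hs
    rw [specializes_iff_primeAt_le (hV' w' hwU') (hV' w hwU)]
    intro c hc
    have h2 : ι.inv.hom c ∈ (primeAt V w' (hV' w' hwU')).comap ι.hom.hom := by
      rw [Ideal.mem_comap, hinv2]
      exact hc
    rw [hcomap] at h2
    have h3 := h1 h2
    rw [← hcomap w (hV' w hwU), Ideal.mem_comap, hinv2] at h3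
    exact h3
  · have hδU := hδ.mem_open U.1.2 hwU
    obtain ⟨w', hw', hpr⟩ := exists_primeAt_eq V ((primeAt U δ hδU).comap ι.inv.hom)
    refine ⟨w', eq_of_primeAt_eq (hη := hV hw') (hy := hδU) ?_⟩
    rw [← hcomap w' hw', hpr, Ideal.comap_comap]
    ext a
    rw [Ideal.mem_comap, RingHom.comp_apply, hinv1]

namespace IsModel

variable {U : P.X.affineOpens} {V : P'.X.affineOpens} {n : ℕ} {x : Fin n → Γ(P.X, U.1)}
  {z : Fin n → Γ(P'.X, V.1)} {s : Finset (Fin n)} {e : Fin n →₀ ℕ} {w y : P'.X}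

theorem appLE_coordinate (h : b.IsModel x z s e) (j : Fin n) : b.π.appLE U.1 V.1 h.le (x j) =
    z j * if j ∈ s then coordHom z (monomial e 1) else 1 := by
  have h1 := RingHom.congr_fun h.pushout.comm (X j)
  rw [RingHom.comp_apply, RingHom.comp_apply, blowUpHom_X, map_mul, coordHom_X, coordHom_X] at h1
  refine h1.trans ?_
  split_ifs
  · rfl
  · rw [map_one]

theorem mem_center_iff (h : b.IsModel x z s e) (hw : w ∈ V.1) :
    b.π w ∈ b.Z ↔ ∃ j, e j ≠ 0 ∧ w ∉ P'.X.basicOpen (z j) := by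
  have h1 : b.π w ∈ b.Z ↔ coordHom z (monomial e 1) ∈ primeAt V w hw := by
    rw [mem_iff_stalkIdeal_vanishingIdeal_le, primeAt, Ideal.mem_comap,
      ← Ideal.span_singleton_le_iff_mem, ← Set.image_singleton, ← Ideal.map_span, ← h.exceptional,
      ← stalkIdeal_eq _ V hw, exceptionalIdeal, stalkIdeal_comap, Ideal.map_le_iff_le_comap,
      IsLocalRing.maximalIdeal_comap]
  rw [h1]
  rcases h.exp with ⟨rfl, -⟩ | ⟨i, -, rfl⟩
  · constructor
    · intro h2
      refine absurd ((Ideal.eq_top_iff_one _).mpr ?_) (isPrime_primeAt V hw).ne_top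
      rwa [← map_one (coordHom z)]
    · rintro ⟨j, hj, -⟩
      exact absurd rfl hj
  · have h2 : coordHom z (monomial (Finsupp.single i 1) 1) = z i := coordHom_X i
    rw [h2, mem_primeAt]
    constructor
    · exact fun h3 => ⟨i, by simp, h3⟩
    · rintro ⟨j, hj, hj'⟩
      by_cases hij : i = j
      · exact hij ▸ hj'
      · exact absurd (Finsupp.single_eq_of_ne (Ne.symm hij)) hj

theorem notMem_of_notMem (h : b.IsModel x z s e) (hw : w ∈ V.1) {j : Fin n}
    (hj : w ∉ P'.X.basicOpen (z j)) : b.π w ∉ P.X.basicOpen (x j) := by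
  rw [← mem_primeAt (hx := h.le hw), ← comap_appLE_primeAt b.π h.le hw, Ideal.mem_comap]
  change b.π.appLE U.1 V.1 h.le (x j) ∈ _
  rw [h.appLE_coordinate]
  exact Ideal.mul_mem_right _ _ (mem_primeAt.mpr hj)

theorem notMem_of_notMem_center (h : b.IsModel x z s e) (hw : w ∈ V.1) (hZ : b.π w ∉ b.Z)
    {j : Fin n} (hj : b.π w ∉ P.X.basicOpen (x j)) : w ∉ P'.X.basicOpen (z j) := by
  rw [← mem_primeAt (hx := h.le hw), ← comap_appLE_primeAt b.π h.le hw, Ideal.mem_comap] at hj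
  change b.π.appLE U.1 V.1 h.le (x j) ∈ _ at hj
  rw [h.appLE_coordinate] at hj
  rw [← mem_primeAt (hx := hw)]
  refine ((isPrime_primeAt V hw).mem_or_mem hj).resolve_right fun hc => hZ ?_
  split_ifs at hc with hjs
  · rw [h.mem_center_iff hw]
    rcases h.exp with ⟨rfl, rfl⟩ | ⟨i, -, rfl⟩
    · exact absurd hjs (Finset.notMem_empty j)
    · refine ⟨i, by simp, (mem_primeAt (hx := hw)).mp ?_⟩
      have h2 : coordHom z (monomial (Finsupp.single i 1) 1) = z i := coordHom_X i
      rwa [h2] at hc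
  · exact absurd ((Ideal.eq_top_iff_one _).mpr hc) (isPrime_primeAt V hw).ne_top

theorem isGenericAt_mem_center_iff (h : b.IsModel x z s e) (hy : y ∈ V.1) {j : Fin n} {ξ : P'.X}
    (hξ : IsGenericAt z y j ξ) : b.π ξ ∈ b.Z ↔ e j ≠ 0 := by
  rw [h.mem_center_iff (hξ.specializes.mem_open V.1.2 hy)]
  constructor
  · rintro ⟨i, hi, hi'⟩
    rwa [← (hξ.notMem_iff i).mp hi']
  · exact fun hj => ⟨j, hj, (hξ.notMem_iff j).mpr rfl⟩

/-- The birational transform of a component of the boundary. -/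
theorem closure_preimage_sdiff_eq (h : b.IsModel x z s e) (hy : y ∈ V.1) {j : Fin n} {ξ : P'.X}
    (hξ : IsGenericAt z y j ξ) (hj : e j = 0) {D : IrreducibleCloseds P.X}
    (hD : ∀ q ∈ U.1, q ∈ D ↔ q ∉ P.X.basicOpen (x j)) :
    ¬ (D : Set P.X) ⊆ b.Z ∧ closure (b.π ⁻¹' ((D : Set P.X) \ b.Z)) = closure {ξ} := by
  have hξV := hξ.specializes.mem_open V.1.2 hy
  have hξZ : b.π ξ ∉ b.Z := fun hc => (h.isGenericAt_mem_center_iff hy hξ).mp hc hj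
  have hξD : b.π ξ ∈ D :=
    (hD _ (h.le hξV)).mpr (h.notMem_of_notMem hξV ((hξ.notMem_iff j).mpr rfl))
  refine ⟨fun hc => hξZ (hc hξD), (closure_minimal ?_ isClosed_closure).antisymm
    (closure_mono (Set.singleton_subset_iff.mpr ⟨hξD, hξZ⟩))⟩
  -- The generic point of `D` lifts to a generization `w` of `ξ`. The coordinate `z j` vanishes at
  -- `w`, so `ξ` specializes to `w` as well, and `w` specializes to every point over `D` outside the
  -- center.
  obtain ⟨h1, h2⟩ := specializes_and_exists_of_notMem hξZ
  have hδ := genericPoint_specializes_of_mem hξD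
  obtain ⟨w, hw⟩ := h2 _ hδ
  have hwξ : w ⤳ ξ := h1 w (hw ▸ hδ)
  have hwZ : b.π w ∉ b.Z := fun hc => hξZ ((hw ▸ hδ).mem_closed b.Z.isClosed hc)
  have hwV := hwξ.mem_open V.1.2 hξV
  have hwD : b.π w ∈ D := hw ▸ (isGenericPoint_genericPoint D).mem
  have hξw : ξ ⤳ w := hξ.specializes_of_notMem w (hwξ.trans hξ.specializes)
    (h.notMem_of_notMem_center hwV hwZ ((hD _ (h.le hwV)).mp hwD))
  rintro a ⟨haD, haZ⟩
  have h3 := (specializes_and_exists_of_notMem haZ).1 w (hw ▸ genericPoint_specializes_of_mem haD)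
  exact specializes_iff_mem_closure.mp (hξw.trans h3)

/-- The generic point of the birational transform lies outside the exceptional locus, where `x j`
and `z j` vanish together. If `e j ≠ 0`, the vanishing of `z j` would put it over the center. -/
theorem notMem_of_eq_closure (h : b.IsModel x z s e) (hy : y ∈ V.1) {j : Fin n}
    {D : IrreducibleCloseds P.X} (hD : ∀ q ∈ U.1, q ∈ D ↔ q ∉ P.X.basicOpen (x j))
    {D' : IrreducibleCloseds P'.X}
    (hD' : (D' : Set P'.X) = closure (b.π ⁻¹' ((D : Set P.X) \ b.Z))) (hyD' : y ∈ D') :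
    y ∉ P'.X.basicOpen (z j) ∧ e j = 0 := by
  have hγ := isGenericPoint_genericPoint D'
  set γ := D'.isIrreducible.genericPoint
  have hne : (b.π ⁻¹' ((D : Set P.X) \ b.Z)).Nonempty := by
    rw [← closure_nonempty_iff, ← hD']
    exact ⟨y, hyD'⟩
  obtain ⟨a, haD, haZ⟩ := hne
  have haD' : a ∈ (D' : Set P'.X) := hD' ▸ subset_closure ⟨haD, haZ⟩
  have hγa : γ ⤳ a := genericPoint_specializes_of_mem haD'
  have hγZ : b.π γ ∉ b.Z := fun hc =>
    haZ ((hγa.map b.π.continuous).mem_closed b.Z.isClosed hc)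
  have hγD : b.π γ ∈ D := by
    have h1 : (D' : Set P'.X) ⊆ b.π ⁻¹' (D : Set P.X) := by
      rw [hD']
      exact closure_minimal (fun _ h => h.1) (D.isClosed.preimage b.π.continuous)
    exact h1 hγ.mem
  have hγy : γ ⤳ y := genericPoint_specializes_of_mem hyD'
  have hγV := hγy.mem_open V.1.2 hy
  have hγj := h.notMem_of_notMem_center hγV hγZ ((hD _ (h.le hγV)).mp hγD)
  refine ⟨fun hc => hγj (hγy.mem_open (P'.X.basicOpen (z j)).2 hc), ?_⟩
  by_contra hj
  exact hγZ ((h.mem_center_iff hγV).mpr ⟨j, hj, hγj⟩)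

theorem mem_center_iff_of_ne_zero (h : b.IsModel x z s e) {j : Fin n} (hj : e j ≠ 0)
    (hw : w ∈ V.1) : b.π w ∈ b.Z ↔ w ∉ P'.X.basicOpen (z j) := by
  rw [h.mem_center_iff hw]
  refine ⟨?_, fun h => ⟨j, hj, h⟩⟩
  rintro ⟨i, hi, hi'⟩
  rcases h.exp with ⟨rfl, -⟩ | ⟨l, -, rfl⟩
  · exact absurd rfl hj
  · have h1 : l = j := by
      by_contra hc
      exact hj (Finsupp.single_eq_of_ne (Ne.symm hc))
    have h2 : l = i := by
      by_contra hc
      exact hi (Finsupp.single_eq_of_ne (Ne.symm hc))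
    rwa [← h1, h2]

/-- On `V` the preimage of the center is `(z_j = 0)`. A larger irreducible set has a generic point
that generizes `y` and at which `z j` vanishes, so `ξ` specializes to it. -/
theorem maximal_closure (h : b.IsModel x z s e) (hy : y ∈ V.1) {j : Fin n} {ξ : P'.X}
    (hξ : IsGenericAt z y j ξ) (hj : e j ≠ 0) :
    Maximal (fun E : IrreducibleCloseds P'.X => (E : Set P'.X) ⊆ b.π ⁻¹' (b.Z : Set P.X))
      ⟨closure {ξ}, isIrreducible_singleton.closure, isClosed_closure⟩ := by
  have hξZ := (h.isGenericAt_mem_center_iff hy hξ).mpr hj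
  refine ⟨closure_minimal (Set.singleton_subset_iff.mpr hξZ)
    (b.Z.isClosed.preimage b.π.continuous), fun E hE hle => ?_⟩
  have hξE : ξ ∈ E := hle (subset_closure rfl)
  have hε := (genericPoint_specializes_of_mem hξE).trans hξ.specializes
  have hεZ : b.π E.isIrreducible.genericPoint ∈ b.Z := hE (isGenericPoint_genericPoint E).mem
  have h1 := hξ.specializes_of_notMem _ hε
    ((h.mem_center_iff_of_ne_zero hj (hε.mem_open V.1.2 hy)).mp hεZ)
  intro a ha
  exact specializes_iff_mem_closure.mp (h1.trans (genericPoint_specializes_of_mem ha))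

theorem exists_ne_zero_of_maximal (h : b.IsModel x z s e) (hy : y ∈ V.1)
    {E : IrreducibleCloseds P'.X} (hE : (E : Set P'.X) ⊆ b.π ⁻¹' (b.Z : Set P.X)) (hyE : y ∈ E) :
    ∃ j, e j ≠ 0 ∧ y ∉ P'.X.basicOpen (z j) ∧ ∀ ξ, IsGenericAt z y j ξ → (E : Set P'.X) ⊆ closure {ξ} := by
  obtain ⟨j, hj, hyj⟩ := (h.mem_center_iff hy).mp (hE hyE)
  refine ⟨j, hj, hyj, fun ξ hξ a ha => ?_⟩
  have hε := genericPoint_specializes_of_mem hyE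
  have hεZ : b.π E.isIrreducible.genericPoint ∈ b.Z := hE (isGenericPoint_genericPoint E).mem
  have h1 := hξ.specializes_of_notMem _ hε
    ((h.mem_center_iff_of_ne_zero hj (hε.mem_open V.1.2 hy)).mp hεZ)
  exact specializes_iff_mem_closure.mp (h1.trans (genericPoint_specializes_of_mem ha))

end IsModel

end PairBlowUp

end Toroidal

/-! ### The blow-up of a toroidal center is locally snc -/

namespace Toroidal

variable {k : Type u} [Field k]

open LogPair MvPolynomial

namespace PairBlowUp

variable {P P' : LogPair k} {b : PairBlowUp P P'}

namespace IsModel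

variable {U : P.X.affineOpens} {V : P'.X.affineOpens} {n : ℕ} {x : Fin n → Γ(P.X, U.1)}
  {z : Fin n → Γ(P'.X, V.1)} {s : Finset (Fin n)} {e : Fin n →₀ ℕ} {w y : P'.X}

/-- The components of the boundary of a blow-up through a point are coordinate hyperplanes. -/
theorem mem_boundary_iff (h : b.IsModel x z s e) (hx : IsChart x (b.π y)) (hy : y ∈ V.1)
    (he : ∀ j ∉ faces x (b.π y), e j = 0) {ξ : Fin n → P'.X}
    (hξ : ∀ j, y ∉ P'.X.basicOpen (z j) → IsGenericAt z y j (ξ j)) (D' : IrreducibleCloseds P'.X) :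
    D' ∈ P'.Δ ∧ y ∈ D' ↔ ∃ j ∈ faces x (b.π y), y ∉ P'.X.basicOpen (z j) ∧
      (D' : Set P'.X) = closure {ξ j} := by
  rw [b.mem_Δ_iff]
  constructor
  · rintro ⟨⟨D, hD, -, hD'⟩ | hD', hyD'⟩
    · have hyD : b.π y ∈ D := by
        have h1 : (D' : Set P'.X) ⊆ b.π ⁻¹' (D : Set P.X) := by
          rw [hD']
          exact closure_minimal (fun _ h => h.1) (D.isClosed.preimage b.π.continuous)
        exact h1 hyD'
      obtain ⟨j, hj⟩ := hx.adapted D hD hyD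
      obtain ⟨hyj, hej⟩ := h.notMem_of_eq_closure hy hj hD' hyD'
      exact ⟨j, mem_faces.mpr ⟨D, hD, hyD, hj⟩, hyj,
        hD'.trans (h.closure_preimage_sdiff_eq hy (hξ j hyj) hej hj).2⟩
    · obtain ⟨j, hej, hyj, hle⟩ := h.exists_ne_zero_of_maximal hy hD'.1 hyD'
      have hjf : j ∈ faces x (b.π y) := by
        by_contra hc
        exact hej (he j hc)
      exact ⟨j, hjf, hyj, (hle _ (hξ j hyj)).antisymm
        (hD'.2 (h.maximal_closure hy (hξ j hyj) hej).1 (hle _ (hξ j hyj)))⟩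
  · rintro ⟨j, hjf, hyj, hD'⟩
    have hyD' : y ∈ (D' : Set P'.X) := by
      rw [hD']
      exact specializes_iff_mem_closure.mp (hξ j hyj).specializes
    refine ⟨?_, hyD'⟩
    by_cases hej : e j = 0
    · left
      obtain ⟨D, hD, -, hj⟩ := mem_faces.mp hjf
      obtain ⟨h1, h2⟩ := h.closure_preimage_sdiff_eq hy (hξ j hyj) hej hj
      exact ⟨D, hD, h1, hD'.trans h2.symm⟩
    · right
      have h1 := h.maximal_closure hy (hξ j hyj) hej
      rwa [← show D' = ⟨closure {ξ j}, isIrreducible_singleton.closure, isClosed_closure⟩ from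
        IrreducibleCloseds.ext hD'] at h1

/-- After shrinking `V`, each hypersurface through `y` coincides with its branch at `y`, and
`mem_boundary_iff` says which of these are boundary components. -/
theorem exists_isChart (h : b.IsModel x z s e) (hx : IsChart x (b.π y)) (hy : y ∈ V.1)
    (he : ∀ j ∉ faces x (b.π y), e j = 0) : ∃ (V' : P'.X.affineOpens) (hV : V'.1 ≤ V.1),
      IsChart (fun j => P'.X.presheaf.map (homOfLE hV).op (z j)) y ∧
      ∀ j, j ∈ faces (fun j => P'.X.presheaf.map (homOfLE hV).op (z j)) y ↔
        j ∈ faces x (b.π y) ∧ y ∉ P'.X.basicOpen (z j) := by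
  have h1 (j : Fin n) : ∃ ξ, ∃ O : P'.X.Opens, y ∈ O ∧ (y ∉ P'.X.basicOpen (z j) →
      IsGenericAt z y j ξ ∧ ∀ q ∈ O, q ∈ V.1 → (q ∈ closure {ξ} ↔ q ∉ P'.X.basicOpen (z j))) := by
    by_cases hj : y ∉ P'.X.basicOpen (z j)
    · obtain ⟨ξ, h1, O, h2, h3⟩ := h.etale.exists_isGenericAt hy hj
      exact ⟨ξ, O, h2, fun _ => ⟨h1, h3⟩⟩
    · exact ⟨y, ⊤, trivial, fun hc => absurd hc hj⟩
  choose ξ O hyO hξ using h1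
  have hyO' : y ∈ Finset.univ.inf O := by
    rw [← SetLike.mem_coe, Opens.coe_finset_inf, Finset.inf_eq_iInf]
    simpa using hyO
  obtain ⟨V', hV, hVO, hyV', hc⟩ := h.etale.exists_res hy hyO'
  have hcl (j) (hj : y ∉ P'.X.basicOpen (z j)) (q) (hq : q ∈ V'.1) : q ∈ closure {ξ j} ↔
      q ∉ P'.X.basicOpen (P'.X.presheaf.map (homOfLE hV).op (z j)) := by
    rw [mem_basicOpen_res hV _ hq]
    exact (hξ j hj).2 q (Finset.inf_le (f := O) (Finset.mem_univ j) (hVO hq)) (hV hq)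
  have hΔ := h.mem_boundary_iff hx hy he fun j hj => (hξ j hj).1
  refine ⟨V', hV, ⟨hyV', hc, fun D' hD' hyD' => ?_⟩, fun j => ?_⟩
  · obtain ⟨j, -, hyj, hj⟩ := (hΔ D').mp ⟨hD', hyD'⟩
    refine ⟨j, fun q hq => ?_⟩
    rw [← hcl j hyj q hq, ← hj]
    rfl
  · rw [mem_faces]
    constructor
    · rintro ⟨D', hD', hyD', hj⟩
      obtain ⟨i, hi, hyi, hD'i⟩ := (hΔ D').mp ⟨hD', hyD'⟩
      have hξi := (hξ i hyi).1
      have hξD' : ξ i ∈ D' := by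
        rw [← SetLike.mem_coe, hD'i]
        exact subset_closure rfl
      have hξV := hξi.specializes.mem_open V'.1.2 hyV'
      have h2 := (hj _ hξV).mp hξD'
      rw [mem_basicOpen_res hV _ hξV, hξi.notMem_iff] at h2
      exact h2 ▸ ⟨hi, hyi⟩
    · rintro ⟨hjf, hyj⟩
      obtain ⟨hD', hyD'⟩ := (hΔ ⟨closure {ξ j}, isIrreducible_singleton.closure,
        isClosed_closure⟩).mpr ⟨j, hjf, hyj, rfl⟩
      exact ⟨_, hD', hyD', hcl j hyj⟩

end IsModel

/-- Charts at a point of a blow-up and at its image, in which the blow-up is monomial. -/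
structure IsFrame (b : PairBlowUp P P') {U : P.X.affineOpens} {V : P'.X.affineOpens} {n : ℕ}
    (x : Fin n → Γ(P.X, U.1)) (z : Fin n → Γ(P'.X, V.1)) (s : Finset (Fin n)) (e : Fin n →₀ ℕ)
    (y : P'.X) : Prop where
  chart : IsChart x (b.π y)
  chart' : IsChart z y
  subset : s ⊆ faces x (b.π y)
  faces_subset : faces z y ⊆ faces x (b.π y)
  exp_support : ∀ j ∉ faces z y, e j = 0
  isUnit : ∀ j ∈ faces x (b.π y), j ∉ faces z y → IsUnit (coordStalk z chart'.mem (X j))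
  comp : (b.π.stalkMap y).hom.comp (coordStalk x chart.mem) =
    (coordStalk z chart'.mem).comp (blowUpHom k s e)
  exceptional : stalkIdeal b.exceptionalIdeal y =
    Ideal.span {coordStalk z chart'.mem (monomial e 1)}
  comap_le : ∀ V, IsUpperOn (faces z y) V →
    ((monomialIdeal k V).map (coordStalk z chart'.mem)).comap (b.π.stalkMap y).hom ≤
      (monomialIdeal k (blowUpExp s e ⁻¹' V)).map (coordStalk x chart.mem)

/-- `E` arises from the sections over `V` by inverting functions from below that are units at `b.π
y`. Thus `w` times such a function comes from a section over `V`, for which membership at `y`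
supplies a further denominator `t`. -/
theorem IsModel.exists_mul_mem {U : P.X.affineOpens} {V : P'.X.affineOpens} {n : ℕ}
    {x : Fin n → Γ(P.X, U.1)} {z : Fin n → Γ(P'.X, V.1)} {s : Finset (Fin n)} {e : Fin n →₀ ℕ}
    {y : P'.X} (h : b.IsModel x z s e) (hx : b.π y ∈ U.1) (hy : y ∈ V.1) {E : CommRingCat.{u}}
    {α : P.X.presheaf.stalk (b.π y) →+* E} {ω : MvPolynomial (Fin n) k →+* E}
    (hE : IsRingPushout (coordStalk x hx) (blowUpHom k s e) α ω)
    {Θ : E →+* P'.X.presheaf.stalk y} (hα : Θ.comp α = (b.π.stalkMap y).hom)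
    (hω : Θ.comp ω = coordStalk z hy) (T : Finset (Fin n)) (w : E)
    (hw : Θ w ∈ (monomialIdeal k (posOn T)).map (coordStalk z hy)) :
    ∃ v, IsUnit (Θ v) ∧ v * w ∈ (monomialIdeal k (posOn T)).map ω := by
  have hgerm := stalkMap_germ_appLE b.π h.le y hy hx
  obtain ⟨κ, hκ1, hκ2⟩ := h.pushout.exists_lift E (α.comp (P.X.presheaf.germ U.1 _ hx).hom) ω (by
    rw [← hE.comm, RingHom.comp_assoc]; rfl)
  have hκφ (a : Γ(P.X, U.1)) : α (P.X.presheaf.germ U.1 _ hx a) =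
      κ ((b.π.appLE U.1 V.1 h.le).hom a) := (RingHom.congr_fun hκ1 a).symm
  have hΘκ : Θ.comp κ = (P'.X.presheaf.germ V.1 y hy).hom := by
    refine h.pushout.hom_ext _ _ _ ?_ ?_
    · rw [RingHom.comp_assoc, hκ1, ← RingHom.comp_assoc, hα, hgerm]
    · rw [RingHom.comp_assoc, hκ2, hω]
      rfl
  have hnum : ∃ a : Γ(P.X, U.1), IsUnit (P.X.presheaf.germ U.1 _ hx a) ∧
      ∃ c, α (P.X.presheaf.germ U.1 _ hx a) * w = κ c := by
    refine hE.induction (fun w => ∃ a : Γ(P.X, U.1), IsUnit (P.X.presheaf.germ U.1 _ hx a) ∧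
      ∃ c, α (P.X.presheaf.germ U.1 _ hx a) * w = κ c) (fun g p => ?_) ?_ w
    · obtain ⟨a, t, ht, hta⟩ := exists_germ_mul_eq U hx g
      refine ⟨t, (P.X.mem_basicOpen _ _ hx).mp ht,
        (b.π.appLE U.1 V.1 h.le).hom a * coordHom z p, ?_⟩
      rw [map_mul, ← hκφ, ← hta, ← hκ2, map_mul, RingHom.comp_apply]
      ring
    · rintro w₁ w₂ ⟨a₁, ha₁, c₁, hc₁⟩ ⟨a₂, ha₂, c₂, hc₂⟩
      refine ⟨a₁ * a₂, by rw [map_mul]; exact ha₁.mul ha₂,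
        (b.π.appLE U.1 V.1 h.le).hom a₂ * c₁ + (b.π.appLE U.1 V.1 h.le).hom a₁ * c₂, ?_⟩
      rw [map_mul, map_mul, map_add, map_mul, map_mul, ← hc₁, ← hc₂, ← hκφ, ← hκφ]
      ring
  obtain ⟨a, ha, c, hc⟩ := hnum
  have hΘc : P'.X.presheaf.germ V.1 y hy c ∈
      ((monomialIdeal k (posOn T)).map (coordHom z)).map (P'.X.presheaf.germ V.1 y hy).hom := by
    have h1 : P'.X.presheaf.germ V.1 y hy c = Θ (κ c) := (RingHom.congr_fun hΘκ c).symm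
    rw [h1, ← hc, map_mul, Ideal.map_map]
    exact Ideal.mul_mem_left _ _ hw
  obtain ⟨t, ht, htc⟩ := germ_mem_map_iff.mp hΘc
  refine ⟨κ t * α (P.X.presheaf.germ U.1 _ hx a), ?_, ?_⟩
  · rw [map_mul, ← RingHom.comp_apply, hΘκ]
    refine ((P'.X.mem_basicOpen _ _ hy).mp ht).mul ?_
    rw [← RingHom.comp_apply, hα]
    exact ha.map _
  · rw [mul_assoc, hc, ← map_mul, ← hκ2, ← Ideal.map_map]
    exact Ideal.mem_map_of_mem _ htc

theorem coordStalk_res {U V : P.X.affineOpens} {n : ℕ} (x : Fin n → Γ(P.X, U.1)) (h : V.1 ≤ U.1)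
    {y : P.X} (hy : y ∈ V.1) : coordStalk (fun j => P.X.presheaf.map (homOfLE h).op (x j)) hy =
      coordStalk x (h hy) := by
  rw [coordStalk, coordHom_res, ← RingHom.comp_assoc, germ_res_comp]
  rfl

theorem exists_isFrame (hP : P.IsLocallySnc) (hZ : P.IsToroidalCenter b.Z) (y : P'.X) :
    ∃ (U : P.X.affineOpens) (n : ℕ) (x : Fin n → Γ(P.X, U.1)) (V : P'.X.affineOpens)
      (z : Fin n → Γ(P'.X, V.1)) (s : Finset (Fin n)) (e : Fin n →₀ ℕ), b.IsFrame x z s e y := by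
  obtain ⟨U, n, x, 𝒱, hx, -, hcov, h𝒱⟩ := exists_finite_isModel hP hZ (b.π y)
  obtain ⟨V, hV, hy⟩ := hcov y hx.mem
  obtain ⟨z, s, e, h, hs, he⟩ := h𝒱 V hV
  obtain ⟨V', hV, hc, hf⟩ := h.exists_isChart hx hy fun j hj => by
    by_contra hne
    exact hj (he j hne).1
  obtain ⟨z', hz'⟩ : ∃ z' : Fin n → Γ(P'.X, V'.1),
    z' = fun j => P'.X.presheaf.map (homOfLE hV).op (z j) := ⟨_, rfl⟩
  rw [← hz'] at hc hf
  have hcoord : coordStalk z' hc.mem = coordStalk z hy := by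
    subst hz'
    exact coordStalk_res z hV hc.mem
  have hsub : faces z' y ⊆ faces x (b.π y) := fun j hj => ((hf j).mp hj).1
  have he0 : ∀ j ∈ s, e j = 0 := by
    intro j hj
    rcases h.exp with ⟨rfl, -⟩ | ⟨i, hi, rfl⟩
    · rfl
    · exact Finsupp.single_eq_of_ne fun hc => hi (hc ▸ hj)
  -- A coordinate that occurs in `e` cuts out the exceptional divisor, and `he` says that it can
  -- occur only if `b.π y` lies in the center.
  have hsupp : ∀ j, e j ≠ 0 → j ∈ faces z' y := fun j hj =>
    (hf j).mpr ⟨(he j hj).1, (h.mem_center_iff_of_ne_zero hj hy).mp (he j hj).2⟩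
  have hpos : s.Nonempty → e ∈ posOn (faces z' y) := by
    intro hs
    rcases h.exp with ⟨-, rfl⟩ | ⟨i, hi, rfl⟩
    · exact absurd hs Finset.not_nonempty_empty
    · exact ⟨i, hsupp i (by simp), by simp⟩
  have hcomp : (b.π.stalkMap y).hom.comp (coordStalk x hx.mem) =
      (coordStalk z hy).comp (blowUpHom k s e) := by
    rw [coordStalk, ← RingHom.comp_assoc, stalkMap_germ_appLE b.π h.le y hy hx.mem,
      RingHom.comp_assoc, h.pushout.comm]
    rfl
  have hF := hc.isToricFrame
  refine ⟨U, n, x, V', z', s, e, hx, hc, hs, hsub, fun j hj => ?_, fun j hj hj' => ?_,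
    ?_, ?_, fun W hW => ?_⟩
  · by_contra hne
    exact hj (hsupp j hne)
  · rw [hcoord, coordStalk_X]
    refine (P'.X.mem_basicOpen _ _ hy).mp ?_
    by_contra hn
    exact hj' ((hf j).mpr ⟨hj, hn⟩)
  · rw [hcoord, hcomp]
  · rw [hcoord, stalkIdeal_eq _ V hy, h.exceptional, Ideal.map_span, Set.image_singleton]
    rfl
  · refine comap_map_monomialIdeal_blowUp hx.isToricFrame hF.flat (by rw [hcoord, hcomp]) hs hsub
      he0 hpos (hF.prime _ subset_rfl).ne_top (fun E α ω hE Θ hα hω w hw => ?_) hW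
    rw [hcoord] at hω hw
    exact h.exists_mul_mem hx.mem hy hE hα hω _ w hw

theorem isLocallySnc (b : PairBlowUp P P') (hP : P.IsLocallySnc) (hZ : P.IsToroidalCenter b.Z) :
    P'.IsLocallySnc where
  compactSpace := by
    have := hP.compactSpace
    have key (q : P.X) : ∃ U : P.X.affineOpens, q ∈ U.1 ∧ ∃ 𝒱 : Set P'.X.affineOpens, 𝒱.Finite ∧
        ∀ w, b.π w ∈ U.1 → ∃ V ∈ 𝒱, w ∈ V.1 := by
      obtain ⟨U, n, x, 𝒱, hx, hfin, hcov, -⟩ := exists_finite_isModel hP hZ q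
      exact ⟨U, hx.mem, 𝒱, hfin, hcov⟩
    choose U hqU 𝒱 hfin hcov using key
    obtain ⟨t, ht⟩ := isCompact_univ.elim_finite_subcover (fun q => ((U q).1 : Set P.X))
      (fun q => (U q).1.2) fun q _ => Set.mem_iUnion.mpr ⟨q, hqU q⟩
    have hcpt : IsCompact (⋃ q ∈ t, ⋃ V ∈ 𝒱 q, (V.1 : Set P'.X)) :=
      t.isCompact_biUnion fun q _ => (hfin q).isCompact_biUnion fun V _ => V.2.isCompact
    refine ⟨hcpt.of_isClosed_subset isClosed_univ fun w _ => ?_⟩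
    obtain ⟨q, hq, hwq⟩ := Set.mem_iUnion₂.mp (ht (Set.mem_univ (b.π w)))
    obtain ⟨V, hV, hwV⟩ := hcov q w hwq
    exact Set.mem_iUnion₂.mpr ⟨q, hq, Set.mem_iUnion₂.mpr ⟨V, hV, hwV⟩⟩
  exists_coordinates y := by
    obtain ⟨U, n, x, V, z, s, e, h⟩ := exists_isFrame hP hZ y
    exact ⟨V, n, z, h.chart'.mem, h.chart'.etale, h.chart'.adapted⟩

end PairBlowUp

end Toroidal

/-! ### Division by an effective Cartier divisor -/

namespace Toroidal

/-- Finite generation of `J` lets a product of denominators, one for each generator, do for all of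
`J`. -/
theorem map_colon_of_isLocalization {R S : Type*} [CommRing R] [CommRing S] [Algebra R S]
    (M : Submonoid R) [IsLocalization M S] (I : Ideal R) {J : Ideal R} (hJ : J.FG) :
    (I.colon (J : Set R)).map (algebraMap R S) =
      (I.map (algebraMap R S)).colon (J.map (algebraMap R S) : Set S) := by
  apply le_antisymm
  · rw [Ideal.map_le_iff_le_comap]
    intro a ha
    rw [Ideal.mem_comap, Submodule.mem_colon]
    intro t ht
    have h1 : Ideal.map (algebraMap R S) J ≤
        (I.map (algebraMap R S)).colon {algebraMap R S a} := by
      rw [Ideal.map_le_iff_le_comap]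
      intro g hg
      rw [Ideal.mem_comap, Submodule.mem_colon_singleton, smul_eq_mul, ← map_mul, mul_comm]
      exact Ideal.mem_map_of_mem _ (Submodule.mem_colon.mp ha g hg)
    have h2 := Submodule.mem_colon_singleton.mp (h1 ht)
    rwa [smul_eq_mul, mul_comm] at h2
  · intro c hc
    obtain ⟨a, m, rfl⟩ := IsLocalization.exists_mk'_eq M c
    obtain ⟨G, hG⟩ := hJ
    have h1 : ∀ g ∈ G, ∃ t ∈ M, t * (a * g) ∈ I := by
      intro g hg
      rw [← IsLocalization.algebraMap_mem_map_algebraMap_iff M S, map_mul,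
        ← IsLocalization.mk'_spec S a m, mul_right_comm]
      exact Ideal.mul_mem_right _ _ (Submodule.mem_colon.mp hc _
        (Ideal.mem_map_of_mem _ (hG ▸ Submodule.subset_span hg)))
    choose! t ht htI using h1
    have h2 : (∏ g ∈ G, t g) * a ∈ I.colon (J : Set R) := by
      rw [Submodule.mem_colon]
      intro g hg
      have h3 : J ≤ I.colon {(∏ g ∈ G, t g) * a} := by
        rw [← hG]
        refine Submodule.span_le.mpr fun g hg => Submodule.mem_colon_singleton.mpr ?_
        obtain ⟨r, hr⟩ := Finset.dvd_prod_of_mem t hg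
        rw [smul_eq_mul, hr, show g * (t g * r * a) = r * (t g * (a * g)) by ring]
        exact Ideal.mul_mem_left _ _ (htI g hg)
      have h4 := Submodule.mem_colon_singleton.mp (h3 hg)
      rwa [smul_eq_mul, mul_comm] at h4
    have h5 := Ideal.mem_map_of_mem (algebraMap R S) h2
    rw [map_mul] at h5
    have h6 : IsUnit (algebraMap R S (∏ g ∈ G, t g)) :=
      IsLocalization.map_units S (⟨_, Submonoid.prod_mem M ht⟩ : M)
    rw [Ideal.unit_mul_mem_iff_mem _ h6, ← IsLocalization.mk'_spec S a m,
      Ideal.mul_unit_mem_iff_mem _ (IsLocalization.map_units S m)] at h5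
    exact h5

variable {X : Scheme.{u}}

theorem colon_map_basicOpen [IsLocallyNoetherian X] (K M : X.IdealSheafData) (U : X.affineOpens)
    (f : Γ(X, U.1)) : ((K.ideal U).colon (M.ideal U : Set Γ(X, U.1))).map
      (X.presheaf.map (homOfLE (X.basicOpen_le f)).op).hom =
      (K.ideal (X.affineBasicOpen f)).colon (M.ideal (X.affineBasicOpen f) : Set _) := by
  have hU : IsAffineOpen U.1 := U.2
  let := (X.presheaf.map (homOfLE (X.basicOpen_le f)).op).hom.toAlgebra
  have hloc : IsLocalization.Away f Γ(X, X.basicOpen f) := hU.isLocalization_basicOpen f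
  have : IsNoetherianRing Γ(X, U.1) := IsLocallyNoetherian.component_noetherian U
  rw [← K.map_ideal_basicOpen, ← M.map_ideal_basicOpen]
  exact map_colon_of_isLocalization (S := Γ(X, X.basicOpen f)) (Submonoid.powers f) (K.ideal U)
    (IsNoetherian.noetherian (M.ideal U))

/-- The ideal sheaf of all functions that multiply `M` into `K`. -/
noncomputable def colonIdeal [IsLocallyNoetherian X] (K M : X.IdealSheafData) :
    X.IdealSheafData where
  ideal U := (K.ideal U).colon (M.ideal U : Set Γ(X, U.1))
  map_ideal_basicOpen U f := colon_map_basicOpen K M U f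

theorem IsCartier.pow {E : X.IdealSheafData} (hE : IsCartier E) (m : ℕ) : IsCartier (E ^ m) := by
  intro x
  obtain ⟨U, hxU, a, ha, hU⟩ := hE x
  refine ⟨U, hxU, a ^ m, pow_mem ha m, ?_⟩
  rw [← Ideal.span_singleton_pow, ← hU]
  rfl

theorem IsCartier.exists_stalkIdeal {E : X.IdealSheafData} (hE : IsCartier E) (x : X) :
    ∃ a ∈ nonZeroDivisors (X.presheaf.stalk x), stalkIdeal E x = Ideal.span {a} := by
  obtain ⟨U, hxU, a, ha, hU⟩ := hE x
  refine ⟨X.presheaf.germ U.1 x hxU a, map_mem_nonZeroDivisors_of_flat (flat_germ U hxU) ha, ?_⟩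
  rw [stalkIdeal_eq _ U hxU, hU, Ideal.map_span, Set.image_singleton]

theorem IsCartier.le_of_mul_le_mul {E K L : X.IdealSheafData} (hE : IsCartier E)
    (h : E * K ≤ E * L) : K ≤ L := by
  rw [le_iff_stalkIdeal_le] at h ⊢
  intro x
  obtain ⟨a, ha, hEx⟩ := hE.exists_stalkIdeal x
  have h1 := h x
  rw [stalkIdeal_mul, stalkIdeal_mul, hEx] at h1
  intro t ht
  obtain ⟨u, hu, htu⟩ := Ideal.mem_span_singleton_mul.mp
    (h1 (Ideal.mul_mem_mul (Ideal.mem_span_singleton_self a) ht))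
  have h2 : (u - t) * a = 0 := by rw [sub_mul, mul_comm u, htu, mul_comm, sub_self]
  rwa [← sub_eq_zero.mp (mem_nonZeroDivisors_iff_right.mp ha _ h2)]

/-- The quotient is the colon ideal, which locally is division by a generator of `E`. -/
theorem IsCartier.exists_mul_eq [IsLocallyNoetherian X] {E K : X.IdealSheafData} (hE : IsCartier E)
    (h : K ≤ E) : ∃ L, E * L = K := by
  refine ⟨colonIdeal K E, ext_stalkIdeal fun x => ?_⟩
  obtain ⟨U, hxU, a, ha, hU⟩ := hE x
  rw [stalkIdeal_mul, stalkIdeal_eq _ U hxU, stalkIdeal_eq _ U hxU, stalkIdeal_eq _ U hxU,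
    ← Ideal.map_mul]
  congr 1
  change E.ideal U * (K.ideal U).colon (E.ideal U : Set Γ(X, U.1)) = K.ideal U
  have hKU : K.ideal U ≤ E.ideal U := h U
  rw [hU] at hKU ⊢
  apply le_antisymm
  · rw [Ideal.mul_le]
    intro r hr t ht
    rw [mul_comm]
    exact Submodule.mem_colon.mp ht r hr
  · intro t ht
    obtain ⟨c, rfl⟩ := Ideal.mem_span_singleton.mp (hKU ht)
    refine Ideal.mul_mem_mul (Ideal.mem_span_singleton_self a) (Submodule.mem_colon.mpr fun r hr => ?_)
    obtain ⟨d, rfl⟩ := Ideal.mem_span_singleton.mp hr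
    rw [smul_eq_mul, show c * (a * d) = d * (a * c) by ring]
    exact Ideal.mul_mem_left _ _ ht

end Toroidal

/-! ### Birational transforms of toroidal ideal sheaves -/

namespace Toroidal

variable {k : Type u} [Field k]

open LogPair MvPolynomial

theorem map_monomial_dvd {σ O : Type*} [CommRing O] {ψ : MvPolynomial σ k →+* O} {F : Finset σ}
    {a c : σ →₀ ℕ} (hu : ∀ j ∉ F, a j ≠ 0 → IsUnit (ψ (X j))) (hac : ∀ j ∈ F, a j ≤ c j) :
    ψ (monomial a 1) ∣ ψ (monomial c 1) := by
  classical
  have h1 : a.filter (· ∈ F) ≤ c := by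
    intro j
    by_cases hj : j ∈ F
    · rw [Finsupp.filter_apply_pos _ _ hj]
      exact hac j hj
    · rw [Finsupp.filter_apply_neg _ _ hj]
      exact Nat.zero_le _
  have h2 : IsUnit (ψ (monomial (a.filter (¬ · ∈ F)) 1)) := by
    rw [monomial_eq, map_mul, C_1, map_one, one_mul, Finsupp.prod, map_prod, IsUnit.prod_iff]
    intro j hj
    rw [map_pow]
    rw [Finsupp.support_filter, Finset.mem_filter, Finsupp.mem_support_iff] at hj
    exact (hu j hj.2 hj.1).pow _
  obtain ⟨d, hd⟩ := exists_add_of_le h1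
  rw [← Finsupp.filter_add_filter_not a (· ∈ F), monomial_add_one, map_mul, h2.mul_right_dvd,
    hd, monomial_add_one, map_mul]
  exact dvd_mul_right _ _

namespace LogPair

variable {P : LogPair k}

theorem IsMonomialAt.mul {y : P.X} {𝔞 𝔠 : Ideal (P.X.presheaf.stalk y)} (h𝔞 : P.IsMonomialAt y 𝔞)
    (h𝔠 : P.IsMonomialAt y 𝔠) : P.IsMonomialAt y (𝔞 * 𝔠) := by
  obtain ⟨M, rfl⟩ := h𝔞
  obtain ⟨N, rfl⟩ := h𝔠
  have h1 (m n : IrreducibleCloseds P.X → ℕ) : stalkIdeal (P.divisorIdeal (m + n)) y =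
      stalkIdeal (P.divisorIdeal m) y * stalkIdeal (P.divisorIdeal n) y := by
    rw [← stalkIdeal_mul, divisorIdeal, divisorIdeal, divisorIdeal, ← Finset.prod_mul_distrib]
    simp only [Pi.add_apply, pow_add]
  refine ⟨Set.image2 (· + ·) M N, ?_⟩
  rw [iSup_image2]
  simp only [Ideal.iSup_mul]
  simp only [h1, Ideal.mul_iSup]

theorem IsLocallySnc.isToroidal_mul (hP : P.IsLocallySnc) {I K : P.X.IdealSheafData}
    (hI : P.IsToroidal I) (hK : P.IsToroidal K) : P.IsToroidal (I * K) := by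
  rw [hP.isToroidal_iff] at hI hK ⊢
  intro y
  rw [stalkIdeal_mul]
  exact (hI y).mul (hK y)

theorem IsLocallySnc.isToroidal_toroidalHull (hP : P.IsLocallySnc) (J : P.X.IdealSheafData) :
    P.IsToroidal (P.toroidalHull J) :=
  (hP.isLeast_toroidalHull J).1.1

theorem IsLocallySnc.le_toroidalHull (hP : P.IsLocallySnc) (J : P.X.IdealSheafData) :
    J ≤ P.toroidalHull J :=
  (hP.isLeast_toroidalHull J).1.2

theorem IsLocallySnc.toroidalHull_le (hP : P.IsLocallySnc) {I J : P.X.IdealSheafData}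
    (hI : P.IsToroidal I) (h : J ≤ I) : P.toroidalHull J ≤ I :=
  (hP.isLeast_toroidalHull J).2 ⟨hI, h⟩

end LogPair

/-! ### Pull-back, division and hulls under a toroidal blow-up -/

namespace PairBlowUp

variable {P P' : LogPair k} {b : PairBlowUp P P'}

namespace IsFrame

variable {U : P.X.affineOpens} {V : P'.X.affineOpens} {n : ℕ} {x : Fin n → Γ(P.X, U.1)}
  {z : Fin n → Γ(P'.X, V.1)} {s : Finset (Fin n)} {e : Fin n →₀ ℕ} {y : P'.X}

/-- Coordinates of faces below that do not vanish at `y` become units above, so only exponents along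
`faces z y` matter. -/
theorem isMonomialAt_map (h : b.IsFrame x z s e y) {𝔠 : Ideal (P.X.presheaf.stalk (b.π y))}
    (h𝔠 : P.IsMonomialAt (b.π y) 𝔠) : P'.IsMonomialAt y (𝔠.map (b.π.stalkMap y).hom) := by
  classical
  obtain ⟨W, hW, rfl⟩ := h.chart.isMonomialAt_iff.mp h𝔠
  refine h.chart'.isMonomialAt_iff.mpr
    ⟨{c | ∃ a ∈ W, ∀ j ∈ faces z y, blowUpExp s e a j ≤ c j}, ?_, ?_⟩
  · rintro c ⟨a, ha, hac⟩ d hcd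
    exact ⟨a, ha, fun j hj => (hac j hj).trans (hcd j hj)⟩
  · have hmon (a : Fin n →₀ ℕ) : b.π.stalkMap y (coordStalk x h.chart.mem (monomial a 1)) =
        coordStalk z h.chart'.mem (monomial (blowUpExp s e a) 1) := by
      rw [← blowUpHom_monomial]
      exact RingHom.congr_fun h.comp (monomial a 1)
    apply le_antisymm
    · rw [Ideal.map_map, monomialIdeal, Ideal.map_span, Ideal.span_le]
      rintro _ ⟨_, ⟨a, ha, rfl⟩, rfl⟩
      have h1 : ((b.π.stalkMap y).hom.comp (coordStalk x h.chart.mem)) (monomial a 1) = _ := hmon a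
      rw [h1]
      exact Ideal.mem_map_of_mem _ (monomial_mem_monomialIdeal ⟨a, ha, fun _ _ => le_rfl⟩)
    · rw [monomialIdeal, Ideal.map_span, Ideal.span_le]
      rintro _ ⟨_, ⟨c, ⟨a, ha, hac⟩, rfl⟩, rfl⟩
      have ha' : a.filter (· ∈ faces x (b.π y)) ∈ W :=
        hW a ha _ fun j hj => (Finsupp.filter_apply_pos _ _ hj).ge
      have hle : a.filter (· ∈ faces x (b.π y)) ≤ a := by
        intro j
        by_cases hj : j ∈ faces x (b.π y)
        · rw [Finsupp.filter_apply_pos _ _ hj]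
        · rw [Finsupp.filter_apply_neg _ _ hj]
          exact Nat.zero_le _
      refine Ideal.mem_of_dvd _ (map_monomial_dvd (F := faces z y)
        (a := blowUpExp s e (a.filter (· ∈ faces x (b.π y)))) ?_ ?_) (?_ : coordStalk z h.chart'.mem
          (monomial (blowUpExp s e (a.filter (· ∈ faces x (b.π y)))) 1) ∈ _)
      · intro j hj hne
        refine h.isUnit j ?_ hj
        by_contra hjx
        refine hne ?_
        simp only [blowUpExp, Finsupp.add_apply, Finsupp.smul_apply, h.exp_support j hj, smul_zero,
          add_zero]
        exact Finsupp.filter_apply_neg _ _ hjx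
      · intro j hj
        refine le_trans ?_ (hac j hj)
        simp only [blowUpExp, Finsupp.add_apply, Finsupp.smul_apply, smul_eq_mul]
        exact add_le_add (hle j) (Nat.mul_le_mul_right _ (Finset.sum_le_sum fun i _ => hle i))
      · rw [← hmon]
        exact Ideal.mem_map_of_mem _ (Ideal.mem_map_of_mem _ (monomial_mem_monomialIdeal ha'))

theorem isMonomialAt_exceptionalIdeal (h : b.IsFrame x z s e y) :
    P'.IsMonomialAt y (stalkIdeal b.exceptionalIdeal y) := by
  rw [h.chart'.isMonomialAt_iff, h.exceptional]
  refine ⟨{c | ∀ j ∈ faces z y, e j ≤ c j}, fun c hc d hcd j hj => (hc j hj).trans (hcd j hj), ?_⟩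
  apply le_antisymm
  · rw [Ideal.span_singleton_le_iff_mem]
    exact Ideal.mem_map_of_mem _ (monomial_mem_monomialIdeal fun _ _ => le_rfl)
  · rw [monomialIdeal, Ideal.map_span, Ideal.span_le]
    rintro _ ⟨_, ⟨c, hc, rfl⟩, rfl⟩
    rw [SetLike.mem_coe, Ideal.mem_span_singleton]
    exact map_monomial_dvd (fun j hj hne => absurd (h.exp_support j hj) hne) hc

/-- The equation of the exceptional divisor is a regular monomial, so dividing by it is a colon,
which flatness computes on exponents. -/
theorem isMonomialAt_of_mul (h : b.IsFrame x z s e y) {𝔠 : Ideal (P'.X.presheaf.stalk y)}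
    (h𝔠 : P'.IsMonomialAt y (stalkIdeal b.exceptionalIdeal y * 𝔠)) : P'.IsMonomialAt y 𝔠 := by
  obtain ⟨W, hW, hWeq⟩ := h.chart'.isMonomialAt_iff.mp h𝔠
  rw [h.exceptional] at hWeq
  have hψ := h.chart'.isToricFrame.flat
  refine h.chart'.isMonomialAt_iff.mpr ⟨{a | e + a ∈ W}, hW.colon e, le_antisymm ?_ ?_⟩
  · intro t ht
    refine flat_colon hψ (r := monomial e 1) (I := monomialIdeal k W)
      (fun p hp => mem_monomialIdeal_of_monomial_mul_mem hW.isUpperSet e hp) ?_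
    rw [← hWeq]
    exact Ideal.mul_mem_mul (Ideal.mem_span_singleton_self _) ht
  · rw [monomialIdeal, Ideal.map_span, Ideal.span_le]
    rintro _ ⟨_, ⟨a, ha, rfl⟩, rfl⟩
    have h1 : coordStalk z h.chart'.mem (monomial (e + a) 1) ∈
        (monomialIdeal k W).map (coordStalk z h.chart'.mem) :=
      Ideal.mem_map_of_mem _ (monomial_mem_monomialIdeal ha)
    rw [← hWeq, monomial_add_one, map_mul] at h1
    obtain ⟨t, ht, hta⟩ := Ideal.mem_span_singleton_mul.mp h1
    have h2 : coordStalk z h.chart'.mem (monomial e 1) ∈ nonZeroDivisors _ :=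
      map_mem_nonZeroDivisors_of_flat hψ (mem_nonZeroDivisors_of_ne_zero (by simp))
    have h3 : (t - coordStalk z h.chart'.mem (monomial a 1)) *
        coordStalk z h.chart'.mem (monomial e 1) = 0 := by
      rw [sub_mul, mul_comm t, hta, mul_comm, sub_self]
    change coordStalk z h.chart'.mem (monomial a 1) ∈ _
    rwa [← sub_eq_zero.mp (mem_nonZeroDivisors_iff_right.mp h2 _ h3)]

end IsFrame

theorem isToroidal_comap (b : PairBlowUp P P') (hP : P.IsLocallySnc)
    (hZ : P.IsToroidalCenter b.Z) {I : P.X.IdealSheafData} (hI : P.IsToroidal I) :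
    P'.IsToroidal (I.comap b.π) := by
  rw [(b.isLocallySnc hP hZ).isToroidal_iff]
  intro y
  obtain ⟨U, n, x, V, z, s, e, h⟩ := exists_isFrame hP hZ y
  rw [stalkIdeal_comap]
  exact h.isMonomialAt_map (hP.isToroidal_iff.mp hI _)

theorem isToroidal_exceptionalIdeal (b : PairBlowUp P P') (hP : P.IsLocallySnc)
    (hZ : P.IsToroidalCenter b.Z) : P'.IsToroidal b.exceptionalIdeal := by
  rw [(b.isLocallySnc hP hZ).isToroidal_iff]
  intro y
  obtain ⟨U, n, x, V, z, s, e, h⟩ := exists_isFrame hP hZ y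
  exact h.isMonomialAt_exceptionalIdeal

theorem isToroidal_pow_mul (b : PairBlowUp P P') (hP : P.IsLocallySnc)
    (hZ : P.IsToroidalCenter b.Z) {I : P'.X.IdealSheafData} (hI : P'.IsToroidal I) (m : ℕ) :
    P'.IsToroidal (b.exceptionalIdeal ^ m * I) := by
  induction m with
  | zero => rwa [pow_zero, one_mul]
  | succ m ih =>
    rw [pow_succ', mul_assoc]
    exact (b.isLocallySnc hP hZ).isToroidal_mul (b.isToroidal_exceptionalIdeal hP hZ) ih

theorem isToroidal_of_pow_mul (b : PairBlowUp P P') (hP : P.IsLocallySnc)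
    (hZ : P.IsToroidalCenter b.Z) {I : P'.X.IdealSheafData} {m : ℕ}
    (hI : P'.IsToroidal (b.exceptionalIdeal ^ m * I)) : P'.IsToroidal I := by
  induction m with
  | zero => rwa [pow_zero, one_mul] at hI
  | succ m ih =>
    refine ih ?_
    rw [pow_succ', mul_assoc, (b.isLocallySnc hP hZ).isToroidal_iff] at hI
    rw [(b.isLocallySnc hP hZ).isToroidal_iff]
    intro y
    obtain ⟨U, n, x, V, z, s, e, h⟩ := exists_isFrame hP hZ y
    have h1 := hI y
    rw [stalkIdeal_mul] at h1
    exact h.isMonomialAt_of_mul h1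

/-- A toroidal ideal sheaf that contains the pull-back of `J` contains the pull-back of `Jᵗ`. -/
theorem comap_toroidalHull_le (b : PairBlowUp P P') (hP : P.IsLocallySnc)
    (hZ : P.IsToroidalCenter b.Z) {J : P.X.IdealSheafData} {L : P'.X.IdealSheafData}
    (hL : P'.IsToroidal L) (h : J.comap b.π ≤ L) : (P.toroidalHull J).comap b.π ≤ L := by
  rw [le_iff_stalkIdeal_le]
  intro y
  obtain ⟨U, n, x, V, z, s, e, hf⟩ := exists_isFrame hP hZ y
  obtain ⟨W, hW, hLW⟩ := hf.chart'.isMonomialAt_iff.mp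
    ((b.isLocallySnc hP hZ).isToroidal_iff.mp hL y)
  have h1 := stalkIdeal_mono h y
  rw [stalkIdeal_comap, hLW, Ideal.map_le_iff_le_comap] at h1
  -- The exponents that the substitution sends into `W` define a monomial ideal at `b.π y`. It
  -- contains `J` there by `comap_le`, hence also the hull.
  obtain ⟨I, hI, hJI, hIy⟩ := hP.exists_isToroidal_stalkIdeal_le
    (hf.chart.isMonomialAt_map (hW.preimage_blowUpExp hf.subset hf.faces_subset))
    (h1.trans (hf.comap_le W hW))
  rw [stalkIdeal_comap, hLW]
  refine (Ideal.map_mono ((stalkIdeal_mono (hP.toroidalHull_le hI hJI) _).trans hIy)).trans ?_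
  rw [Ideal.map_map, hf.comp, ← Ideal.map_map]
  exact Ideal.map_mono (map_monomialIdeal_blowUpHom_le s e W)

theorem pow_mul_le (b : PairBlowUp P P') (m : ℕ) (K : P'.X.IdealSheafData) :
    b.exceptionalIdeal ^ m * K ≤ b.exceptionalIdeal ^ m := by
  rw [le_iff_stalkIdeal_le]
  intro y
  rw [stalkIdeal_mul]
  exact Ideal.mul_le_left

/-- The toroidal ideal `E^m · J'ᵗ` contains the pull-back of `J`, hence that of `Jᵗ`. So the latter
is `E^m · K` for some `K`, which is toroidal and contains `J'`, hence contains `J'ᵗ`. -/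
theorem isBirationalTransform_toroidalHull (b : PairBlowUp P P') (hP : P.IsLocallySnc)
    (hZ : P.IsToroidalCenter b.Z) {m : ℕ} {J : P.X.IdealSheafData}
    {J' : P'.X.IdealSheafData} (h : b.IsBirationalTransform m J J') :
    b.IsBirationalTransform m (P.toroidalHull J) (P'.toroidalHull J') := by
  have hP' := b.isLocallySnc hP hZ
  have := hP'.isLocallyNoetherian
  have hE : IsCartier (b.exceptionalIdeal ^ m) := IsCartier.pow b.isBlowUp.1 m
  have h1 : (P.toroidalHull J).comap b.π ≤ b.exceptionalIdeal ^ m * P'.toroidalHull J' := by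
    refine b.comap_toroidalHull_le hP hZ
      (b.isToroidal_pow_mul hP hZ (hP'.isToroidal_toroidalHull J') m) ?_
    rw [← h]
    exact mul_le_mul_right (hP'.le_toroidalHull J') _
  obtain ⟨K, hK⟩ := hE.exists_mul_eq (K := (P.toroidalHull J).comap b.π)
    (h1.trans (b.pow_mul_le m _))
  refine le_antisymm ?_ h1
  rw [← hK]
  refine mul_le_mul_right (hP'.toroidalHull_le (b.isToroidal_of_pow_mul hP hZ (m := m) ?_)
    (hE.le_of_mul_le_mul ?_)) _
  · rw [hK]
    exact b.isToroidal_comap hP hZ (hP.isToroidal_toroidalHull J)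
  · rw [hK, h]
    exact Scheme.IdealSheafData.comap_mono b.π (hP.le_toroidalHull J)

/-- The pull-back of `J` lies in that of `Jᵗ`, so it is divisible by `E^m` too; cancelling the
Cartier ideal `E^m` identifies the hull of the quotient with `K`. -/
theorem exists_isBirationalTransform (b : PairBlowUp P P') (hP : P.IsLocallySnc)
    (hZ : P.IsToroidalCenter b.Z) {m : ℕ} {J : P.X.IdealSheafData}
    {K : P'.X.IdealSheafData} (h : b.IsBirationalTransform m (P.toroidalHull J) K) :
    ∃ J', b.IsBirationalTransform m J J' ∧ P'.toroidalHull J' = K := by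
  have hP' := b.isLocallySnc hP hZ
  have := hP'.isLocallyNoetherian
  have hE : IsCartier (b.exceptionalIdeal ^ m) := IsCartier.pow b.isBlowUp.1 m
  obtain ⟨J', hJ'⟩ := hE.exists_mul_eq (K := J.comap b.π)
    ((Scheme.IdealSheafData.comap_mono b.π (hP.le_toroidalHull J)).trans
      (h.symm.le.trans (b.pow_mul_le m K)))
  refine ⟨J', hJ', ?_⟩
  have h1 := b.isBirationalTransform_toroidalHull hP hZ hJ'
  have h2 : b.exceptionalIdeal ^ m * P'.toroidalHull J' = b.exceptionalIdeal ^ m * K :=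
    h1.trans h.symm
  exact le_antisymm (hE.le_of_mul_le_mul h2.le) (hE.le_of_mul_le_mul h2.ge)

end PairBlowUp

/-! ### Induction along a blow-up sequence -/

namespace BlowUpSequence

theorem isToroidallyEquimultiple_toroidalHull_iff {P : LogPair k} (S : BlowUpSequence P)
    (hP : P.IsLocallySnc) (J : P.X.IdealSheafData) :
    S.IsToroidallyEquimultiple (P.toroidalHull J) ↔ S.IsToroidallyEquimultiple J := by
  induction S with
  | nil => exact Iff.rfl
  | cons b S ih =>
    refine and_congr_right fun hZ => exists_congr fun m => and_congr
      (hP.isToroidallyEquimultiple_toroidalHull_iff J b.Z m) ⟨?_, ?_⟩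
    · rintro ⟨K, hK, hS⟩
      obtain ⟨J', hJ', rfl⟩ := b.exists_isBirationalTransform hP hZ hK
      exact ⟨J', hJ', (ih (b.isLocallySnc hP hZ) J').mp hS⟩
    · rintro ⟨J', hJ', hS⟩
      exact ⟨_, b.isBirationalTransform_toroidalHull hP hZ hJ',
        (ih (b.isLocallySnc hP hZ) J').mpr hS⟩

/-- The induction keeps the ideal toroidal: pull-back and division by the exceptional divisor
preserve this. Normal crossings of the centers are automatic. -/
theorem isToroidallyEquimultiple_iff {P : LogPair k} (S : BlowUpSequence P)
    (hP : P.IsLocallySnc) {I : P.X.IdealSheafData} (hI : P.IsToroidal I) :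
    S.IsToroidallyEquimultiple I ↔ S.IsToroidal ∧ S.IsEquimultiple I := by
  induction S with
  | nil => exact ⟨fun _ => ⟨trivial, trivial⟩, fun _ => trivial⟩
  | @cons P P' b S ih =>
    have key (hZ : P.IsToroidalCenter b.Z) (m : ℕ) (I' : P'.X.IdealSheafData)
        (h : b.IsBirationalTransform m I I') :
        S.IsToroidallyEquimultiple I' ↔ S.IsToroidal ∧ S.IsEquimultiple I' := by
      refine ih (b.isLocallySnc hP hZ) (b.isToroidal_of_pow_mul hP hZ (m := m) ?_)
      rw [h]
      exact b.isToroidal_comap hP hZ hI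
    constructor
    · rintro ⟨hZ, m, hm, I', hI', hS⟩
      obtain ⟨h1, h2⟩ := (key hZ m I' hI').mp hS
      exact ⟨⟨hZ, h1⟩, hP.hasNormalCrossings hZ, m, (hP.isEquimultiple_iff hI hZ m).mpr hm,
        I', hI', h2⟩
    · rintro ⟨⟨hZ, h1⟩, -, m, hm, I', hI', h2⟩
      exact ⟨hZ, m, (hP.isEquimultiple_iff hI hZ m).mp hm, I', hI', (key hZ m I' hI').mpr ⟨h1, h2⟩⟩

end BlowUpSequence

end Toroidal

theorem mainTheorem6 {k : Type u} [Field k] (P : Toroidal.LogPair k) (hP : P.IsSnc)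
    (J : P.X.IdealSheafData) :
    IsLeast {I : P.X.IdealSheafData | P.IsToroidal I ∧ J ≤ I} (P.toroidalHull J) ∧
    Toroidal.toroidallyEquimultipleSequences P J =
      Toroidal.toroidallyEquimultipleSequences P (P.toroidalHull J) ∧
    Toroidal.toroidallyEquimultipleSequences P (P.toroidalHull J) =
      Toroidal.equimultipleToroidalSequences P (P.toroidalHull J) := by
  have hP' := hP.isLocallySnc
  exact ⟨hP'.isLeast_toroidalHull J,
    Set.ext fun S => (S.isToroidallyEquimultiple_toroidalHull_iff hP' J).symm,
    Set.ext fun S => S.isToroidallyEquimultiple_iff hP' (hP'.isToroidal_toroidalHull J)⟩
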